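/- Let $k$ be a field of characteristic zero and let $R=\bigoplus_{i\ge 0}R_i$ be a commutative Noetherian $\mathbb N$-graded Cohen--Macaulay ring with $R_0=k$; put $\mathfrak m=\bigoplus_{i>0}R_i$ and $d=\dim R$. Graded modules are $\mathbb Z$-graded, their morphisms are the $R$-linear maps that preserve degrees, and $[X,M]$ denotes the (finite) $k$-dimension of the space of these morphisms from $X$ to $M$, for finitely generated graded $R$-modules $X$ and $M$. A finitely generated graded $R$-module $M$ is called graded Cohen--Macaulay if $\mathrm{Ext}^i_R(R/\mathfrak m,M)=0$ for all $i<d$. Let $V=k[[t]]$ and $K=V_t=k((t))$, both placed in degree $0$. For finitely generated graded $R$-modules $M$ and $N$, we say that $M$ gradually degenerates to $N$ if there is a finitely generated graded $R\otimes_k V$-module $Q$ such that $Q$ is flat over $V$, $Q\otimes_V V/tV\cong N$ as graded $R$-modules, and $Q\otimes_V K\cong M\otimes_k K$ as graded $R\otimes_k K$-modules. **Lemma 3.9 (Cancellation property).** Let $M$, $N$ and $X$ be finitely generated graded $R$-modules. (1) Assume that $[X,M]=[X,N]$. If $M\oplus X$ gradually degenerates to $N\oplus X$, then $M$ gradually degenerates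 to $N$. (2) Assume that $R$ is Gorenstein and that $M$ and $N$ are graded Cohen--Macaulay. Let $F$ be a finitely generated graded free $R$-module, and suppose that $M$ gradually degenerates to $N\oplus F$. Then $F$ is isomorphic to a graded direct summand of $M$, and for every split injective morphism of graded modules $F\to M$ the quotient $M/F$ gradually degenerates to $N$. -/

import Mathlib

open scoped TensorProduct PowerSeries

universe u

namespace GradedDegeneration

/-- `ℳ` is a `ℤ`-grading on the module `M` over the `ℕ`-graded ring `(A, 𝒜)`: the module `M` is the
internal direct sum of the pieces `ℳ n`, and `𝒜 i • ℳ n ⊆ ℳ (i + n)`. The pieces are taken to be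
submodules over a base ring `S` that lies in degree zero of `A`. -/
structure IsGradedModule {S A M : Type*} [CommRing S] [CommRing A] [Algebra S A]
    [AddCommGroup M] [Module S M] [Module A M]
    (𝒜 : ℕ → Submodule S A) (ℳ : ℤ → Submodule S M) : Prop where
  isInternal : DirectSum.IsInternal ℳ
  smul_mem : ∀ ⦃i : ℕ⦄ ⦃n : ℤ⦄ ⦃a : A⦄ ⦃m : M⦄, a ∈ 𝒜 i → m ∈ ℳ n → a • m ∈ ℳ ((i : ℤ) + n)

/-- The localization `K = V_t` of `V = k[[t]]` at `t`, i.e. the field `k((t))`. -/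
abbrev Loc (k : Type u) [Field k] : Type u := Localization.Away (PowerSeries.X : k⟦X⟧)

section

variable {k R : Type u} [Field k] [CommRing R] [Algebra k R]

/-- The grading of `M ⊕ N`. -/
def prodGrading {M N : Type*} [AddCommGroup M] [Module k M] [AddCommGroup N] [Module k N]
    (ℳ : ℤ → Submodule k M) (𝒩 : ℤ → Submodule k N) : ℤ → Submodule k (M × N) :=
  fun n => (ℳ n).prod (𝒩 n)

/-- The grading induced on the quotient of `M` by an `R`-submodule `P`
(used for homogeneous `P`). -/
def quotientGrading {M : Type*} [AddCommGroup M] [Module k M] [Module R M] [IsScalarTower k R M]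
    (ℳ : ℤ → Submodule k M) (P : Submodule R M) : ℤ → Submodule k (M ⧸ P) :=
  fun n => (ℳ n).map (P.mkQ.restrictScalars k)

/-- An `R`-linear map is a morphism of graded modules if it preserves degrees. -/
def IsHomogeneousMap {M N : Type*} [AddCommGroup M] [Module k M] [Module R M]
    [AddCommGroup N] [Module k N] [Module R N]
    (ℳ : ℤ → Submodule k M) (𝒩 : ℤ → Submodule k N) (f : M →ₗ[R] N) : Prop :=
  ∀ n, ∀ m ∈ ℳ n, f m ∈ 𝒩 n

/-- The `k`-vector space of morphisms of graded `R`-modules (of degree zero) from `M` to `N`. -/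
def gradedHom {M N : Type*} [AddCommGroup M] [Module k M] [Module R M] [IsScalarTower k R M]
    [AddCommGroup N] [Module k N] [Module R N] [IsScalarTower k R N]
    (ℳ : ℤ → Submodule k M) (𝒩 : ℤ → Submodule k N) : Submodule k (M →ₗ[R] N) where
  carrier := {f | IsHomogeneousMap ℳ 𝒩 f}
  zero_mem' := fun n _ _ => (𝒩 n).zero_mem
  add_mem' := fun hf hg n m hm => (𝒩 n).add_mem (hf n m hm) (hg n m hm)
  smul_mem' := fun c _ hf n m hm => (𝒩 n).smul_mem c (hf n m hm)

variable (R) in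
/-- `[M, N]`, the dimension over `k` of the space of morphisms of graded `R`-modules from `M` to
`N`. -/
noncomputable def homDim {M N : Type*}
    [AddCommGroup M] [Module k M] [Module R M] [IsScalarTower k R M]
    [AddCommGroup N] [Module k N] [Module R N] [IsScalarTower k R N]
    (ℳ : ℤ → Submodule k M) (𝒩 : ℤ → Submodule k N) : ℕ :=
  Module.finrank k (gradedHom (R := R) ℳ 𝒩)

variable (R) in
/-- A graded free module: one that has a basis of homogeneous elements, i.e. a direct sum of
shifts `R(a)`. -/
def IsGradedFree {F : Type u} [AddCommGroup F] [Module k F] [Module R F]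
    (ℱ : ℤ → Submodule k F) : Prop :=
  ∃ (ι : Type u) (b : Module.Basis ι R F) (d : ι → ℤ), ∀ i, b i ∈ ℱ (d i)

/-- `M` gradually degenerates to `N`. Let `V = k[[t]]`, `K = V_t = k((t))`, both in degree zero.
There is a finitely generated graded module `Q` over `V ⊗ R`, where `V ⊗ R` carries the grading
with pieces `V ⊗ 𝒜 i`, such that
* `Q` is flat over `V`;
* there is an isomorphism `e` of graded `R`-modules from `V/tV ⊗_V Q` to `N`;
* there is an isomorphism `e` of graded `K ⊗ R`-modules from `K ⊗_V Q` to `K ⊗_k M`, that is, one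
  which is `K`-linear, compatible with the action of `R`, and respects the degrees.

In both tensor products `R` acts through the right-hand factor (on `Q` through `R → V ⊗ R`,
`r ↦ 1 ⊗ r`), and the piece of degree `n` is the base change of the piece of degree `n`. -/
def Degenerates (𝒜 : ℕ → Submodule k R) {M N : Type u}
    [AddCommGroup M] [Module k M] [Module R M] [IsScalarTower k R M]
    [AddCommGroup N] [Module k N] [Module R N]
    (ℳ : ℤ → Submodule k M) (𝒩 : ℤ → Submodule k N) : Prop :=
  ∃ (Q : Type u) (_ : AddCommGroup Q) (_ : Module k⟦X⟧ Q) (_ : Module (k⟦X⟧ ⊗[k] R) Q)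
    (_ : IsScalarTower k⟦X⟧ (k⟦X⟧ ⊗[k] R) Q) (𝒬 : ℤ → Submodule k⟦X⟧ Q),
    IsGradedModule (fun i => (𝒜 i).baseChange k⟦X⟧) 𝒬 ∧
    Module.Finite (k⟦X⟧ ⊗[k] R) Q ∧
    Module.Flat k⟦X⟧ Q ∧
    (∃ e : ((k⟦X⟧ ⧸ Ideal.span {(PowerSeries.X : k⟦X⟧)}) ⊗[k⟦X⟧] Q) ≃ₗ[k] N,
      (∀ (r : R) (x : (k⟦X⟧ ⧸ Ideal.span {(PowerSeries.X : k⟦X⟧)}) ⊗[k⟦X⟧] Q),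
        e ((Algebra.lsmul k⟦X⟧ k⟦X⟧ Q ((1 : k⟦X⟧) ⊗ₜ[k] r)).baseChange _ x) = r • e x) ∧
      (∀ (n : ℤ) (x : (k⟦X⟧ ⧸ Ideal.span {(PowerSeries.X : k⟦X⟧)}) ⊗[k⟦X⟧] Q),
        e x ∈ 𝒩 n ↔ x ∈ (𝒬 n).baseChange (k⟦X⟧ ⧸ Ideal.span {(PowerSeries.X : k⟦X⟧)}))) ∧
    (∃ e : (Loc k ⊗[k⟦X⟧] Q) ≃ₗ[Loc k] (Loc k ⊗[k] M),
      (∀ (r : R) (x : Loc k ⊗[k⟦X⟧] Q),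
        e ((Algebra.lsmul k⟦X⟧ k⟦X⟧ Q ((1 : k⟦X⟧) ⊗ₜ[k] r)).baseChange (Loc k) x) =
          (Algebra.lsmul k k M r).baseChange (Loc k) (e x)) ∧
      (∀ (n : ℤ) (x : Loc k ⊗[k⟦X⟧] Q),
        e x ∈ (ℳ n).baseChange (Loc k) ↔ x ∈ (𝒬 n).baseChange (Loc k)))

/-- A graded module `M` over `R` is graded Cohen-Macaulay if `Ext^i_R(R/𝔪, M) = 0` for all
`i < dim R`, where `𝔪` is the ideal of elements of positive degree. As `R/𝔪` is finitely generated
(and `R` is Noetherian), the graded `Ext` module has the usual `Ext` as its underlying module. -/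
def IsGradedCM (𝒜 : ℕ → Submodule k R) [GradedAlgebra 𝒜] (M : Type u)
    [AddCommGroup M] [Module R M] : Prop :=
  ∀ i : ℕ, (i : WithBot ℕ∞) < ringKrullDim R →
    Subsingleton (CategoryTheory.Abelian.Ext
      (ModuleCat.of R (R ⧸ (HomogeneousIdeal.irrelevant 𝒜).toIdeal)) (ModuleCat.of R M) i)

/-- A (Noetherian) ring is Gorenstein if its localization at each prime ideal has finite injective
dimension as a module over itself. -/
def IsGorenstein (A : Type u) [CommRing A] : Prop :=
  ∀ (p : Ideal A) [p.IsPrime], ∃ n : ℕ, CategoryTheory.HasInjectiveDimensionLE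
    (ModuleCat.of (Localization.AtPrime p) (Localization.AtPrime p)) n

end

end GradedDegeneration

/-!
A degeneration of `M` to `N` is a flat family `Q` over `k[[t]]` together with a reduction
`π : Q → N` with kernel `tQ` and a map `ι : Q → M ⊗ K` inverting `t`.

If `M ⊕ X` degenerates to `N ⊕ X` and `[X, M] = [X, N]`, then every graded morphism from `X` to the
special fibre `N ⊕ X` lifts to a morphism `X ⊗ k[[t]] → Q`: the reduction of the finite free
`k[[t]]`-module of graded morphisms `X ⊗ k[[t]] → Q` is injective, and its rank is
`[X, M ⊕ X] = [X, N ⊕ X]`. Lift the inclusion `X → N ⊕ X` to `f`. After adding to `f` a multiple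
`t ^ n` of the inclusion of `X` into the generic fibre, the component of `f` in `X ⊗ K` becomes
bijective; then the cokernel of `f` is a flat family with special fibre `N` and generic fibre `M`.

If `M` degenerates to `N ⊕ F` with `F` free, then `F → N ⊕ F` lifts for trivial reasons. When `R` is
Gorenstein and `N` is Cohen–Macaulay, `Ext¹(N ⊕ F, R)` vanishes at the irrelevant ideal, so the
projection `N ⊕ F → F` also lifts to `Q`. The two lifts make `F ⊗ K` a direct summand of `M ⊗ K`,
and a splitting over `k` is found by specialising the coefficients to a point of `k` where a nonzero
determinant does not vanish. The previous argument then gives the degeneration of `M / F` to `N`.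
-/

namespace GradedDegeneration

section Projections

variable {S S' M T : Type*} [CommRing S] [CommRing S'] [AddCommGroup M] [Module S M]
  [AddCommGroup T] [Module S' T] {ℳ : ℤ → Submodule S M} {𝒯 : ℤ → Submodule S' T}

/-- The projection of `M = ⨁ ℳ n` onto its piece of degree `n`, as an endomorphism of `M`. -/
noncomputable def proj (h : DirectSum.IsInternal ℳ) (n : ℤ) : M →ₗ[S] M :=
  (ℳ n).subtype ∘ₗ DirectSum.component S ℤ (fun i => ℳ i) n ∘ₗ
    (LinearEquiv.ofBijective (DirectSum.coeLinearMap ℳ) h).symm.toLinearMap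

theorem proj_mem (h : DirectSum.IsInternal ℳ) (n : ℤ) (m : M) : proj h n m ∈ ℳ n :=
  Submodule.coe_mem _

theorem proj_of_mem (h : DirectSum.IsInternal ℳ) {n : ℤ} {m : M} (hm : m ∈ ℳ n) :
    proj h n m = m :=
  congrArg Subtype.val (h.ofBijective_coeLinearMap_of_mem hm)

theorem proj_of_mem_ne (h : DirectSum.IsInternal ℳ) {n i : ℤ} (hi : i ≠ n) {m : M}
    (hm : m ∈ ℳ i) : proj h n m = 0 :=
  congrArg Subtype.val (h.ofBijective_coeLinearMap_of_mem_ne hi hm)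

theorem homogeneous_induction (h : iSup ℳ = ⊤) {P : M → Prop}
    (mem : ∀ n, ∀ m ∈ ℳ n, P m) (zero : P 0) (add : ∀ x y, P x → P y → P (x + y)) (m : M) : P m :=
  Submodule.iSup_induction ℳ (motive := P) (h ▸ Submodule.mem_top) mem zero add

theorem isInternal_of_separating (h : iSup ℳ = ⊤) (p : ℤ → M →+ T)
    (inj : ∀ n, ∀ m ∈ ℳ n, p n m = 0 → m = 0)
    (kill : ∀ n i, i ≠ n → ∀ m ∈ ℳ i, p n m = 0) : DirectSum.IsInternal ℳ := by
  refine DirectSum.isInternal_submodule_of_iSupIndep_of_iSup_eq_top (fun n => ?_) h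
  rw [Submodule.disjoint_def]
  refine fun x hx hx' => inj n x hx ?_
  rw [iSup_subtype'] at hx'
  exact Submodule.iSup_induction _ (motive := fun x => p n x = 0) hx'
    (fun j m hm => kill n j j.2 m hm) (map_zero _)
    (fun x y hx hy => by rw [map_add, hx, hy, add_zero])

theorem isInternal_of_injective (f : M →+ T) (hf : Function.Injective f) (hℳ : iSup ℳ = ⊤)
    (h𝒯 : DirectSum.IsInternal 𝒯) (hfg : ∀ n, ∀ m ∈ ℳ n, f m ∈ 𝒯 n) : DirectSum.IsInternal ℳ :=
  isInternal_of_separating hℳ (fun n => (proj h𝒯 n).toAddMonoidHom.comp f)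
    (fun n m hm h0 => (map_eq_zero_iff f hf).1 ((proj_of_mem h𝒯 (hfg n m hm)).symm.trans h0))
    (fun _ i hi m hm => proj_of_mem_ne h𝒯 hi (hfg i m hm))

theorem proj_comp_of_graded (hℳ : DirectSum.IsInternal ℳ) (h𝒯 : DirectSum.IsInternal 𝒯)
    {f : M →+ T} (hf : ∀ n, ∀ m ∈ ℳ n, f m ∈ 𝒯 n) (n : ℤ) (m : M) :
    proj h𝒯 n (f m) = f (proj hℳ n m) := by
  refine homogeneous_induction (P := fun m => proj h𝒯 n (f m) = f (proj hℳ n m))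
    hℳ.submodule_iSup_eq_top (fun i x hx => ?_) (by simp only [map_zero])
    (fun x y hx hy => by simp only [map_add, hx, hy]) m
  by_cases hi : i = n
  · subst hi
    rw [proj_of_mem _ hx, proj_of_mem _ (hf _ _ hx)]
  · rw [proj_of_mem_ne _ hi hx, proj_of_mem_ne _ hi (hf _ _ hx), map_zero]

theorem mem_iff_of_injective {f : M →+ T} (hf : Function.Injective f) (hℳ : iSup ℳ = ⊤)
    (h𝒯 : DirectSum.IsInternal 𝒯) (hfg : ∀ n, ∀ m ∈ ℳ n, f m ∈ 𝒯 n) (n : ℤ) (m : M) :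
    f m ∈ 𝒯 n ↔ m ∈ ℳ n := by
  refine ⟨fun h => ?_, hfg n m⟩
  have hℳ := isInternal_of_injective f hf hℳ h𝒯 hfg
  rw [← hf ((proj_comp_of_graded hℳ h𝒯 hfg n m).symm.trans (proj_of_mem h𝒯 h))]
  exact proj_mem hℳ n m

/-- The degree zero part of a linear map `f`: on `ℳ n` it is `f` followed by the projection onto
`𝒯 n`. -/
noncomputable def degreeZeroPart {T : Type*} [AddCommGroup T] [Module S T] {𝒯 : ℤ → Submodule S T}
    (hℳ : DirectSum.IsInternal ℳ) (h𝒯 : DirectSum.IsInternal 𝒯) (f : M →ₗ[S] T) : M →ₗ[S] T :=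
  DirectSum.toModule S ℤ T (fun n => proj h𝒯 n ∘ₗ f ∘ₗ (ℳ n).subtype) ∘ₗ
    (LinearEquiv.ofBijective (DirectSum.coeLinearMap ℳ) hℳ).symm.toLinearMap

theorem degreeZeroPart_apply {T : Type*} [AddCommGroup T] [Module S T] {𝒯 : ℤ → Submodule S T}
    (hℳ : DirectSum.IsInternal ℳ) (h𝒯 : DirectSum.IsInternal 𝒯) (f : M →ₗ[S] T) {n : ℤ} {m : M}
    (hm : m ∈ ℳ n) : degreeZeroPart hℳ h𝒯 f m = proj h𝒯 n (f m) := by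
  have : (LinearEquiv.ofBijective (DirectSum.coeLinearMap ℳ) hℳ).symm m =
      DirectSum.lof S ℤ (fun i => ℳ i) n ⟨m, hm⟩ :=
    (LinearEquiv.symm_apply_eq _).2 (DirectSum.coeLinearMap_lof ℳ n ⟨m, hm⟩).symm
  rw [degreeZeroPart, LinearMap.comp_apply, LinearEquiv.coe_coe, this, DirectSum.toModule_lof]
  rfl

theorem isInternal_prodGrading {k M N : Type*} [Field k] [AddCommGroup M] [Module k M]
    [AddCommGroup N] [Module k N] {ℳ : ℤ → Submodule k M} {𝒩 : ℤ → Submodule k N}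
    (hℳ : DirectSum.IsInternal ℳ) (h𝒩 : DirectSum.IsInternal 𝒩) :
    DirectSum.IsInternal (prodGrading ℳ 𝒩) := by
  refine isInternal_of_separating ?_
    (fun n => ((proj hℳ n).prodMap (proj h𝒩 n)).toAddMonoidHom) ?_ ?_
  · have hM : (⊤ : Submodule k M) ≤ (iSup (prodGrading ℳ 𝒩)).comap (LinearMap.inl k M N) := by
      rw [← hℳ.submodule_iSup_eq_top]
      exact iSup_le fun n x hx => Submodule.mem_iSup_of_mem n ⟨hx, zero_mem _⟩
    have hN : (⊤ : Submodule k N) ≤ (iSup (prodGrading ℳ 𝒩)).comap (LinearMap.inr k M N) := by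
      rw [← h𝒩.submodule_iSup_eq_top]
      exact iSup_le fun n x hx => Submodule.mem_iSup_of_mem n ⟨zero_mem _, hx⟩
    rw [eq_top_iff, ← Submodule.prod_top, Submodule.prod_le_iff]
    exact ⟨Submodule.map_le_iff_le_comap.2 hM, Submodule.map_le_iff_le_comap.2 hN⟩
  · rintro n ⟨x, y⟩ ⟨hx, hy⟩ h0
    rw [Prod.ext_iff]
    exact ⟨(proj_of_mem hℳ hx).symm.trans (congrArg Prod.fst h0),
      (proj_of_mem h𝒩 hy).symm.trans (congrArg Prod.snd h0)⟩
  · rintro n i hi ⟨x, y⟩ ⟨hx, hy⟩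
    exact Prod.ext (proj_of_mem_ne hℳ hi hx) (proj_of_mem_ne h𝒩 hi hy)

end Projections

namespace IsGradedModule

variable {S A M : Type*} [CommRing S] [CommRing A] [Algebra S A] [AddCommGroup M] [Module S M]
  [Module A M] {𝒜 : ℕ → Submodule S A} {ℳ : ℤ → Submodule S M}

theorem exists_finset_span_eq_top [Module.Finite A M] (h : IsGradedModule 𝒜 ℳ) :
    ∃ s : Finset ℤ, Submodule.span A (⋃ n ∈ s, (ℳ n : Set M)) = ⊤ := by
  have hspan : ⨆ n, Submodule.span A (ℳ n : Set M) = ⊤ := by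
    rw [eq_top_iff]
    exact fun m _ => homogeneous_induction (P := (· ∈ ⨆ n, Submodule.span A (ℳ n : Set M)))
      h.isInternal.submodule_iSup_eq_top
      (fun n x hx => Submodule.mem_iSup_of_mem n (Submodule.subset_span hx)) (zero_mem _)
      (fun _ _ => add_mem) m
  obtain ⟨s, hs⟩ := CompleteLattice.IsCompactElement.exists_finset_of_le_iSup (Submodule A M)
    ((Submodule.fg_iff_compact _).1 Module.Finite.fg_top) _ hspan.ge
  refine ⟨s, top_le_iff.1 (hs.trans ?_)⟩
  exact iSup₂_le fun n hn => Submodule.span_mono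
    (Set.subset_biUnion_of_mem (u := fun n => (ℳ n : Set M)) hn)

theorem proj_smul_of_mem [GradedAlgebra 𝒜] (h : IsGradedModule 𝒜 ℳ) {n : ℤ} {m : M}
    (hm : m ∈ ℳ n) (a : A) :
    proj h.isInternal n (a • m) = (DirectSum.decompose 𝒜 a 0 : A) • m := by
  induction a using DirectSum.Decomposition.inductionOn 𝒜 with
  | zero => simp
  | @homogeneous i a =>
    by_cases hi : i = 0
    · subst hi
      rw [DirectSum.decompose_coe, DirectSum.of_eq_same, proj_of_mem]
      simpa using h.smul_mem a.2 hm
    · rw [proj_of_mem_ne _ (by omega) (h.smul_mem a.2 hm),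
        DirectSum.decompose_of_mem_ne 𝒜 a.2 hi, zero_smul]
  | add a b ha hb =>
    rw [add_smul, map_add, ha, hb, DirectSum.decompose_add, DirectSum.add_apply,
      Submodule.coe_add, add_smul]

theorem isNoetherian_piece [IsScalarTower S A M] [GradedAlgebra 𝒜] [IsNoetherian A M]
    (h₀ : ∀ a ∈ 𝒜 0, ∃ s : S, algebraMap S A s = a) (h : IsGradedModule 𝒜 ℳ) (n : ℤ) :
    IsNoetherian S (ℳ n) := by
  let F : Submodule S (ℳ n) → Submodule A M := fun W => Submodule.span A (W.map (ℳ n).subtype)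
  have proj_F_mem (W) : ∀ x ∈ F W, proj h.isInternal n x ∈ W.map (ℳ n).subtype := by
    refine fun x => Submodule.closure_induction (by simp)
      (fun x y _ _ hx hy => by rw [map_add]; exact add_mem hx hy) ?_
    rintro a _ ⟨w, hw, rfl⟩
    obtain ⟨s, hs⟩ := h₀ _ (DirectSum.decompose 𝒜 a 0).2
    rw [Submodule.subtype_apply, h.proj_smul_of_mem w.2, ← hs, algebraMap_smul]
    exact Submodule.smul_mem _ _ ⟨w, hw, rfl⟩
  have le_of_F_le {W W'} (hW : F W ≤ F W') : W ≤ W' := by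
    intro x hx
    have := proj_F_mem W' x (hW (Submodule.subset_span ⟨x, hx, rfl⟩))
    rw [proj_of_mem _ x.2] at this
    exact (Submodule.injective_subtype _).mem_set_image.1 this
  have hF : StrictMono F := Monotone.strictMono_of_injective
    (fun W W' hW => Submodule.span_mono (Submodule.map_mono hW))
    (fun W W' hW => le_antisymm (le_of_F_le hW.le) (le_of_F_le hW.ge))
  exact isNoetherian_iff'.2 hF.wellFoundedGT

end IsGradedModule

/-- The action of `R` on `S ⊗ M` through the right-hand factor. The priority is low so that the
action of `S` and its subrings stays the one through the left-hand factor. -/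
noncomputable scoped instance (priority := low) rightModule {k R S M : Type*} [CommRing k]
    [CommRing R] [Algebra k R] [CommRing S] [Algebra k S] [AddCommGroup M] [Module k M]
    [Module R M] [IsScalarTower k R M] : Module R (S ⊗[k] M) where
  smul r z := (Algebra.lsmul k k M r).baseChange S z
  one_smul z := by
    change (Algebra.lsmul k k M 1).baseChange S z = z
    rw [map_one, Module.End.one_eq_id, LinearMap.baseChange_id, LinearMap.id_apply]
  mul_smul r s z := by
    change (Algebra.lsmul k k M (r * s)).baseChange S z = _
    rw [map_mul, Module.End.mul_eq_comp, LinearMap.baseChange_comp]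
    rfl
  smul_zero r := map_zero _
  smul_add r := map_add _
  add_smul r s z := by
    change (Algebra.lsmul k k M (r + s)).baseChange S z = _
    rw [map_add, LinearMap.baseChange_add]
    rfl
  zero_smul z := by
    change (Algebra.lsmul k k M 0).baseChange S z = 0
    rw [map_zero, LinearMap.baseChange_zero, LinearMap.zero_apply]

section RightModule

variable {k R S M : Type*} [CommRing k] [CommRing R] [Algebra k R] [CommRing S] [Algebra k S]
  [AddCommGroup M] [Module k M] [Module R M] [IsScalarTower k R M]

theorem right_smul_tmul (r : R) (s : S) (m : M) : r • (s ⊗ₜ[k] m) = s ⊗ₜ[k] (r • m) :=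
  rfl

instance : SMulCommClass S R (S ⊗[k] M) :=
  ⟨fun s r z => (map_smul ((Algebra.lsmul k k M r).baseChange S) s z).symm⟩

instance : IsScalarTower k R (S ⊗[k] M) where
  smul_assoc c r z := by
    change (Algebra.lsmul k k M (c • r)).baseChange S z = _
    rw [map_smul, LinearMap.baseChange_smul]
    rfl

instance {T : Type*} [CommRing T] [Algebra k T] [Algebra S T] [IsScalarTower k S T] :
    SMulCommClass S R (T ⊗[k] M) where
  smul_comm s r z := by
    rw [← algebraMap_smul T s, ← algebraMap_smul T s, smul_comm]

theorem right_smul_eq_mul (r : R) (a : S ⊗[k] R) : r • a = ((1 : S) ⊗ₜ[k] r) * a := by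
  induction a with
  | zero => rw [smul_zero, mul_zero]
  | tmul s r' => rw [right_smul_tmul, Algebra.TensorProduct.tmul_mul_tmul, one_mul, smul_eq_mul]
  | add a b ha hb => rw [smul_add, ha, hb, mul_add]

theorem one_tmul_smul {Q : Type*} [AddCommGroup Q] [Module R Q] [Module (S ⊗[k] R) Q]
    [IsScalarTower R (S ⊗[k] R) Q] (r : R) (q : Q) : ((1 : S) ⊗ₜ[k] r) • q = r • q := by
  rw [← mul_one ((1 : S) ⊗ₜ[k] r), ← right_smul_eq_mul, smul_assoc, one_smul]

theorem tmul_smul_eq {Q : Type*} [AddCommGroup Q] [Module S Q] [Module R Q] [Module (S ⊗[k] R) Q]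
    [IsScalarTower S (S ⊗[k] R) Q] [IsScalarTower R (S ⊗[k] R) Q] (s : S) (r : R) (q : Q) :
    (s ⊗ₜ[k] r) • q = s • r • q := by
  rw [← one_tmul_smul (S := S) (k := k) r, ← smul_assoc, TensorProduct.smul_tmul', smul_eq_mul,
    mul_one]

end RightModule

/-- `f` commutes with the actions of `R` and preserves degrees. The source and the target may be
graded over different base rings, so `f` is a bare function. -/
structure IsGradedHom (R : Type*) {S S' P Q : Type*} [CommRing S] [CommRing S'] [AddCommGroup P]
    [Module S P] [SMul R P] [AddCommGroup Q] [Module S' Q] [SMul R Q]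
    (𝒳 : ℤ → Submodule S P) (𝒬 : ℤ → Submodule S' Q) (f : P → Q) : Prop where
  map_smul : ∀ (r : R) (x : P), f (r • x) = r • f x
  map_mem : ∀ n, ∀ x ∈ 𝒳 n, f x ∈ 𝒬 n

/-- A family `Q` over `V = k⟦X⟧` that realizes a degeneration of `M` to `N`: its special fibre is
`N`, through the reduction map `π` with kernel `XQ`, and its generic fibre is `K ⊗ M`, through the
localization map `ι`. -/
structure IsDegeneration (R : Type u) {k M N Q : Type u} [Field k] [CommRing R] [Algebra k R]
    [AddCommGroup M] [Module k M] [Module R M] [IsScalarTower k R M]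
    [AddCommGroup N] [Module k N] [Module R N] [AddCommGroup Q] [Module k⟦X⟧ Q] [Module R Q]
    (ℳ : ℤ → Submodule k M) (𝒩 : ℤ → Submodule k N) (𝒬 : ℤ → Submodule k⟦X⟧ Q)
    (π : Q →ₛₗ[PowerSeries.constantCoeff (R := k)] N) (ι : Q →ₗ[k⟦X⟧] Loc k ⊗[k] M) : Prop where
  special : IsGradedHom R 𝒬 𝒩 π
  special_surjective : Function.Surjective π
  special_ker : ∀ q, π q = 0 → ∃ q', q = (PowerSeries.X : k⟦X⟧) • q'
  generic : IsGradedHom R 𝒬 (fun n => (ℳ n).baseChange (Loc k)) ι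
  generic_injective : Function.Injective ι
  generic_surj : ∀ z, ∃ (n : ℕ) (q : Q), ι q = (PowerSeries.X : k⟦X⟧) ^ n • z

section Localization

theorem isUnit_algebraMap_X_pow {k : Type u} [Field k] (n : ℕ) :
    IsUnit (algebraMap k⟦X⟧ (Loc k) (PowerSeries.X ^ n)) :=
  map_pow (algebraMap k⟦X⟧ (Loc k)) PowerSeries.X n ▸
    (IsLocalization.Away.algebraMap_isUnit _).pow n

variable {k : Type u} {T Q : Type*} [Field k] [AddCommGroup T] [Module k⟦X⟧ T]
  [Module (Loc k) T] [IsScalarTower k⟦X⟧ (Loc k) T] [AddCommGroup Q] [Module k⟦X⟧ Q]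

theorem X_pow_smul_bijective (n : ℕ) :
    Function.Bijective fun z : T => (PowerSeries.X : k⟦X⟧) ^ n • z := by
  have h := MulAction.bijective (β := T) (isUnit_algebraMap_X_pow (k := k) n).unit
  simpa only [Units.smul_def, IsUnit.unit_spec, algebraMap_smul] using h

theorem isLocalizedModule_of_injective {ι : Q →ₗ[k⟦X⟧] T} (hι : Function.Injective ι)
    (hs : ∀ z, ∃ (n : ℕ) (q : Q), ι q = (PowerSeries.X : k⟦X⟧) ^ n • z) :
    IsLocalizedModule (Submonoid.powers (PowerSeries.X : k⟦X⟧)) ι := by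
  refine (isLocalizedModule_iff _ _).2 ⟨?_, fun z => ?_, fun h => ⟨1, by rw [hι h]⟩⟩
  · rintro ⟨_, n, rfl⟩
    exact (Module.End.isUnit_iff _).2 (X_pow_smul_bijective n)
  · obtain ⟨n, q, h⟩ := hs z
    exact ⟨(q, ⟨_, n, rfl⟩), h.symm⟩

end Localization

section BaseChange

variable {A B Q : Type*} [CommRing A] [CommRing B] [Algebra A B] [AddCommGroup Q] [Module A Q]

theorem map_mem_of_mem_baseChange {C T : Type*} [CommRing C] {σ : B →+* C} [AddCommGroup T]
    [Module C T] {p : Submodule A Q} {f : B ⊗[A] Q →ₛₗ[σ] T} {𝒯 : Submodule C T}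
    (h : ∀ q ∈ p, f (1 ⊗ₜ q) ∈ 𝒯) {x : B ⊗[A] Q} (hx : x ∈ p.baseChange B) : f x ∈ 𝒯 := by
  rw [Submodule.baseChange_eq_span] at hx
  refine (Submodule.span_le (p := 𝒯.comap f)).2 ?_ hx
  rintro _ ⟨q, hq, rfl⟩
  exact h q hq

theorem mem_baseChange_iff_of_surjective (hB : Function.Surjective (algebraMap A B))
    {p : Submodule A Q} {x : B ⊗[A] Q} : x ∈ p.baseChange B ↔ ∃ q ∈ p, 1 ⊗ₜ q = x := by
  rw [Submodule.baseChange_eq_span, ← Submodule.restrictScalars_mem A,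
    Submodule.restrictScalars_span A B hB, Submodule.span_eq, Submodule.mem_map]
  rfl

end BaseChange

section SpecialFibre

variable {k Q N : Type*} [Field k] [AddCommGroup Q] [Module k⟦X⟧ Q] [AddCommGroup N] [Module k N]

theorem exists_specialFibreEquiv {π : Q →ₛₗ[PowerSeries.constantCoeff (R := k)] N}
    (hsurj : Function.Surjective π)
    (hker : ∀ q, π q = 0 → ∃ q', q = (PowerSeries.X : k⟦X⟧) • q') :
    ∃ e : ((k⟦X⟧ ⧸ Ideal.span {(PowerSeries.X : k⟦X⟧)}) ⊗[k⟦X⟧] Q) ≃ₗ[k] N,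
      ∀ q, e (1 ⊗ₜ q) = π q := by
  let I := Ideal.span {(PowerSeries.X : k⟦X⟧)}
  have mem_iff (q : Q) : q ∈ I • (⊤ : Submodule k⟦X⟧ Q) ↔ π q = 0 := by
    rw [Submodule.ideal_span_singleton_smul, Submodule.mem_smul_pointwise_iff_exists]
    refine ⟨?_, fun hq => (hker q hq).imp fun q' h => ⟨trivial, h.symm⟩⟩
    rintro ⟨q, -, rfl⟩
    rw [map_smulₛₗ, PowerSeries.constantCoeff_X, zero_smul]
  let g := (I • (⊤ : Submodule k⟦X⟧ Q)).liftQ π fun q => (mem_iff q).1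
  have hg : Function.Bijective g := by
    refine ⟨(injective_iff_map_eq_zero g).2 fun y hy => ?_, fun n => ?_⟩
    · obtain ⟨q, rfl⟩ := Submodule.mkQ_surjective _ y
      exact (Submodule.Quotient.mk_eq_zero _).2 ((mem_iff q).2 hy)
    · obtain ⟨q, rfl⟩ := hsurj n
      exact ⟨Submodule.mkQ _ q, rfl⟩
  let e := (TensorProduct.quotTensorEquivQuotSMul Q I).toAddEquiv.trans
    (AddEquiv.ofBijective g hg)
  have he (q : Q) : e (1 ⊗ₜ q) = π q := by
    have := TensorProduct.quotTensorEquivQuotSMul_mk_tmul (M := Q) I 1 q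
    rw [map_one, one_smul] at this
    exact congrArg g this
  refine ⟨e.toLinearEquiv fun c x => ?_, he⟩
  obtain ⟨q, rfl⟩ := TensorProduct.mk_surjective _ _ _ Ideal.Quotient.mk_surjective x
  have : c • (TensorProduct.mk k⟦X⟧ (k⟦X⟧ ⧸ I) Q 1 q) = 1 ⊗ₜ (algebraMap k k⟦X⟧ c • q) := by
    rw [TensorProduct.mk_apply, TensorProduct.tmul_smul, algebraMap_smul]
  rw [this, he, TensorProduct.mk_apply, he, map_smulₛₗ]
  simp

theorem mk_eq_algebraMap_constantCoeff (v : k⟦X⟧) :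
    Ideal.Quotient.mk (Ideal.span {PowerSeries.X}) v =
      algebraMap k (k⟦X⟧ ⧸ Ideal.span {(PowerSeries.X : k⟦X⟧)}) (PowerSeries.constantCoeff v) := by
  rw [IsScalarTower.algebraMap_apply k k⟦X⟧, Ideal.Quotient.algebraMap_eq, Ideal.Quotient.eq,
    Ideal.mem_span_singleton, PowerSeries.X_dvd_iff]
  simp

theorem one_tmul_eq_zero_iff {q : Q} :
    ((1 : k⟦X⟧ ⧸ Ideal.span {(PowerSeries.X : k⟦X⟧)}) ⊗ₜ[k⟦X⟧] q) = 0 ↔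
      ∃ q', q = (PowerSeries.X : k⟦X⟧) • q' := by
  have h := TensorProduct.quotTensorEquivQuotSMul_mk_tmul (M := Q)
    (Ideal.span {(PowerSeries.X : k⟦X⟧)}) 1 q
  rw [map_one, one_smul] at h
  rw [← LinearEquiv.map_eq_zero_iff (TensorProduct.quotTensorEquivQuotSMul Q _), h,
    Submodule.Quotient.mk_eq_zero, Submodule.ideal_span_singleton_smul,
    Submodule.mem_smul_pointwise_iff_exists]
  simp [eq_comm]

end SpecialFibre

namespace IsDegeneration

variable {k R M N Q : Type u} [Field k] [CommRing R] [Algebra k R]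
  [AddCommGroup M] [Module k M] [Module R M] [IsScalarTower k R M]
  [AddCommGroup N] [Module k N] [Module R N]
  [AddCommGroup Q] [Module k⟦X⟧ Q] [Module R Q]
  {𝒜 : ℕ → Submodule k R}
  {ℳ : ℤ → Submodule k M} {𝒩 : ℤ → Submodule k N} {𝒬 : ℤ → Submodule k⟦X⟧ Q}
  {π : Q →ₛₗ[PowerSeries.constantCoeff (R := k)] N} {ι : Q →ₗ[k⟦X⟧] Loc k ⊗[k] M}

theorem X_pow_smul_injective (h : IsDegeneration R ℳ 𝒩 𝒬 π ι) (n : ℕ) :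
    Function.Injective fun q : Q => (PowerSeries.X : k⟦X⟧) ^ n • q := fun q q' hq =>
  h.generic_injective ((X_pow_smul_bijective n).injective (by
    simpa only [map_smul] using congrArg ι hq))

variable [Module (k⟦X⟧ ⊗[k] R) Q] [IsScalarTower k⟦X⟧ (k⟦X⟧ ⊗[k] R) Q]
  [IsScalarTower R (k⟦X⟧ ⊗[k] R) Q]

theorem exists_specialFibre_gradedEquiv (h : IsDegeneration R ℳ 𝒩 𝒬 π ι)
    (h𝒬 : DirectSum.IsInternal 𝒬) (h𝒩 : DirectSum.IsInternal 𝒩) :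
    ∃ e : ((k⟦X⟧ ⧸ Ideal.span {(PowerSeries.X : k⟦X⟧)}) ⊗[k⟦X⟧] Q) ≃ₗ[k] N,
      (∀ (r : R) x, e ((Algebra.lsmul k⟦X⟧ k⟦X⟧ Q ((1 : k⟦X⟧) ⊗ₜ[k] r)).baseChange _ x) =
        r • e x) ∧
      ∀ n x, e x ∈ 𝒩 n ↔
        x ∈ (𝒬 n).baseChange (k⟦X⟧ ⧸ Ideal.span {(PowerSeries.X : k⟦X⟧)}) := by
  obtain ⟨e, he⟩ := exists_specialFibreEquiv h.special_surjective h.special_ker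
  refine ⟨e, fun r x => ?_, ?_⟩
  · obtain ⟨q, rfl⟩ := TensorProduct.mk_surjective _ _ _ Ideal.Quotient.mk_surjective x
    rw [TensorProduct.mk_apply, LinearMap.baseChange_tmul, he, he, Algebra.lsmul_coe]
    exact (congrArg π (one_tmul_smul r q)).trans (h.special.map_smul r q)
  · refine mem_iff_of_injective (f := e.toAddEquiv.toAddMonoidHom) e.injective
      h𝒬.baseChange.submodule_iSup_eq_top h𝒩 fun n x hx => ?_
    obtain ⟨q, hq, rfl⟩ := (mem_baseChange_iff_of_surjective Ideal.Quotient.mk_surjective).1 hx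
    exact he q ▸ h.special.map_mem n q hq

theorem exists_genericFibre_gradedEquiv (h : IsDegeneration R ℳ 𝒩 𝒬 π ι)
    (h𝒬 : DirectSum.IsInternal 𝒬) (hℳ : DirectSum.IsInternal ℳ) :
    ∃ e : (Loc k ⊗[k⟦X⟧] Q) ≃ₗ[Loc k] (Loc k ⊗[k] M),
      (∀ (r : R) x, e ((Algebra.lsmul k⟦X⟧ k⟦X⟧ Q ((1 : k⟦X⟧) ⊗ₜ[k] r)).baseChange (Loc k) x) =
        (Algebra.lsmul k k M r).baseChange (Loc k) (e x)) ∧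
      ∀ n x, e x ∈ (ℳ n).baseChange (Loc k) ↔ x ∈ (𝒬 n).baseChange (Loc k) := by
  have := isLocalizedModule_of_injective h.generic_injective h.generic_surj
  let S := Submonoid.powers (PowerSeries.X : k⟦X⟧)
  let e := (IsLocalizedModule.linearEquiv S (TensorProduct.mk k⟦X⟧ (Loc k) Q 1)
    ι).extendScalarsOfIsLocalization S (Loc k)
  have he (q : Q) : e (1 ⊗ₜ q) = ι q :=
    IsLocalizedModule.linearEquiv_apply S (TensorProduct.mk k⟦X⟧ (Loc k) Q 1) ι q
  refine ⟨e, fun r x => ?_, ?_⟩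
  · suffices e.toLinearMap ∘ₗ (Algebra.lsmul k⟦X⟧ k⟦X⟧ Q ((1 : k⟦X⟧) ⊗ₜ[k] r)).baseChange _ =
        (Algebra.lsmul k k M r).baseChange (Loc k) ∘ₗ e.toLinearMap from
      LinearMap.congr_fun this x
    ext q
    have : e (1 ⊗ₜ (((1 : k⟦X⟧) ⊗ₜ[k] r) • q)) = r • e (1 ⊗ₜ q) := by
      rw [one_tmul_smul, he, he, h.generic.map_smul]
    exact this
  · refine mem_iff_of_injective (f := e.toAddEquiv.toAddMonoidHom) e.injective
      h𝒬.baseChange.submodule_iSup_eq_top hℳ.baseChange fun n x hx => ?_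
    exact map_mem_of_mem_baseChange (f := e.toLinearMap)
      (fun q hq => (he q).symm ▸ h.generic.map_mem n q hq) hx

theorem degenerates (h : IsDegeneration R ℳ 𝒩 𝒬 π ι)
    (h𝒬 : IsGradedModule (fun i => (𝒜 i).baseChange k⟦X⟧) 𝒬) [Module.Finite (k⟦X⟧ ⊗[k] R) Q]
    (hℳ : DirectSum.IsInternal ℳ) (h𝒩 : DirectSum.IsInternal 𝒩) : Degenerates 𝒜 ℳ 𝒩 := by
  have : Module.IsTorsionFree k⟦X⟧ Q :=
    h.generic_injective.moduleIsTorsionFree ι (map_smul ι)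
  exact ⟨Q, _, _, _, inferInstance, 𝒬, h𝒬, inferInstance, inferInstance,
    h.exists_specialFibre_gradedEquiv h𝒬.isInternal h𝒩,
    h.exists_genericFibre_gradedEquiv h𝒬.isInternal hℳ⟩

end IsDegeneration

theorem Degenerates.exists_isDegeneration {k R M N : Type u} [Field k] [CommRing R] [Algebra k R]
    [AddCommGroup M] [Module k M] [Module R M] [IsScalarTower k R M]
    [AddCommGroup N] [Module k N] [Module R N] {𝒜 : ℕ → Submodule k R}
    {ℳ : ℤ → Submodule k M} {𝒩 : ℤ → Submodule k N} (h : Degenerates 𝒜 ℳ 𝒩) :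
    ∃ (Q : Type u) (_ : AddCommGroup Q) (_ : Module k⟦X⟧ Q) (_ : Module R Q)
      (_ : Module (k⟦X⟧ ⊗[k] R) Q) (_ : IsScalarTower k⟦X⟧ (k⟦X⟧ ⊗[k] R) Q)
      (_ : IsScalarTower R (k⟦X⟧ ⊗[k] R) Q) (𝒬 : ℤ → Submodule k⟦X⟧ Q)
      (π : Q →ₛₗ[PowerSeries.constantCoeff (R := k)] N) (ι : Q →ₗ[k⟦X⟧] (Loc k ⊗[k] M)),
      IsGradedModule (fun i => (𝒜 i).baseChange k⟦X⟧) 𝒬 ∧ Module.Finite (k⟦X⟧ ⊗[k] R) Q ∧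
      IsDegeneration R ℳ 𝒩 𝒬 π ι := by
  obtain ⟨Q, _, _, _, _, 𝒬, h𝒬, _, _, ⟨e, he_smul, he_mem⟩, ⟨f, hf_smul, hf_mem⟩⟩ := h
  let I := Ideal.span {(PowerSeries.X : k⟦X⟧)}
  let S := Submonoid.powers (PowerSeries.X : k⟦X⟧)
  let : Module R Q := Module.compHom Q
    (Algebra.TensorProduct.includeRight : R →ₐ[k] k⟦X⟧ ⊗[k] R).toRingHom
  have tower : IsScalarTower R (k⟦X⟧ ⊗[k] R) Q :=
    ⟨fun r a q => by rw [right_smul_eq_mul, mul_smul]; rfl⟩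
  let π : Q →ₛₗ[PowerSeries.constantCoeff (R := k)] N :=
    { toFun q := e (1 ⊗ₜ q)
      map_add' q q' := by rw [TensorProduct.tmul_add, map_add]
      map_smul' v q := by
        rw [TensorProduct.tmul_smul, ← algebraMap_smul (k⟦X⟧ ⧸ I) v,
          Ideal.Quotient.algebraMap_eq, mk_eq_algebraMap_constantCoeff, algebraMap_smul, map_smul] }
  let ι : Q →ₗ[k⟦X⟧] (Loc k ⊗[k] M) :=
    f.toLinearMap.restrictScalars k⟦X⟧ ∘ₗ TensorProduct.mk k⟦X⟧ (Loc k) Q 1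
  refine ⟨Q, _, _, _, _, inferInstance, tower, 𝒬, π, ι, h𝒬, inferInstance,
    ⟨fun r q => he_smul r (1 ⊗ₜ q), fun n q hq =>
      (he_mem n _).2 (Submodule.tmul_mem_baseChange_of_mem _ hq)⟩, ?_, fun q hq => ?_,
    ⟨fun r q => hf_smul r (1 ⊗ₜ q), fun n q hq =>
      (hf_mem n _).2 (Submodule.tmul_mem_baseChange_of_mem _ hq)⟩, ?_, fun z => ?_⟩
  · exact e.surjective.comp (TensorProduct.mk_surjective _ _ _ Ideal.Quotient.mk_surjective)
  · exact one_tmul_eq_zero_iff.1 ((map_eq_zero_iff _ e.injective).1 hq)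
  · refine f.injective.comp fun q q' hqq' => ?_
    obtain ⟨⟨_, n, rfl⟩, hc⟩ := (IsLocalizedModule.eq_iff_exists S
      (TensorProduct.mk k⟦X⟧ (Loc k) Q 1)).1 hqq'
    exact Module.Flat.isSMulRegular_of_nonZeroDivisors
      (mem_nonZeroDivisors_of_ne_zero (pow_ne_zero n PowerSeries.X_ne_zero)) hc
  · obtain ⟨⟨q, _, n, rfl⟩, hq⟩ := IsLocalizedModule.surj S
      (TensorProduct.mk k⟦X⟧ (Loc k) Q 1) (f.symm z)
    refine ⟨n, q, (congrArg f hq.symm).trans ?_⟩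
    rw [Submonoid.smul_def, ← algebraMap_smul (Loc k), map_smul, f.apply_symm_apply,
      algebraMap_smul]

section Perturbation

theorem finite_spectrum_of_isIntegral {K E : Type*} [Field K] [Ring E] [Algebra K E] {a : E}
    (ha : IsIntegral K a) : (spectrum K a).Finite := by
  classical
  obtain _ | _ := subsingleton_or_nontrivial E
  · rw [spectrum.of_subsingleton]
    exact Set.finite_empty
  · refine (minpoly K a).roots.toFinset.finite_toSet.subset fun r hr => ?_
    have := spectrum.subset_polynomial_aeval a (minpoly K a) ⟨r, hr, rfl⟩
    rw [minpoly.aeval, spectrum.zero_eq, Set.mem_singleton_iff] at this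
    simpa [minpoly.ne_zero ha] using this

variable {K R Y : Type*} [Field K] [CommRing R] [AddCommGroup Y] [Module K Y] [Module R Y]
  [SMulCommClass K R Y]

theorem isIntegral_of_stable_generators {A : Module.End K Y} (hA : ∀ (r : R) y, A (r • y) = r • A y)
    (W : Submodule K Y) [Module.Finite K W] (hAW : ∀ w ∈ W, A w ∈ W)
    (hW : Submodule.span R (W : Set Y) = ⊤) : IsIntegral K A := by
  obtain ⟨p, hp, hp0⟩ := Algebra.IsIntegral.isIntegral (R := K) (A.restrict hAW)
  have aeval_apply (q : Polynomial K) (w : W) :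
      Polynomial.aeval A q w = Polynomial.aeval (A.restrict hAW) q w := by
    induction q using Polynomial.induction_on' with
    | add q q' hq hq' => simp only [map_add, LinearMap.add_apply, hq, hq', Submodule.coe_add]
    | monomial n a =>
      simp only [Polynomial.aeval_monomial, Module.End.mul_apply, Module.algebraMap_end_apply,
        Submodule.coe_smul, Module.End.pow_restrict n hAW, LinearMap.coe_restrict_apply]
  have aeval_smul (q : Polynomial K) (r : R) (y : Y) :
      Polynomial.aeval A q (r • y) = r • Polynomial.aeval A q y := by
    have := SMulCommClass.symm K R Y
    let ρ : Module.End K Y := DistribSMul.toLinearMap K Y r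
    have hρ : A ∈ Subalgebra.centralizer K {ρ} := Subalgebra.mem_centralizer_iff K |>.2 <| by
      rintro _ rfl
      exact LinearMap.ext fun y => (hA r y).symm
    have := Algebra.adjoin_le (Set.singleton_subset_iff.2 hρ)
      (Polynomial.aeval_mem_adjoin_singleton K A (p := q))
    exact (LinearMap.congr_fun (Subalgebra.mem_centralizer_iff K |>.1 this ρ rfl) y).symm
  refine ⟨p, hp, LinearMap.ext fun y => ?_⟩
  induction hW ▸ Submodule.mem_top (x := y) using Submodule.span_induction with
  | mem w hw =>
    refine (aeval_apply p ⟨w, hw⟩).trans ?_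
    rw [Polynomial.aeval_def, hp0]
    rfl
  | zero => exact map_zero _
  | add y z _ _ hy hz => rw [map_add, hy, hz, map_add]
  | smul r y _ hy => exact (aeval_smul p r y).trans (by rw [Polynomial.aeval_def, hy]; simp)

theorem exists_bijective_add_smul {A : Module.End K Y} (hA : IsIntegral K A) {c : ℕ → K}
    (hc : Function.Injective c) (m₀ : ℕ) :
    ∃ m ≥ m₀, Function.Bijective (A + algebraMap K (Module.End K Y) (c m)) := by
  have hfin : {m | -c m ∈ spectrum K A}.Finite :=
    (finite_spectrum_of_isIntegral hA).preimage (neg_injective.comp hc).injOn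
  obtain ⟨m, hm, hm₀⟩ := hfin.infinite_compl.exists_gt m₀
  have hunit : IsUnit (algebraMap K (Module.End K Y) (-c m) - A) := spectrum.notMem_iff.1 hm
  refine ⟨m, hm₀.le, (Module.End.isUnit_iff _).1 ?_⟩
  rwa [← IsUnit.neg_iff, neg_add_rev, ← map_neg, ← sub_eq_add_neg]

end Perturbation

section Loc

variable {k : Type u} [Field k]

theorem isField_loc (k : Type u) [Field k] : IsField (Loc k) :=
  have : IsLocalization (Submonoid.powers (PowerSeries.X : k⟦X⟧)) (LaurentSeries k) :=
    LaurentSeries.of_powerSeries_localization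
  MulEquiv.isField (Field.toIsField (LaurentSeries k))
    (IsLocalization.algEquiv (Submonoid.powers (PowerSeries.X : k⟦X⟧)) (Loc k) _).toMulEquiv

theorem exists_X_pow_smul_loc (a : Loc k) :
    ∃ (n : ℕ) (v : k⟦X⟧), (PowerSeries.X : k⟦X⟧) ^ n • a = algebraMap k⟦X⟧ (Loc k) v := by
  obtain ⟨⟨v, ⟨_, n, rfl⟩⟩, h⟩ :=
    IsLocalization.surj (Submonoid.powers (PowerSeries.X : k⟦X⟧)) a
  exact ⟨n, v, by rw [Algebra.smul_def, mul_comm]; exact h⟩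

theorem algebraMap_X_pow_injective :
    Function.Injective fun m : ℕ => algebraMap k⟦X⟧ (Loc k) (PowerSeries.X ^ m) :=
  (IsLocalization.injective (Loc k)
    (powers_le_nonZeroDivisors_of_noZeroDivisors PowerSeries.X_ne_zero)).comp fun m n h => by
      simpa using congrArg PowerSeries.order h

end Loc

variable {k R X : Type u} [Field k] [CommRing R] [Algebra k R] [AddCommGroup X] [Module k X]
  [Module R X] [IsScalarTower k R X] {𝒜 : ℕ → Submodule k R} {𝒳 : ℤ → Submodule k X}

theorem span_baseChange_eq_top {S : Type*} [CommRing S] [Algebra k S] {W : Submodule k X}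
    (hW : Submodule.span R (W : Set X) = ⊤) :
    Submodule.span R (W.baseChange S : Set (S ⊗[k] X)) = ⊤ := by
  refine eq_top_iff.2 ?_
  rintro z -
  induction z with
  | zero => exact zero_mem _
  | add z z' hz hz' => exact add_mem hz hz'
  | tmul s x =>
    induction hW ▸ Submodule.mem_top (x := x) using Submodule.span_induction with
    | mem x hx => exact Submodule.subset_span (Submodule.tmul_mem_baseChange_of_mem s hx)
    | zero => rw [TensorProduct.tmul_zero]; exact zero_mem _
    | add x y _ _ hx hy => rw [TensorProduct.tmul_add]; exact add_mem hx hy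
    | smul r x _ hx => exact Submodule.smul_mem _ r hx

theorem isIntegral_of_isGradedHom {K : Type*} [Field K] [Algebra k K] [Module.Finite R X]
    (h𝒳 : IsGradedModule 𝒜 𝒳) (hfin : ∀ n, Module.Finite k (𝒳 n))
    {A : Module.End K (K ⊗[k] X)} (hA : IsGradedHom R (fun n => (𝒳 n).baseChange K)
      (fun n => (𝒳 n).baseChange K) A) : IsIntegral K A := by
  obtain ⟨s, hs⟩ := h𝒳.exists_finset_span_eq_top
  let W : Submodule k X := ⨆ n ∈ s, 𝒳 n
  have hW : Submodule.span R (W : Set X) = ⊤ := top_le_iff.1 <| hs ▸ Submodule.span_mono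
    (Set.iUnion₂_subset fun n hn => le_iSup₂_of_le (f := fun n _ => 𝒳 n) n hn le_rfl)
  have : Module.Finite k W := Module.Finite.iff_fg.2 (Submodule.fg_biSup s _ fun n _ =>
    Module.Finite.iff_fg.1 (hfin n))
  have : Module.Finite K (W.baseChange K) :=
    Module.Finite.of_surjective _ (W.toBaseChange_surjective K)
  refine isIntegral_of_stable_generators hA.map_smul (W.baseChange K) (fun z hz => ?_)
    (span_baseChange_eq_top hW)
  refine map_mem_of_mem_baseChange (fun x hx => ?_) hz
  have hle : W ≤ (((W.baseChange K).comap A).restrictScalars k).comap (TensorProduct.mk k K X 1) :=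
    iSup₂_le fun n hn x hx => show A (1 ⊗ₜ x) ∈ W.baseChange K from
      Submodule.baseChange_mono K (le_iSup₂_of_le (f := fun n _ => 𝒳 n) n hn le_rfl)
        (hA.map_mem n _ (Submodule.tmul_mem_baseChange_of_mem 1 hx))
  exact hle hx

theorem exists_bijective_add_X_pow_smul [Module.Finite R X] (h𝒳 : IsGradedModule 𝒜 𝒳)
    (hfin : ∀ n, Module.Finite k (𝒳 n)) {A : Module.End (Loc k) (Loc k ⊗[k] X)}
    (hA : IsGradedHom R (fun n => (𝒳 n).baseChange (Loc k))
      (fun n => (𝒳 n).baseChange (Loc k)) A) (m₀ : ℕ) :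
    ∃ m ≥ m₀, Function.Bijective fun z => A z + (PowerSeries.X : k⟦X⟧) ^ m • z := by
  let := (isField_loc k).toField
  obtain ⟨m, hm, hbij⟩ :=
    exists_bijective_add_smul (isIntegral_of_isGradedHom h𝒳 hfin hA) algebraMap_X_pow_injective m₀
  refine ⟨m, hm, ?_⟩
  convert hbij using 2 with z
  exact congrArg (A z + ·) (algebraMap_smul (Loc k) _ z).symm

namespace IsGradedHom

variable {R S₁ S₂ S₃ P Q T : Type*} [CommRing S₁] [CommRing S₂] [CommRing S₃] [AddCommGroup P]
  [Module S₁ P] [AddCommGroup Q] [Module S₂ Q] [AddCommGroup T] [Module S₃ T]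
  {𝒳 : ℤ → Submodule S₁ P} {𝒬 : ℤ → Submodule S₂ Q} {𝒯 : ℤ → Submodule S₃ T} {f g : P → Q}

theorem comp [SMul R P] [SMul R Q] [SMul R T] {g : Q → T} (hg : IsGradedHom R 𝒬 𝒯 g)
    (hf : IsGradedHom R 𝒳 𝒬 f) : IsGradedHom R 𝒳 𝒯 fun x => g (f x) where
  map_smul r x := by rw [hf.map_smul, hg.map_smul]
  map_mem n x hx := hg.map_mem n _ (hf.map_mem n x hx)

theorem add [SMul R P] [DistribSMul R Q] (hf : IsGradedHom R 𝒳 𝒬 f) (hg : IsGradedHom R 𝒳 𝒬 g) :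
    IsGradedHom R 𝒳 𝒬 fun x => f x + g x where
  map_smul r x := by rw [hf.map_smul, hg.map_smul, smul_add]
  map_mem n x hx := add_mem (hf.map_mem n x hx) (hg.map_mem n x hx)

theorem const_smul [SMul R P] [SMul R Q] {A : Type*} [SMul A S₂] [SMul A Q] [IsScalarTower A S₂ Q]
    [SMulCommClass A R Q] (a : A) (hf : IsGradedHom R 𝒳 𝒬 f) :
    IsGradedHom R 𝒳 𝒬 fun x => a • f x where
  map_smul r x := by rw [hf.map_smul, smul_comm]
  map_mem n x hx := (𝒬 n).smul_of_tower_mem a (hf.map_mem n x hx)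

theorem of_comp_injective [SMul R P] [SMul R Q] [SMul R T] {g : Q →+ T} {f : P → Q}
    (hgf : IsGradedHom R 𝒳 𝒯 fun x => g (f x)) (hg : IsGradedHom R 𝒬 𝒯 g)
    (hinj : Function.Injective g) (h𝒬 : iSup 𝒬 = ⊤) (h𝒯 : DirectSum.IsInternal 𝒯) :
    IsGradedHom R 𝒳 𝒬 f where
  map_smul r x := hinj (by rw [hg.map_smul, hgf.map_smul])
  map_mem n x hx := (mem_iff_of_injective hinj h𝒬 h𝒯 hg.map_mem n _).1 (hgf.map_mem n x hx)

end IsGradedHom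

section BaseChange

variable {k R S M C : Type*} [CommRing k] [CommRing R] [Algebra k R] [CommRing S] [Algebra k S]
  [AddCommGroup M] [Module k M] [Module R M] [IsScalarTower k R M]
  [AddCommGroup C] [Module k C] [Module R C] [IsScalarTower k R C]
  {ℳ : ℤ → Submodule k M} {𝒞 : ℤ → Submodule k C}

theorem baseChange_right_smul (f : M →ₗ[R] C) (r : R) (z : S ⊗[k] M) :
    (f.restrictScalars k).baseChange S (r • z) = r • (f.restrictScalars k).baseChange S z := by
  induction z with
  | zero => rw [smul_zero, map_zero, smul_zero]
  | add x y hx hy => rw [smul_add, map_add, hx, hy, map_add, smul_add]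
  | tmul s m =>
    rw [right_smul_tmul, LinearMap.baseChange_tmul, LinearMap.baseChange_tmul, right_smul_tmul]
    exact congrArg (s ⊗ₜ[k] ·) (f.map_smul r m)

theorem isGradedHom_baseChange {f : M →ₗ[R] C} (hf : ∀ n, ∀ m ∈ ℳ n, f m ∈ 𝒞 n) :
    IsGradedHom R (fun n => (ℳ n).baseChange S) (fun n => (𝒞 n).baseChange S)
      ((f.restrictScalars k).baseChange S) where
  map_smul := baseChange_right_smul f
  map_mem n _ hz := map_mem_of_mem_baseChange
    (fun m hm => Submodule.tmul_mem_baseChange_of_mem 1 (hf n m hm)) hz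

end BaseChange

section Constant

variable {k : Type*} [Field k] {X : Type*} [AddCommGroup X] [Module k X]

variable (k X) in
/-- Reduction modulo the uniformizer, from the constant family `k⟦X⟧ ⊗[k] X` to its special fibre
`X`. -/
noncomputable def reduction : k⟦X⟧ ⊗[k] X →ₛₗ[PowerSeries.constantCoeff (R := k)] X where
  toFun z := TensorProduct.lid k X ((PowerSeries.coeff (R := k) 0).rTensor X z)
  map_add' z z' := by rw [map_add, map_add]
  map_smul' v z := by
    induction z with
    | zero => simp only [smul_zero, map_zero]
    | add z z' hz hz' => simp only [smul_add, map_add, hz, hz']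
    | tmul w x => simp [TensorProduct.smul_tmul', mul_smul]

@[simp]
theorem reduction_tmul (v : k⟦X⟧) (x : X) :
    reduction k X (v ⊗ₜ x) = PowerSeries.constantCoeff v • x := by
  simp [reduction]

theorem reduction_baseChange {Y : Type*} [AddCommGroup Y] [Module k Y] (f : X →ₗ[k] Y)
    (z : k⟦X⟧ ⊗[k] X) : reduction k Y (f.baseChange k⟦X⟧ z) = f (reduction k X z) := by
  induction z with
  | zero => simp only [map_zero]
  | add x y hx hy => simp only [map_add, hx, hy]
  | tmul v x => rw [LinearMap.baseChange_tmul, reduction_tmul, reduction_tmul, map_smul]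

theorem exists_eq_one_tmul_reduction_add (z : k⟦X⟧ ⊗[k] X) :
    ∃ z', z = 1 ⊗ₜ reduction k X z + (PowerSeries.X : k⟦X⟧) • z' := by
  induction z with
  | zero => exact ⟨0, by simp⟩
  | add x y hx hy =>
    obtain ⟨⟨a, ha⟩, ⟨b, hb⟩⟩ := And.intro hx hy
    refine ⟨a + b, ?_⟩
    rw [map_add, TensorProduct.tmul_add, smul_add]
    nth_rw 1 [ha, hb]
    abel
  | tmul v y =>
    obtain ⟨w, hw⟩ : (PowerSeries.X : k⟦X⟧) ∣
        v - PowerSeries.C (PowerSeries.constantCoeff v) := by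
      simp [PowerSeries.X_dvd_iff]
    refine ⟨w ⊗ₜ y, ?_⟩
    rw [reduction_tmul, TensorProduct.tmul_smul, TensorProduct.smul_tmul',
      TensorProduct.smul_tmul', smul_eq_mul, ← hw, ← TensorProduct.add_tmul,
      PowerSeries.smul_eq_C_mul, mul_one, add_sub_cancel]

end Constant

section ConstantFamily

variable {k R X : Type u} [Field k] [CommRing R] [Algebra k R] [AddCommGroup X] [Module k X]

variable (k X) in
/-- The localization map from the constant family `k⟦X⟧ ⊗[k] X` to its generic fibre
`Loc k ⊗[k] X`. -/
noncomputable def localization : k⟦X⟧ ⊗[k] X →ₗ[k⟦X⟧] Loc k ⊗[k] X :=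
  TensorProduct.AlgebraTensorModule.map (Algebra.linearMap k⟦X⟧ (Loc k)) LinearMap.id

@[simp]
theorem localization_tmul (v : k⟦X⟧) (x : X) :
    localization k X (v ⊗ₜ x) = algebraMap k⟦X⟧ (Loc k) v ⊗ₜ x :=
  rfl

theorem isDegeneration_constant [Module R X] [IsScalarTower k R X] (𝒳 : ℤ → Submodule k X) :
    IsDegeneration R 𝒳 𝒳 (fun n => (𝒳 n).baseChange k⟦X⟧) (reduction k X) (localization k X) where
  special := {
    map_smul r z := by
      induction z with
      | zero => rw [smul_zero, map_zero, smul_zero]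
      | add x y hx hy => rw [smul_add, map_add, hx, hy, map_add, smul_add]
      | tmul v x =>
        rw [right_smul_tmul, reduction_tmul, reduction_tmul, smul_comm]
    map_mem n z hz := map_mem_of_mem_baseChange (f := reduction k X)
      (fun x hx => by simpa using hx) hz }
  special_surjective x := ⟨1 ⊗ₜ x, by simp⟩
  special_ker z hz := by
    obtain ⟨z', h⟩ := exists_eq_one_tmul_reduction_add z
    exact ⟨z', by rw [h, hz, TensorProduct.tmul_zero, zero_add]⟩
  generic := {
    map_smul r z := by
      induction z with
      | zero => rw [smul_zero, map_zero, smul_zero]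
      | add x y hx hy => rw [smul_add, map_add, hx, hy, map_add, smul_add]
      | tmul v x => rfl
    map_mem n z hz := map_mem_of_mem_baseChange (f := localization k X)
      (𝒯 := ((𝒳 n).baseChange (Loc k)).restrictScalars k⟦X⟧)
      (fun x hx => Submodule.tmul_mem_baseChange_of_mem _ hx) hz }
  generic_injective := by
    have := Module.Flat.rTensor_preserves_injective_linearMap (M := X)
      ((Algebra.linearMap k⟦X⟧ (Loc k)).restrictScalars k) (IsLocalization.injective (Loc k)
        (powers_le_nonZeroDivisors_of_noZeroDivisors PowerSeries.X_ne_zero))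
    exact this
  generic_surj z := by
    induction z with
    | zero => exact ⟨0, 0, by simp⟩
    | add x y hx hy =>
      obtain ⟨⟨n, a, ha⟩, ⟨m, b, hb⟩⟩ := And.intro hx hy
      refine ⟨n + m, (PowerSeries.X : k⟦X⟧) ^ m • a + (PowerSeries.X : k⟦X⟧) ^ n • b, ?_⟩
      rw [map_add, map_smul, map_smul, ha, hb, smul_add, smul_smul, smul_smul, ← pow_add,
        ← pow_add, add_comm m n]
    | tmul a x =>
      obtain ⟨n, v, hv⟩ := exists_X_pow_smul_loc a
      exact ⟨n, v ⊗ₜ x, by rw [localization_tmul, ← hv, TensorProduct.smul_tmul']⟩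

end ConstantFamily

namespace IsDegeneration

variable {k R M N Q : Type u} [Field k] [CommRing R] [Algebra k R]
  [AddCommGroup M] [Module k M] [Module R M] [IsScalarTower k R M]
  [AddCommGroup N] [Module k N] [Module R N]
  [AddCommGroup Q] [Module k⟦X⟧ Q] [Module R Q]
  {ℳ : ℤ → Submodule k M} {𝒩 : ℤ → Submodule k N} {𝒬 : ℤ → Submodule k⟦X⟧ Q}
  {π : Q →ₛₗ[PowerSeries.constantCoeff (R := k)] N} {ι : Q →ₗ[k⟦X⟧] Loc k ⊗[k] M}

theorem exists_generic_extension (h : IsDegeneration R ℳ 𝒩 𝒬 π ι) (h𝒬 : iSup 𝒬 = ⊤)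
    (hℳ : DirectSum.IsInternal ℳ) {T : Type*} [AddCommGroup T] [Module k⟦X⟧ T] [Module (Loc k) T]
    [IsScalarTower k⟦X⟧ (Loc k) T] [DistribSMul R T] [SMulCommClass k⟦X⟧ R T]
    {𝒯 : ℤ → Submodule (Loc k) T} {f : Q →ₗ[k⟦X⟧] T} (hf : IsGradedHom R 𝒬 𝒯 f) :
    ∃ F : Loc k ⊗[k] M →ₗ[Loc k] T, IsGradedHom R (fun n => (ℳ n).baseChange (Loc k)) 𝒯 F ∧
      ∀ q, F (ι q) = f q := by
  let S := Submonoid.powers (PowerSeries.X : k⟦X⟧)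
  have := isLocalizedModule_of_injective h.generic_injective h.generic_surj
  have hunit (s : S) : IsUnit (algebraMap k⟦X⟧ (Module.End k⟦X⟧ T) s) := by
    obtain ⟨_, n, rfl⟩ := s
    exact (Module.End.isUnit_iff _).2 (X_pow_smul_bijective (k := k) n)
  let F := (IsLocalizedModule.lift S ι f hunit).extendScalarsOfIsLocalization S (Loc k)
  have hF (q : Q) : F (ι q) = f q := IsLocalizedModule.lift_apply S ι f hunit q
  have F_X_pow (n : ℕ) (z) :
      F ((PowerSeries.X : k⟦X⟧) ^ n • z) = (PowerSeries.X : k⟦X⟧) ^ n • F z :=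
    (F.restrictScalars k⟦X⟧).map_smul _ z
  refine ⟨F, ⟨fun r z => ?_, fun d z hz => ?_⟩, hF⟩
  · obtain ⟨n, q, hq⟩ := h.generic_surj z
    refine (X_pow_smul_bijective (k := k) (T := T) n).injective ?_
    change (PowerSeries.X : k⟦X⟧) ^ n • F (r • z) = (PowerSeries.X : k⟦X⟧) ^ n • r • F z
    rw [← F_X_pow, smul_comm, smul_comm _ r (F z), ← F_X_pow, ← hq, ← h.generic.map_smul, hF, hF,
      hf.map_smul]
  · obtain ⟨n, q, hq⟩ := h.generic_surj z
    have hqd : q ∈ 𝒬 d := by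
      refine (mem_iff_of_injective (f := ι.toAddMonoidHom) h.generic_injective h𝒬 hℳ.baseChange
        h.generic.map_mem d q).1 ?_
      exact hq ▸ Submodule.smul_of_tower_mem _ _ hz
    have hFz : (PowerSeries.X : k⟦X⟧) ^ n • F z ∈ 𝒯 d := by
      rw [← F_X_pow, ← hq, hF]
      exact hf.map_mem d q hqd
    rw [← algebraMap_smul (Loc k)] at hFz
    exact ((𝒯 d).smul_mem_iff_of_isUnit (isUnit_algebraMap_X_pow n)).1 hFz

theorem exists_X_pow_smul_mem_range (h : IsDegeneration R ℳ 𝒩 𝒬 π ι) {X : Type*} [AddCommGroup X]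
    [Module k X] [Module R X] [IsScalarTower k R X] [Module.Finite R X]
    {φ : k⟦X⟧ ⊗[k] X →ₗ[k⟦X⟧] Loc k ⊗[k] M} (hφ : ∀ (r : R) z, φ (r • z) = r • φ z) :
    ∃ n : ℕ, ∀ z, ∃ q, ι q = (PowerSeries.X : k⟦X⟧) ^ n • φ z := by
  let L (n : ℕ) : Submodule R X :=
    { carrier := {x | ∃ q, ι q = (PowerSeries.X : k⟦X⟧) ^ n • φ (1 ⊗ₜ x)}
      zero_mem' := ⟨0, by simp⟩
      add_mem' := by
        rintro x y ⟨a, ha⟩ ⟨b, hb⟩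
        exact ⟨a + b, by rw [map_add, ha, hb, TensorProduct.tmul_add, map_add, smul_add]⟩
      smul_mem' := by
        rintro r x ⟨a, ha⟩
        exact ⟨r • a, by rw [h.generic.map_smul, ha, ← right_smul_tmul, hφ,
          smul_comm (PowerSeries.X ^ n : k⟦X⟧) r]⟩ }
  have hL : Monotone L := monotone_nat_of_le_succ fun n x ⟨q, hq⟩ =>
    ⟨(PowerSeries.X : k⟦X⟧) • q, by rw [map_smul, hq, smul_smul, pow_succ']⟩
  have hL_top : ⨆ n, L n = ⊤ := eq_top_iff.2 fun x _ =>
    (Submodule.mem_iSup_of_directed L hL.directed_le).2 (h.generic_surj (φ (1 ⊗ₜ x)))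
  obtain ⟨n, hn⟩ := Module.Finite.fg_top.stabilizes_of_iSup_eq ⟨L, hL⟩ hL_top
  refine ⟨n, fun z => ?_⟩
  induction z with
  | zero => exact ⟨0, by simp⟩
  | add z z' hz hz' =>
    obtain ⟨⟨a, ha⟩, ⟨b, hb⟩⟩ := And.intro hz hz'
    exact ⟨a + b, by rw [map_add, ha, hb, map_add, smul_add]⟩
  | tmul v x =>
    obtain ⟨q, hq⟩ : x ∈ L n := (show ⊤ = L n from hn) ▸ Submodule.mem_top
    refine ⟨v • q, ?_⟩
    rw [map_smul, hq, smul_comm, ← map_smul, TensorProduct.smul_tmul', smul_eq_mul, mul_one]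

theorem exists_X_pow_smul_lift (h : IsDegeneration R ℳ 𝒩 𝒬 π ι) (h𝒬 : iSup 𝒬 = ⊤)
    (hℳ : DirectSum.IsInternal ℳ) {X : Type u} [AddCommGroup X] [Module k X] [Module R X]
    [IsScalarTower k R X] [Module.Finite R X] {𝒳 : ℤ → Submodule k X}
    {φ : k⟦X⟧ ⊗[k] X →ₗ[k⟦X⟧] Loc k ⊗[k] M}
    (hφ : IsGradedHom R (fun n => (𝒳 n).baseChange k⟦X⟧) (fun n => (ℳ n).baseChange (Loc k)) φ) :
    ∃ (n : ℕ) (g : k⟦X⟧ ⊗[k] X →ₗ[k⟦X⟧] Q), IsGradedHom R (fun n => (𝒳 n).baseChange k⟦X⟧) 𝒬 g ∧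
      ∀ z, ι (g z) = (PowerSeries.X : k⟦X⟧) ^ n • φ z := by
  obtain ⟨n, hn⟩ := h.exists_X_pow_smul_mem_range hφ.map_smul
  choose g hg using hn
  let g' : k⟦X⟧ ⊗[k] X →ₗ[k⟦X⟧] Q :=
    { toFun := g
      map_add' z z' := h.generic_injective (by simp only [hg, map_add, smul_add])
      map_smul' v z := h.generic_injective (by
        rw [RingHom.id_apply, map_smul, hg, hg, map_smul, smul_comm]) }
  refine ⟨n, g', IsGradedHom.of_comp_injective (g := ι.toAddMonoidHom) ?_ h.generic
    h.generic_injective h𝒬 hℳ.baseChange, hg⟩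
  have : (fun z => ι (g z)) = fun z => (PowerSeries.X : k⟦X⟧) ^ n • φ z := funext hg
  exact this ▸ hφ.const_smul ((PowerSeries.X : k⟦X⟧) ^ n)

end IsDegeneration

theorem baseChange_comp_eq_id {k R X M S : Type*} [CommRing k] [CommRing R] [Algebra k R]
    [CommRing S] [Algebra k S] [AddCommGroup X] [Module k X] [Module R X] [IsScalarTower k R X]
    [AddCommGroup M] [Module k M] [Module R M] [IsScalarTower k R M] {i : X →ₗ[R] M}
    {p : M →ₗ[R] X} (h : p ∘ₗ i = LinearMap.id) :
    (p.restrictScalars k).baseChange S ∘ₗ (i.restrictScalars k).baseChange S = LinearMap.id := by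
  rw [← LinearMap.baseChange_comp, ← LinearMap.restrictScalars_comp, h]
  exact LinearMap.baseChange_id

theorem IsGradedHom.exists_exact {R S X M C : Type*} [CommRing S] [AddCommGroup X] [Module S X]
    [AddCommGroup M] [Module S M] [AddCommGroup C] [Module S C] [SMul R X] [DistribSMul R M]
    [DistribSMul R C] {𝒳 : ℤ → Submodule S X} {ℳ : ℤ → Submodule S M} {𝒞 : ℤ → Submodule S C}
    (h𝒳 : DirectSum.IsInternal 𝒳) {i F : X →ₗ[S] M} {p : M →ₗ[S] X} {c : M →ₗ[S] C}
    (hF : IsGradedHom R 𝒳 ℳ F) (hp : IsGradedHom R ℳ 𝒳 p) (hc : IsGradedHom R ℳ 𝒞 c)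
    (hpi : p ∘ₗ i = LinearMap.id) (hcs : Function.Surjective c) (hic : Function.Exact i c)
    (hbij : Function.Bijective fun x => p (F x)) :
    ∃ ψ : M →ₗ[S] C, IsGradedHom R ℳ 𝒞 ψ ∧ Function.Surjective ψ ∧ Function.Exact F ψ := by
  let E := LinearEquiv.ofBijective (p ∘ₗ F) hbij
  have pFE (x) : p (F (E.symm x)) = x := E.apply_symm_apply x
  have EpF (x) : E.symm (p (F x)) = x := E.symm_apply_apply x
  have pi (x) : p (i x) = x := LinearMap.congr_fun hpi x
  have hE : IsGradedHom R 𝒳 𝒳 E.symm :=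
    .of_comp_injective (g := E.toLinearMap.toAddMonoidHom)
      (by simpa [E, Function.comp_def] using ⟨fun _ _ => rfl, fun _ _ => id⟩) (hp.comp hF)
      E.injective h𝒳.submodule_iSup_eq_top h𝒳
  let ψ := c ∘ₗ (LinearMap.id - F ∘ₗ E.symm.toLinearMap ∘ₗ p)
  have hψ (y) : ψ y = c (y - F (E.symm (p y))) := rfl
  refine ⟨ψ, ⟨fun r y => ?_, fun n y hy => ?_⟩, hcs.forall.2 fun y => ?_,
    fun y => ⟨fun hy => ?_, ?_⟩⟩
  · rw [hψ, hψ, hp.map_smul, hE.map_smul, hF.map_smul, ← smul_sub, hc.map_smul]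
  · exact hc.map_mem n _ (sub_mem hy (hF.map_mem n _ (hE.map_mem n _ (hp.map_mem n y hy))))
  · refine ⟨y - i (p y), ?_⟩
    rw [hψ, map_sub p, pi, sub_self, map_zero, map_zero, sub_zero, map_sub,
      hic.apply_apply_eq_zero, sub_zero]
  · obtain ⟨x, hx⟩ : ∃ x, i x = y - F (E.symm (p y)) := (hic _).1 hy
    have hx0 : x = 0 := by rw [← pi x, hx, map_sub, pFE, sub_self]
    exact ⟨E.symm (p y), (sub_eq_zero.1 (by rw [← hx, hx0, map_zero])).symm⟩
  · rintro ⟨x, rfl⟩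
    rw [hψ, EpF, sub_self, map_zero]

namespace IsDegeneration

variable {k R M N X C Q : Type u} [Field k] [CommRing R] [Algebra k R]
  [AddCommGroup M] [Module k M] [Module R M] [IsScalarTower k R M]
  [AddCommGroup N] [Module k N] [Module R N]
  [AddCommGroup X] [Module k X] [Module R X] [IsScalarTower k R X]
  [AddCommGroup C] [Module k C] [Module R C] [IsScalarTower k R C]
  [AddCommGroup Q] [Module k⟦X⟧ Q] [Module R Q]
  {𝒜 : ℕ → Submodule k R}
  {ℳ : ℤ → Submodule k M} {𝒩 : ℤ → Submodule k N} {𝒳 : ℤ → Submodule k X} {𝒞 : ℤ → Submodule k C}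
  {𝒬 : ℤ → Submodule k⟦X⟧ Q}

section Lift

variable [SMulCommClass k⟦X⟧ R Q]
  {π : Q →ₛₗ[PowerSeries.constantCoeff (R := k)] N} {ι : Q →ₗ[k⟦X⟧] Loc k ⊗[k] M}

theorem exists_bijective_lift [Module.Finite R X] (h : IsDegeneration R ℳ 𝒩 𝒬 π ι)
    (h𝒬 : iSup 𝒬 = ⊤) (hℳ : DirectSum.IsInternal ℳ) (h𝒳 : IsGradedModule 𝒜 𝒳)
    (hfin : ∀ n, Module.Finite k (𝒳 n)) {i : X →ₗ[R] M} {p : M →ₗ[R] X}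
    (hi : IsHomogeneousMap 𝒳 ℳ i) (hp : IsHomogeneousMap ℳ 𝒳 p) (hpi : p ∘ₗ i = LinearMap.id)
    {f₀ : k⟦X⟧ ⊗[k] X →ₗ[k⟦X⟧] Q}
    (hf₀ : IsGradedHom R (fun n => (𝒳 n).baseChange k⟦X⟧) 𝒬 f₀) :
    ∃ (f : k⟦X⟧ ⊗[k] X →ₗ[k⟦X⟧] Q) (F : Loc k ⊗[k] X →ₗ[Loc k] Loc k ⊗[k] M),
      IsGradedHom R (fun n => (𝒳 n).baseChange k⟦X⟧) 𝒬 f ∧ (∀ z, π (f z) = π (f₀ z)) ∧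
      IsGradedHom R (fun n => (𝒳 n).baseChange (Loc k)) (fun n => (ℳ n).baseChange (Loc k)) F ∧
      (∀ z, F (localization k X z) = ι (f z)) ∧
      Function.Bijective fun z => (p.restrictScalars k).baseChange (Loc k) (F z) := by
  have hconst := isDegeneration_constant (R := R) 𝒳
  let iK := (i.restrictScalars k).baseChange (Loc k)
  let pK := (p.restrictScalars k).baseChange (Loc k)
  have hiK : IsGradedHom R _ _ iK := isGradedHom_baseChange hi
  have hpK : IsGradedHom R _ _ pK := isGradedHom_baseChange hp
  have pK_iK : pK ∘ₗ iK = LinearMap.id := baseChange_comp_eq_id hpi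
  obtain ⟨n, g, hg, hιg⟩ := h.exists_X_pow_smul_lift h𝒬 hℳ
    (φ := iK.restrictScalars k⟦X⟧ ∘ₗ localization k X) (hiK.comp hconst.generic)
  obtain ⟨F₀, hF₀, hF₀f⟩ := hconst.exists_generic_extension
    h𝒳.isInternal.baseChange.submodule_iSup_eq_top h𝒳.isInternal (f := ι ∘ₗ f₀)
    (h.generic.comp hf₀)
  obtain ⟨m, hm, hbij⟩ := exists_bijective_add_X_pow_smul h𝒳 hfin (A := pK ∘ₗ F₀)
    (hpK.comp hF₀) (n + 1)
  let f := f₀ + (PowerSeries.X : k⟦X⟧) ^ (m - n) • g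
  let F := F₀ + (PowerSeries.X : k⟦X⟧) ^ m • iK
  have F_apply (z) : F z = F₀ z + (PowerSeries.X : k⟦X⟧) ^ m • iK z := rfl
  refine ⟨f, F, hf₀.add (hg.const_smul _), fun z => ?_,
    hF₀.add (hiK.const_smul ((PowerSeries.X : k⟦X⟧) ^ m)), fun z => ?_, ?_⟩
  · have : PowerSeries.constantCoeff ((PowerSeries.X : k⟦X⟧) ^ (m - n)) = 0 := by
      rw [map_pow, PowerSeries.constantCoeff_X, zero_pow (by omega)]
    rw [LinearMap.add_apply, LinearMap.smul_apply, map_add, map_smulₛₗ, this, zero_smul, add_zero]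
  · rw [F_apply, hF₀f, LinearMap.add_apply, LinearMap.smul_apply, map_add, map_smul, hιg,
      smul_smul, ← pow_add, Nat.sub_add_cancel (by omega)]
    rfl
  · convert hbij using 2 with z
    change pK (F z) = pK (F₀ z) + _
    rw [F_apply, map_add, LinearMap.map_smul_of_tower]
    exact congrArg (pK (F₀ z) + (PowerSeries.X : k⟦X⟧) ^ m • ·) (LinearMap.congr_fun pK_iK z)

end Lift

section Quotient

variable {N' : Type u} [AddCommGroup N'] [Module k N'] [Module R N'] {𝒩' : ℤ → Submodule k N'}
  {π : Q →ₛₗ[PowerSeries.constantCoeff (R := k)] N} {ι : Q →ₗ[k⟦X⟧] Loc k ⊗[k] M}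

theorem map_of_surjective (h : IsDegeneration R ℳ 𝒩 𝒬 π ι) {Q' : Type u} [AddCommGroup Q']
    [Module k⟦X⟧ Q'] [Module R Q'] {g : Q →ₗ[k⟦X⟧] Q'} (hg : ∀ (r : R) q, g (r • q) = r • g q)
    (hg_surj : Function.Surjective g) {σ : N →ₗ[k] N'} (hσ : IsGradedHom R 𝒩 𝒩' σ)
    (hσ_surj : Function.Surjective σ) {ψ : Loc k ⊗[k] M →ₗ[Loc k] Loc k ⊗[k] C}
    (hψ : IsGradedHom R (fun n => (ℳ n).baseChange (Loc k)) (fun n => (𝒞 n).baseChange (Loc k)) ψ)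
    (hψ_surj : Function.Surjective ψ)
    {π' : Q' →ₛₗ[PowerSeries.constantCoeff (R := k)] N'} {ι' : Q' →ₗ[k⟦X⟧] Loc k ⊗[k] C}
    (hπ' : ∀ q, π' (g q) = σ (π q)) (hι' : ∀ q, ι' (g q) = ψ (ι q))
    (hι'_inj : Function.Injective ι') (hlift : ∀ q, σ (π q) = 0 → ∃ q₁, g q₁ = 0 ∧ π q₁ = π q) :
    IsDegeneration R 𝒞 𝒩' (fun n => (𝒬 n).map g) π' ι' where
  special := {
    map_smul r := hg_surj.forall.2 fun q => by
      rw [← hg, hπ', hπ', h.special.map_smul, hσ.map_smul]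
    map_mem := by
      rintro n _ ⟨q, hq, rfl⟩
      exact hπ' q ▸ hσ.map_mem n _ (h.special.map_mem n q hq) }
  special_surjective :=
    .of_comp (g := g) <| by
      simpa only [Function.comp_def, hπ'] using hσ_surj.comp h.special_surjective
  special_ker := hg_surj.forall.2 fun q hq => by
    obtain ⟨q₁, hq₁, hπq₁⟩ := hlift q (hπ' q ▸ hq)
    obtain ⟨q', hq'⟩ := h.special_ker (q - q₁) (by rw [map_sub, hπq₁, sub_self])
    exact ⟨g q', by rw [← map_smul, ← hq', map_sub, hq₁, sub_zero]⟩
  generic := {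
    map_smul r := hg_surj.forall.2 fun q => by
      rw [← hg, hι', hι', h.generic.map_smul, hψ.map_smul]
    map_mem := by
      rintro n _ ⟨q, hq, rfl⟩
      exact hι' q ▸ hψ.map_mem n _ (h.generic.map_mem n q hq) }
  generic_injective := hι'_inj
  generic_surj := hψ_surj.forall.2 fun y => by
    obtain ⟨n, q, hq⟩ := h.generic_surj y
    exact ⟨n, g q, by rw [hι', hq, LinearMap.map_smul_of_tower]⟩

variable [Module (k⟦X⟧ ⊗[k] R) Q] [IsScalarTower k⟦X⟧ (k⟦X⟧ ⊗[k] R) Q]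
  [IsScalarTower R (k⟦X⟧ ⊗[k] R) Q] [Module.Finite (k⟦X⟧ ⊗[k] R) Q]

theorem degenerates_of_quotient (h : IsDegeneration R ℳ 𝒩 𝒬 π ι)
    (h𝒬 : IsGradedModule (fun i => (𝒜 i).baseChange k⟦X⟧) 𝒬) (h𝒩' : DirectSum.IsInternal 𝒩')
    (h𝒞 : DirectSum.IsInternal 𝒞) {σ : N →ₗ[k] N'} (hσ : IsGradedHom R 𝒩 𝒩' σ)
    (hσ_surj : Function.Surjective σ) {ψ : Loc k ⊗[k] M →ₗ[Loc k] Loc k ⊗[k] C}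
    (hψ : IsGradedHom R (fun n => (ℳ n).baseChange (Loc k)) (fun n => (𝒞 n).baseChange (Loc k)) ψ)
    (hψ_surj : Function.Surjective ψ) (hker : ∀ q, ψ (ι q) = 0 → σ (π q) = 0)
    (hlift : ∀ q, σ (π q) = 0 → ∃ q₁, ψ (ι q₁) = 0 ∧ π q₁ = π q) : Degenerates 𝒜 𝒞 𝒩' := by
  let ψι : Q →ₗ[k⟦X⟧] Loc k ⊗[k] C := ψ.restrictScalars k⟦X⟧ ∘ₗ ι
  have hψι : IsGradedHom R 𝒬 (fun n => (𝒞 n).baseChange (Loc k)) ψι := hψ.comp h.generic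
  let P : Submodule (k⟦X⟧ ⊗[k] R) Q :=
    { LinearMap.ker ψι with
      smul_mem' := fun a q (hq : ψι q = 0) => show ψι (a • q) = 0 by
        induction a with
        | zero => exact (congrArg ψι (zero_smul (k⟦X⟧ ⊗[k] R) q)).trans (map_zero ψι)
        | add a b ha hb => rw [add_smul, map_add, ha, hb, add_zero]
        | tmul v r => rw [tmul_smul_eq, map_smul, hψι.map_smul, hq, smul_zero, smul_zero] }
  let g : Q →ₗ[k⟦X⟧] Q ⧸ P := P.mkQ.restrictScalars k⟦X⟧
  let ι' : (Q ⧸ P) →ₗ[k⟦X⟧] Loc k ⊗[k] C := (P.restrictScalars k⟦X⟧).liftQ ψι le_rfl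
  let π' : (Q ⧸ P) →ₛₗ[PowerSeries.constantCoeff (R := k)] N' :=
    (P.restrictScalars k⟦X⟧).liftQ (σ.comp π) hker
  have g_surj : Function.Surjective g := P.mkQ_surjective
  have hι'_inj : Function.Injective ι' :=
    LinearMap.ker_eq_bot.1 (Submodule.ker_liftQ_eq_bot _ _ _ le_rfl)
  have h' : IsDegeneration R 𝒞 𝒩' (fun n => (𝒬 n).map g) π' ι' :=
    h.map_of_surjective (fun _ _ => rfl) g_surj hσ hσ_surj hψ hψ_surj (fun _ => rfl) (fun _ => rfl)
      hι'_inj fun q hq => (hlift q hq).imp fun q₁ hq₁ =>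
        ⟨(Submodule.Quotient.mk_eq_zero P).2 hq₁.1, hq₁.2⟩
  have hsup : iSup (fun n => (𝒬 n).map g) = ⊤ := by
    rw [← Submodule.map_iSup, h𝒬.isInternal.submodule_iSup_eq_top, Submodule.map_top,
      LinearMap.range_eq_top.2 g_surj]
  refine h'.degenerates ⟨isInternal_of_injective ι'.toAddMonoidHom hι'_inj hsup h𝒞.baseChange
    h'.generic.map_mem, ?_⟩ h𝒞 h𝒩'
  rintro i n a _ ha ⟨q, hq, rfl⟩
  exact ⟨a • q, h𝒬.smul_mem ha hq, rfl⟩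

end Quotient

section Cancel

variable {π : Q →ₛₗ[PowerSeries.constantCoeff (R := k)] N × X} {ι : Q →ₗ[k⟦X⟧] Loc k ⊗[k] M}

theorem mem_range_lift (h : IsDegeneration R ℳ (prodGrading 𝒩 𝒳) 𝒬 π ι)
    {f : k⟦X⟧ ⊗[k] X →ₗ[k⟦X⟧] Q} (hf : ∀ z, π (f z) = (0, reduction k X z))
    {F : Loc k ⊗[k] X →ₗ[Loc k] Loc k ⊗[k] M} (hF : ∀ z, F (localization k X z) = ι (f z))
    {q : Q} (hq : ι q ∈ LinearMap.range F) : q ∈ LinearMap.range f := by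
  obtain ⟨z, hz⟩ := hq
  have hconst := isDegeneration_constant (R := R) 𝒳
  obtain ⟨n, w, hw⟩ := hconst.generic_surj z
  have hfw : f w = (PowerSeries.X : k⟦X⟧) ^ n • q := by
    refine h.generic_injective ?_
    rw [← hF, hw, LinearMap.map_smul_of_tower, map_smul, hz]
  clear hw
  induction n generalizing w with
  | zero => exact ⟨w, by rw [hfw, pow_zero, one_smul]⟩
  | succ n ih =>
    have hw0 : reduction k X w = 0 := by
      have := congrArg (fun q => (π q).2) hfw
      rwa [hf, map_smulₛₗ, map_pow, PowerSeries.constantCoeff_X, zero_pow n.succ_ne_zero,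
        zero_smul] at this
    obtain ⟨w', rfl⟩ := hconst.special_ker w hw0
    refine ih w' (h.X_pow_smul_injective 1 ?_)
    simpa only [pow_one, pow_zero, one_smul, pow_succ', mul_smul, map_smul] using hfw

variable [Module (k⟦X⟧ ⊗[k] R) Q] [IsScalarTower k⟦X⟧ (k⟦X⟧ ⊗[k] R) Q]
  [IsScalarTower R (k⟦X⟧ ⊗[k] R) Q] [SMulCommClass k⟦X⟧ R Q] [Module.Finite (k⟦X⟧ ⊗[k] R) Q]

theorem cancel [Module.Finite R X] (h : IsDegeneration R ℳ (prodGrading 𝒩 𝒳) 𝒬 π ι)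
    (h𝒬 : IsGradedModule (fun i => (𝒜 i).baseChange k⟦X⟧) 𝒬) (hℳ : DirectSum.IsInternal ℳ)
    (h𝒩 : DirectSum.IsInternal 𝒩) (h𝒳 : IsGradedModule 𝒜 𝒳) (h𝒞 : DirectSum.IsInternal 𝒞)
    (hfin : ∀ n, Module.Finite k (𝒳 n)) {i : X →ₗ[R] M} {p : M →ₗ[R] X} {c : M →ₗ[R] C}
    (hi : IsHomogeneousMap 𝒳 ℳ i) (hp : IsHomogeneousMap ℳ 𝒳 p) (hc : IsHomogeneousMap ℳ 𝒞 c)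
    (hpi : p ∘ₗ i = LinearMap.id) (hcs : Function.Surjective c) (hic : Function.Exact i c)
    {f₀ : k⟦X⟧ ⊗[k] X →ₗ[k⟦X⟧] Q}
    (hf₀ : IsGradedHom R (fun n => (𝒳 n).baseChange k⟦X⟧) 𝒬 f₀)
    (hf₀π : ∀ z, π (f₀ z) = (0, reduction k X z)) : Degenerates 𝒜 𝒞 𝒩 := by
  obtain ⟨f, F, -, hfπ, hF, hFf, hbij⟩ :=
    h.exists_bijective_lift h𝒬.isInternal.submodule_iSup_eq_top hℳ h𝒳 hfin hi hp hpi hf₀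
  let iK := (i.restrictScalars k).baseChange (Loc k)
  let pK := (p.restrictScalars k).baseChange (Loc k)
  let cK := (c.restrictScalars k).baseChange (Loc k)
  have hpK : IsGradedHom R _ _ pK := isGradedHom_baseChange hp
  have hcK : IsGradedHom R _ _ cK := isGradedHom_baseChange hc
  have pK_iK : pK ∘ₗ iK = LinearMap.id := baseChange_comp_eq_id hpi
  have cK_surj : Function.Surjective cK :=
    LinearMap.lTensor_surjective (Loc k) (g := c.restrictScalars k) hcs
  have exact_K : Function.Exact iK cK :=
    lTensor_exact (Loc k) (f := i.restrictScalars k) (g := c.restrictScalars k) hic hcs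
  have h𝒳K : DirectSum.IsInternal fun n => (𝒳 n).baseChange (Loc k) := h𝒳.isInternal.baseChange
  have pF_bij : Function.Bijective fun z => pK (F z) := hbij
  obtain ⟨ψ, hψ, hψ_surj, hFψ⟩ := hF.exists_exact h𝒳K hpK hcK pK_iK cK_surj exact_K pF_bij
  have hfπ' (z) : π (f z) = (0, reduction k X z) := (hfπ z).trans (hf₀π z)
  refine h.degenerates_of_quotient h𝒬 h𝒩 h𝒞 (σ := LinearMap.fst k N X)
    ⟨fun _ _ => rfl, fun _ _ hx => hx.1⟩ LinearMap.fst_surjective hψ hψ_surj (fun q hq => ?_)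
    (fun q hq => ?_)
  · obtain ⟨z, rfl⟩ := h.mem_range_lift hfπ' hFf ((hFψ _).1 hq)
    rw [hfπ', LinearMap.fst_apply]
  · refine ⟨f (1 ⊗ₜ (π q).2), (hFψ _).2 ⟨_, hFf _⟩, ?_⟩
    rw [hfπ', reduction_tmul, map_one, one_smul]
    exact Prod.ext hq.symm rfl

end Cancel

end IsDegeneration

section FiniteType

variable {k R : Type*} [CommRing k] [CommRing R] [Algebra k R]
  (𝒜 : ℕ → Submodule k R) [GradedAlgebra 𝒜]

theorem mem_adjoin_of_mem_piece (h₀ : ∀ a ∈ 𝒜 0, ∃ c : k, algebraMap k R c = a) {t : Set R}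
    (ht : ∀ x ∈ t, ∃ d, 0 < d ∧ x ∈ 𝒜 d) (hspan : ∀ n, 0 < n → ∀ a ∈ 𝒜 n, a ∈ Ideal.span t)
    (n : ℕ) : ∀ a ∈ 𝒜 n, a ∈ Algebra.adjoin k t := by
  induction n using Nat.strong_induction_on with
  | _ n ih =>
    intro a ha
    rcases Nat.eq_zero_or_pos n with rfl | hn
    · obtain ⟨c, rfl⟩ := h₀ a ha
      exact Subalgebra.algebraMap_mem _ c
    have component_mem : ∀ b : R, (DirectSum.decompose 𝒜 (b * a) n : R) ∈ Algebra.adjoin k t := by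
      refine Submodule.span_induction (p := fun y _ => ∀ b : R,
        (DirectSum.decompose 𝒜 (b * y) n : R) ∈ Algebra.adjoin k t) (fun x hx b => ?_)
        (fun b => by simp) (fun y z _ _ hy hz b => ?_) (fun c y _ hy b => ?_) (hspan n hn a ha)
      · obtain ⟨d, hd, hxd⟩ := ht x hx
        by_cases hdn : d ≤ n
        · rw [DirectSum.coe_decompose_mul_of_right_mem_of_le 𝒜 hxd hdn]
          exact mul_mem (ih _ (by omega) _ (SetLike.coe_mem _)) (Algebra.subset_adjoin hx)
        · rw [DirectSum.coe_decompose_mul_of_right_mem_of_not_le 𝒜 hxd hdn]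
          exact zero_mem _
      · rw [mul_add, DirectSum.decompose_add, DirectSum.add_apply, Submodule.coe_add]
        exact add_mem (hy b) (hz b)
      · rw [smul_eq_mul, ← mul_assoc]
        exact hy _
    simpa only [one_mul, DirectSum.decompose_of_mem_same 𝒜 ha] using component_mem 1

theorem finiteType_of_isNoetherianRing [IsNoetherianRing R]
    (h₀ : ∀ a ∈ 𝒜 0, ∃ c : k, algebraMap k R c = a) : Algebra.FiniteType k R := by
  obtain ⟨t, ht, hspan⟩ := (Submodule.fg_span_iff_fg_span_finset_subset
    (R := R) (⋃ n : ℕ, ⋃ _ : 0 < n, (𝒜 n : Set R))).1 (IsNoetherian.noetherian _)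
  have mem_adjoin := mem_adjoin_of_mem_piece 𝒜 h₀ (t := t)
    (fun x hx => by simpa using ht hx)
    (fun n hn a ha => hspan.le (Submodule.subset_span (Set.mem_iUnion₂.2 ⟨n, hn, ha⟩)))
  refine ⟨t, eq_top_iff.2 fun r _ => ?_⟩
  classical
  rw [← DirectSum.sum_support_decompose 𝒜 r]
  exact sum_mem fun n _ => mem_adjoin n _ (SetLike.coe_mem _)

end FiniteType

section PowerSeriesTensor

variable {k R : Type*} [Field k] [CommRing R] [Algebra k R] (𝒜 : ℕ → Submodule k R)

theorem isNoetherianRing_powerSeries_tensor [IsNoetherianRing R] [GradedAlgebra 𝒜]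
    (h₀ : ∀ a ∈ 𝒜 0, ∃ c : k, algebraMap k R c = a) : IsNoetherianRing (k⟦X⟧ ⊗[k] R) := by
  have := finiteType_of_isNoetherianRing 𝒜 h₀
  exact Algebra.FiniteType.isNoetherianRing k⟦X⟧ _

theorem exists_algebraMap_of_mem_baseChange (h₀ : ∀ a ∈ 𝒜 0, ∃ c : k, algebraMap k R c = a) :
    ∀ a ∈ (𝒜 0).baseChange k⟦X⟧, ∃ v : k⟦X⟧, algebraMap k⟦X⟧ (k⟦X⟧ ⊗[k] R) v = a := by
  intro a ha
  refine map_mem_of_mem_baseChange (f := LinearMap.id)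
    (𝒯 := LinearMap.range (Algebra.linearMap k⟦X⟧ (k⟦X⟧ ⊗[k] R))) (fun r hr => ?_) ha
  obtain ⟨c, rfl⟩ := h₀ r hr
  exact ⟨algebraMap k k⟦X⟧ c, Algebra.TensorProduct.tmul_one_eq_one_tmul c⟩

end PowerSeriesTensor

section HomDimension

variable {k R : Type u} {X M N : Type*} [Field k] [CommRing R] [Algebra k R]
  [AddCommGroup X] [Module k X] [Module R X] [IsScalarTower k R X]
  [AddCommGroup M] [Module k M] [Module R M] [IsScalarTower k R M]
  [AddCommGroup N] [Module k N] [Module R N] [IsScalarTower k R N]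
  {𝒜 : ℕ → Submodule k R} {𝒳 : ℤ → Submodule k X} {ℳ : ℤ → Submodule k M} {𝒩 : ℤ → Submodule k N}

theorem finite_gradedHom [Module.Finite R X] (h𝒳 : IsGradedModule 𝒜 𝒳)
    (hX : ∀ n, Module.Finite k (𝒳 n)) (hM : ∀ n, Module.Finite k (ℳ n)) :
    Module.Finite k (gradedHom (R := R) 𝒳 ℳ) := by
  obtain ⟨s, hs⟩ := h𝒳.exists_finset_span_eq_top
  let res : gradedHom (R := R) 𝒳 ℳ →ₗ[k] ∀ n : s, 𝒳 n →ₗ[k] ℳ n :=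
    { toFun f n := (f.1.restrictScalars k).restrict (f.2 n)
      map_add' _ _ := rfl
      map_smul' _ _ := rfl }
  refine Module.Finite.of_injective res fun f g hfg => Subtype.ext (LinearMap.ext_on hs ?_)
  intro x hx
  obtain ⟨n, hn, hxn⟩ := Set.mem_iUnion₂.1 hx
  exact congrArg Subtype.val (LinearMap.congr_fun (congrFun hfg ⟨n, hn⟩) ⟨x, hxn⟩)

theorem homDim_prod [Module.Finite k (gradedHom (R := R) 𝒳 ℳ)]
    [Module.Finite k (gradedHom (R := R) 𝒳 𝒩)] :
    homDim R 𝒳 (prodGrading ℳ 𝒩) = homDim R 𝒳 ℳ + homDim R 𝒳 𝒩 := by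
  let e : gradedHom (R := R) 𝒳 (prodGrading ℳ 𝒩) ≃ₗ[k]
      gradedHom (R := R) 𝒳 ℳ × gradedHom (R := R) 𝒳 𝒩 :=
    { toFun f := (⟨LinearMap.fst R M N ∘ₗ f.1, fun n x hx => (f.2 n x hx).1⟩,
        ⟨LinearMap.snd R M N ∘ₗ f.1, fun n x hx => (f.2 n x hx).2⟩)
      map_add' _ _ := rfl
      map_smul' _ _ := rfl
      invFun p := ⟨p.1.1.prod p.2.1, fun n x hx => ⟨p.1.2 n x hx, p.2.2 n x hx⟩⟩
      left_inv _ := rfl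
      right_inv _ := rfl }
  rw [homDim, e.finrank_eq, Module.finrank_prod, homDim, homDim]

theorem finite_piece [IsNoetherianRing R] [GradedAlgebra 𝒜]
    (h₀ : ∀ a ∈ 𝒜 0, ∃ c : k, algebraMap k R c = a) [Module.Finite R M]
    (hℳ : IsGradedModule 𝒜 ℳ) (n : ℤ) : Module.Finite k (ℳ n) :=
  have := hℳ.isNoetherian_piece h₀ n
  inferInstance

end HomDimension

theorem finite_prodGrading {k M N : Type*} [Field k] [AddCommGroup M] [Module k M]
    [AddCommGroup N] [Module k N] {ℳ : ℤ → Submodule k M} {𝒩 : ℤ → Submodule k N}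
    (hM : ∀ n, Module.Finite k (ℳ n)) (hN : ∀ n, Module.Finite k (𝒩 n)) (n : ℤ) :
    Module.Finite k (prodGrading ℳ 𝒩 n) :=
  Module.Finite.iff_fg.2 ((Module.Finite.iff_fg.1 (hM n)).prod (Module.Finite.iff_fg.1 (hN n)))

theorem eq_zero_of_sum_tmul_eq_zero {k S X M ι : Type*} [Field k] [AddCommGroup S] [Module k S]
    [AddCommGroup M] [Module k M] [Fintype ι] {b : ι → X → M} (hb : LinearIndependent k b)
    {c : ι → S} (hc : ∀ x, ∑ j, c j ⊗ₜ[k] b j x = 0) (j : ι) : c j = 0 := by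
  refine (Module.forall_dual_apply_eq_zero_iff k _).1 fun l => ?_
  refine Fintype.linearIndependent_iff.1 hb (fun j => l (c j)) (funext fun x => ?_) j
  simpa using congrArg (TensorProduct.lid k M ∘ l.rTensor M) (hc x)

theorem surjective_of_ker_le_X_smul {k H W : Type*} [Field k] [AddCommGroup H] [Module k⟦X⟧ H]
    [Module.Finite k⟦X⟧ H] [Module.Free k⟦X⟧ H] [AddCommGroup W] [Module k W] [Module.Finite k W]
    {ρ : H →ₛₗ[PowerSeries.constantCoeff (R := k)] W}
    (hρ : ∀ f, ρ f = 0 → ∃ g, f = (PowerSeries.X : k⟦X⟧) • g)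
    (hrank : Module.finrank k W ≤ Module.finrank k⟦X⟧ H) : Function.Surjective ρ := by
  let b := Module.finBasis k⟦X⟧ H
  have ρ_sum (c : Fin (Module.finrank k⟦X⟧ H) → k) :
      ρ (∑ j, (PowerSeries.C (c j) : k⟦X⟧) • b j) = ∑ j, c j • ρ (b j) := by
    simp only [map_sum, map_smulₛₗ, PowerSeries.constantCoeff_C]
  have indep : LinearIndependent k (fun j => ρ (b j)) := by
    refine Fintype.linearIndependent_iff.2 fun c hc j => ?_
    obtain ⟨g, hg⟩ := hρ _ ((ρ_sum c).trans hc)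
    have hcoord := congrArg (fun z => b.repr z j) hg
    simp only [Module.Basis.repr_sum_self, map_smul, Finsupp.smul_apply, smul_eq_mul] at hcoord
    simpa using congrArg PowerSeries.constantCoeff hcoord
  have span_top := indep.span_eq_top_of_card_eq_finrank' <|
    le_antisymm indep.fintype_card_le_finrank (by rwa [Fintype.card_fin])
  intro w
  obtain ⟨c, hc⟩ := (Submodule.mem_span_range_iff_exists_fun k).1
    (span_top ▸ Submodule.mem_top : w ∈ _)
  exact ⟨_, (ρ_sum c).trans hc⟩

section FamilyHom

variable {k R X Q : Type*} [Field k] [CommRing R] [Algebra k R]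
  [AddCommGroup X] [Module k X] [Module R X] [IsScalarTower k R X]
  [AddCommGroup Q] [Module k⟦X⟧ Q] [Module R Q] [SMulCommClass k⟦X⟧ R Q]
  {𝒜 : ℕ → Submodule k R} {𝒳 : ℤ → Submodule k X} {𝒬 : ℤ → Submodule k⟦X⟧ Q}

variable (R 𝒳 𝒬) in
/-- The `k⟦X⟧`-module of morphisms of graded modules from the constant family `k⟦X⟧ ⊗ X` to the
family `Q`. -/
def familyHom : Submodule k⟦X⟧ (k⟦X⟧ ⊗[k] X →ₗ[k⟦X⟧] Q) where
  carrier := {f | IsGradedHom R (fun n => (𝒳 n).baseChange k⟦X⟧) 𝒬 f}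
  zero_mem' := ⟨fun r _ => (smul_zero r).symm, fun n _ _ => zero_mem (𝒬 n)⟩
  add_mem' := .add
  smul_mem' := fun v _ => .const_smul v

theorem finite_familyHom [Module.Finite R X] (h𝒳 : IsGradedModule 𝒜 𝒳)
    (hX : ∀ n, Module.Finite k (𝒳 n)) (hQ : ∀ n, Module.Finite k⟦X⟧ (𝒬 n)) :
    Module.Finite k⟦X⟧ (familyHom R 𝒳 𝒬) := by
  obtain ⟨s, hs⟩ := h𝒳.exists_finset_span_eq_top
  let res : familyHom R 𝒳 𝒬 →ₗ[k⟦X⟧] ∀ n : s, k⟦X⟧ ⊗[k] 𝒳 n →ₗ[k⟦X⟧] 𝒬 n :=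
    { toFun f n := (f.1 ∘ₗ (𝒳 n).subtype.baseChange k⟦X⟧).codRestrict (𝒬 n) fun z =>
        f.2.map_mem n _ (LinearMap.mem_range_self _ z)
      map_add' _ _ := rfl
      map_smul' _ _ := rfl }
  have (n : s) : Module.Finite k⟦X⟧ (k⟦X⟧ ⊗[k] 𝒳 n →ₗ[k⟦X⟧] 𝒬 n) := inferInstance
  have (n : s) : IsNoetherian k⟦X⟧ (k⟦X⟧ ⊗[k] 𝒳 n →ₗ[k⟦X⟧] 𝒬 n) := inferInstance
  have : IsNoetherian k⟦X⟧ (∀ n : s, k⟦X⟧ ⊗[k] 𝒳 n →ₗ[k⟦X⟧] 𝒬 n) :=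
    isNoetherian_pi (M := fun n : s => k⟦X⟧ ⊗[k] 𝒳 n →ₗ[k⟦X⟧] 𝒬 n)
  refine Module.Finite.of_injective res fun f g hfg => Subtype.ext (LinearMap.ext fun z => ?_)
  induction z with
  | zero => rw [map_zero, map_zero]
  | add z z' hz hz' => rw [map_add, map_add, hz, hz']
  | tmul v x =>
    have hx : x ∈ Submodule.span R (⋃ n ∈ s, (𝒳 n : Set X)) := hs ▸ Submodule.mem_top
    induction hx using Submodule.span_induction with
    | mem x hx =>
      obtain ⟨n, hn, hxn⟩ := Set.mem_iUnion₂.1 hx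
      exact congrArg Subtype.val (LinearMap.congr_fun (congrFun hfg ⟨n, hn⟩) (v ⊗ₜ ⟨x, hxn⟩))
    | zero => rw [TensorProduct.tmul_zero, map_zero, map_zero]
    | add x y _ _ hx hy => rw [TensorProduct.tmul_add, map_add, map_add, hx, hy]
    | smul r x _ hx => rw [← right_smul_tmul, f.2.map_smul, g.2.map_smul, hx]

end FamilyHom

namespace IsDegeneration

variable {k R M N X Q : Type u} [Field k] [CommRing R] [Algebra k R]
  [AddCommGroup M] [Module k M] [Module R M] [IsScalarTower k R M]
  [AddCommGroup N] [Module k N] [Module R N]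
  [AddCommGroup X] [Module k X] [Module R X] [IsScalarTower k R X]
  [AddCommGroup Q] [Module k⟦X⟧ Q] [Module R Q] [SMulCommClass k⟦X⟧ R Q]
  {ℳ : ℤ → Submodule k M} {𝒩 : ℤ → Submodule k N} {𝒳 : ℤ → Submodule k X}
  {𝒬 : ℤ → Submodule k⟦X⟧ Q}
  {π : Q →ₛₗ[PowerSeries.constantCoeff (R := k)] N} {ι : Q →ₗ[k⟦X⟧] Loc k ⊗[k] M}

theorem exists_eq_X_smul (h : IsDegeneration R ℳ 𝒩 𝒬 π ι) (h𝒬 : DirectSum.IsInternal 𝒬)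
    {f : k⟦X⟧ ⊗[k] X →ₗ[k⟦X⟧] Q} (hf : f ∈ familyHom R 𝒳 𝒬) (hπ : ∀ z, π (f z) = 0) :
    ∃ g ∈ familyHom R 𝒳 𝒬, f = (PowerSeries.X : k⟦X⟧) • g := by
  have inj : Function.Injective (LinearMap.lsmul k⟦X⟧ Q (PowerSeries.X : k⟦X⟧)) := by
    have := h.X_pow_smul_injective 1
    rwa [pow_one] at this
  choose g hg using fun z => h.special_ker _ (hπ z)
  let g' : k⟦X⟧ ⊗[k] X →ₗ[k⟦X⟧] Q :=
    { toFun := g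
      map_add' z z' := inj (by simp only [map_add, LinearMap.lsmul_apply, ← hg])
      map_smul' v z := inj (by
        simp only [map_smul, LinearMap.lsmul_apply, RingHom.id_apply, ← hg]) }
  have hf' : IsGradedHom R (fun n => (𝒳 n).baseChange k⟦X⟧) 𝒬
      fun z => (PowerSeries.X : k⟦X⟧) • g' z := (funext hg : ⇑f = _) ▸ hf
  exact ⟨g', .of_comp_injective (g := (LinearMap.lsmul k⟦X⟧ Q PowerSeries.X).toAddMonoidHom) hf'
    ⟨fun r _ => smul_comm _ r _, fun n _ => (𝒬 n).smul_mem _⟩ inj h𝒬.submodule_iSup_eq_top h𝒬,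
    LinearMap.ext hg⟩

theorem homDim_le_finrank [Module.Finite R X] (h : IsDegeneration R ℳ 𝒩 𝒬 π ι)
    (h𝒬 : iSup 𝒬 = ⊤) (hℳ : DirectSum.IsInternal ℳ) [Module.Finite k⟦X⟧ (familyHom R 𝒳 𝒬)]
    [Module.Finite k (gradedHom (R := R) 𝒳 ℳ)] :
    homDim R 𝒳 ℳ ≤ Module.finrank k⟦X⟧ (familyHom R 𝒳 𝒬) := by
  let b := Module.finBasis k (gradedHom (R := R) 𝒳 ℳ)
  have hb : LinearIndependent k fun j => ((b j).1 : X → M) :=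
    b.linearIndependent.map' (LinearMap.ltoFun R X M k ∘ₗ (gradedHom (R := R) 𝒳 ℳ).subtype)
      (LinearMap.ker_eq_bot.2 (DFunLike.coe_injective.comp Subtype.val_injective))
  choose n g hg hιg using fun j => h.exists_X_pow_smul_lift h𝒬 hℳ
    (φ := ((b j).1.restrictScalars k).baseChange (Loc k) ∘ₗ localization k X)
    ((isGradedHom_baseChange (b j).2).comp (isDegeneration_constant (R := R) 𝒳).generic)
  have indep : LinearIndependent k⟦X⟧ fun j => (⟨g j, hg j⟩ : familyHom R 𝒳 𝒬) := by
    refine Fintype.linearIndependent_iff.2 fun v hv j => ?_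
    have sum_tmul (x) : ∑ j, algebraMap k⟦X⟧ (Loc k) (v j * PowerSeries.X ^ n j) ⊗ₜ[k]
        (b j).1 x = 0 := by
      have := congrArg (fun f : familyHom R 𝒳 𝒬 => ι (f.1 (1 ⊗ₜ x))) hv
      simp only [Submodule.coe_sum, LinearMap.sum_apply, map_sum, Submodule.coe_smul,
        LinearMap.smul_apply, map_smul, hιg] at this
      refine (Finset.sum_congr rfl fun j _ => ?_).trans (this.trans (map_zero ι))
      rw [smul_smul, LinearMap.comp_apply, localization_tmul, map_one,
        LinearMap.coe_restrictScalars, LinearMap.baseChange_tmul, TensorProduct.smul_tmul',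
        Algebra.smul_def, mul_one]
      rfl
    have hv0 := eq_zero_of_sum_tmul_eq_zero hb sum_tmul j
    rw [map_eq_zero_iff _ (IsLocalization.injective (Loc k)
      (powers_le_nonZeroDivisors_of_noZeroDivisors PowerSeries.X_ne_zero))] at hv0
    exact (mul_eq_zero.1 hv0).resolve_right (pow_ne_zero _ PowerSeries.X_ne_zero)
  simpa [homDim] using indep.fintype_card_le_finrank

theorem exists_lift [IsScalarTower k R N] [Module.Finite R X] (h : IsDegeneration R ℳ 𝒩 𝒬 π ι)
    (h𝒬 : DirectSum.IsInternal 𝒬) (hℳ : DirectSum.IsInternal ℳ)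
    [Module.Finite k⟦X⟧ (familyHom R 𝒳 𝒬)] [Module.Finite k (gradedHom (R := R) 𝒳 ℳ)]
    [Module.Finite k (gradedHom (R := R) 𝒳 𝒩)] (hdim : homDim R 𝒳 𝒩 ≤ homDim R 𝒳 ℳ)
    {φ : X →ₗ[R] N} (hφ : IsHomogeneousMap 𝒳 𝒩 φ) :
    ∃ f ∈ familyHom R 𝒳 𝒬, ∀ z, π (f z) = φ (reduction k X z) := by
  have : Module.IsTorsionFree k⟦X⟧ Q :=
    h.generic_injective.moduleIsTorsionFree ι fun v q => map_smul ι v q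
  have : Module.IsTorsionFree k⟦X⟧ (k⟦X⟧ ⊗[k] X →ₗ[k⟦X⟧] Q) :=
    DFunLike.coe_injective.moduleIsTorsionFree (fun f => (f : k⟦X⟧ ⊗[k] X → Q)) fun _ _ => rfl
  have π_eq (f : k⟦X⟧ ⊗[k] X →ₗ[k⟦X⟧] Q) (z) : π (f z) = π (f (1 ⊗ₜ reduction k X z)) := by
    obtain ⟨z', hz'⟩ := exists_eq_one_tmul_reduction_add z
    nth_rw 1 [hz']
    rw [map_add, map_smul, map_add, map_smulₛₗ, PowerSeries.constantCoeff_X, zero_smul, add_zero]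
  let ρ : familyHom R 𝒳 𝒬 →ₛₗ[PowerSeries.constantCoeff (R := k)] gradedHom (R := R) 𝒳 𝒩 :=
    { toFun f := ⟨
        { toFun x := π (f.1 (1 ⊗ₜ x))
          map_add' x y := by rw [TensorProduct.tmul_add, map_add, map_add]
          map_smul' r x := by
            rw [← right_smul_tmul, f.2.map_smul, h.special.map_smul, RingHom.id_apply] },
        fun n x hx => h.special.map_mem n _
          (f.2.map_mem n _ (Submodule.tmul_mem_baseChange_of_mem 1 hx))⟩
      map_add' f g := Subtype.ext (LinearMap.ext fun x => map_add π _ _)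
      map_smul' v f := Subtype.ext (LinearMap.ext fun x => map_smulₛₗ π v _) }
  have ρ_apply (f x) : (ρ f).1 x = π (f.1 (1 ⊗ₜ x)) := rfl
  have ρ_surj : Function.Surjective ρ := surjective_of_ker_le_X_smul (fun f hf => by
    obtain ⟨g, hg, hfg⟩ := h.exists_eq_X_smul h𝒬 f.2 fun z => by
      rw [π_eq, ← ρ_apply, hf]
      rfl
    exact ⟨⟨g, hg⟩, Subtype.ext hfg⟩)
    (hdim.trans (h.homDim_le_finrank h𝒬.submodule_iSup_eq_top hℳ))
  obtain ⟨f, hf⟩ := ρ_surj ⟨φ, hφ⟩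
  exact ⟨f, f.2, fun z => by rw [π_eq, ← ρ_apply, hf]⟩

end IsDegeneration

theorem smulCommClass_of_isScalarTower {k R S Q : Type*} [CommRing k] [CommRing R] [Algebra k R]
    [CommRing S] [Algebra k S] [AddCommGroup Q] [Module S Q] [Module R Q] [Module (S ⊗[k] R) Q]
    [IsScalarTower S (S ⊗[k] R) Q] [IsScalarTower R (S ⊗[k] R) Q] : SMulCommClass S R Q where
  smul_comm s r q := by
    have h := mul_smul ((1 : S) ⊗ₜ[k] r) (s ⊗ₜ[k] (1 : R)) q
    rwa [Algebra.TensorProduct.tmul_mul_tmul, one_mul, mul_one, one_tmul_smul, tmul_smul_eq,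
      tmul_smul_eq, one_smul] at h

theorem Degenerates.cancel {k R M N X : Type u} [Field k] [CommRing R] [Algebra k R]
    [AddCommGroup M] [Module k M] [Module R M] [IsScalarTower k R M] [Module.Finite R M]
    [AddCommGroup N] [Module k N] [Module R N] [IsScalarTower k R N] [Module.Finite R N]
    [AddCommGroup X] [Module k X] [Module R X] [IsScalarTower k R X] [Module.Finite R X]
    {𝒜 : ℕ → Submodule k R} [GradedAlgebra 𝒜] [IsNoetherianRing R]
    {ℳ : ℤ → Submodule k M} {𝒩 : ℤ → Submodule k N} {𝒳 : ℤ → Submodule k X}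
    (h₀ : ∀ a ∈ 𝒜 0, ∃ c : k, algebraMap k R c = a) (hℳ : IsGradedModule 𝒜 ℳ)
    (h𝒩 : IsGradedModule 𝒜 𝒩) (h𝒳 : IsGradedModule 𝒜 𝒳) (hdim : homDim R 𝒳 ℳ = homDim R 𝒳 𝒩)
    (h : Degenerates 𝒜 (prodGrading ℳ 𝒳) (prodGrading 𝒩 𝒳)) : Degenerates 𝒜 ℳ 𝒩 := by
  have hX := finite_piece h₀ h𝒳
  have := finite_gradedHom h𝒳 hX (finite_piece h₀ hℳ)
  have := finite_gradedHom h𝒳 hX (finite_piece h₀ h𝒩)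
  have := finite_gradedHom h𝒳 hX hX
  have := finite_gradedHom h𝒳 hX (finite_prodGrading (finite_piece h₀ hℳ) hX)
  have := finite_gradedHom h𝒳 hX (finite_prodGrading (finite_piece h₀ h𝒩) hX)
  obtain ⟨Q, _, _, _, _, _, _, 𝒬, π, ι, h𝒬, _, h⟩ := h.exists_isDegeneration
  have : SMulCommClass k⟦X⟧ R Q := smulCommClass_of_isScalarTower (k := k)
  have := isNoetherianRing_powerSeries_tensor 𝒜 h₀
  have hQ (n) : Module.Finite k⟦X⟧ (𝒬 n) :=
    have := h𝒬.isNoetherian_piece (exists_algebraMap_of_mem_baseChange 𝒜 h₀) n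
    inferInstance
  have := finite_familyHom (R := R) h𝒳 hX hQ
  have hℳ𝒳 := isInternal_prodGrading hℳ.isInternal h𝒳.isInternal
  obtain ⟨f, hf, hfπ⟩ := h.exists_lift (φ := LinearMap.inr R N X) h𝒬.isInternal hℳ𝒳
    (by rw [homDim_prod, homDim_prod, hdim]) (fun n x hx => ⟨zero_mem _, hx⟩)
  exact h.cancel (i := LinearMap.inr R M X) (p := LinearMap.snd R M X) (c := LinearMap.fst R M X)
    h𝒬 hℳ𝒳 h𝒩.isInternal h𝒳 hℳ.isInternal hX (fun n x hx => ⟨zero_mem _, hx⟩)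
    (fun n x hx => hx.2) (fun n x hx => hx.1) rfl LinearMap.fst_surjective
    Function.Exact.inr_fst hf hfπ

section InjectiveDimension

open CategoryTheory CategoryTheory.Abelian IsLocalRing RingTheory.Sequence

variable {B : Type u} [CommRing B]

theorem subsingleton_ext_of_shortExact {S : ShortComplex (ModuleCat.{u} B)} (hS : S.ShortExact)
    (Y : ModuleCat.{u} B) (n : ℕ) [h₁ : Subsingleton (Ext S.X₁ Y n)]
    [h₃ : Subsingleton (Ext S.X₃ Y n)] : Subsingleton (Ext S.X₂ Y n) := by
  refine subsingleton_of_forall_eq 0 fun e => ?_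
  obtain ⟨e', rfl⟩ := Ext.contravariant_sequence_exact₂ hS Y e (Subsingleton.elim _ _)
  rw [Subsingleton.elim e' 0, Ext.comp_zero]

theorem subsingleton_ext_left_of_shortExact {S : ShortComplex (ModuleCat.{u} B)}
    (hS : S.ShortExact) (Y : ModuleCat.{u} B) (n : ℕ) [h₂ : Subsingleton (Ext S.X₂ Y n)]
    [h₃ : Subsingleton (Ext S.X₃ Y (n + 1))] : Subsingleton (Ext S.X₁ Y n) := by
  refine subsingleton_of_forall_eq 0 fun e => ?_
  obtain ⟨e', rfl⟩ := Ext.contravariant_sequence_exact₁ hS Y e (add_comm 1 n)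
    (Subsingleton.elim _ _)
  rw [Subsingleton.elim e' 0, Ext.comp_zero]

theorem subsingleton_ext_of_subsingleton (T : Type u) [AddCommGroup T] [Module B T]
    [Subsingleton T] (Y : ModuleCat.{u} B) (n : ℕ) :
    Subsingleton (Ext (ModuleCat.of B T) Y n) := by
  have : Limits.IsZero (ModuleCat.of B T) := ModuleCat.isZero_of_subsingleton _
  refine subsingleton_of_forall_eq 0 fun e => ?_
  rw [← Ext.mk₀_id_comp e, this.eq_zero_of_src (𝟙 _), Ext.mk₀_zero, Ext.zero_comp]

theorem subsingleton_ext_congr {T T' : Type u} [AddCommGroup T] [Module B T] [AddCommGroup T']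
    [Module B T'] (e : T ≃ₗ[B] T') (Y : ModuleCat.{u} B) (n : ℕ)
    [h : Subsingleton (Ext (ModuleCat.of B T) Y n)] :
    Subsingleton (Ext (ModuleCat.of B T') Y n) := by
  refine subsingleton_of_forall_eq 0 fun x => ?_
  have h1 : (Ext.mk₀ e.symm.toModuleIso.hom).comp ((Ext.mk₀ e.toModuleIso.hom).comp x
      (zero_add n)) (zero_add n) = x := by
    rw [← Ext.comp_assoc_of_second_deg_zero, Ext.mk₀_comp_mk₀]
    have : e.symm.toModuleIso.hom ≫ e.toModuleIso.hom = 𝟙 (ModuleCat.of B T') := by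
      ext y
      simp
    rw [this, Ext.mk₀_id_comp]
  rw [← h1, Subsingleton.elim ((Ext.mk₀ e.toModuleIso.hom).comp x (zero_add n)) 0, Ext.comp_zero]

theorem subsingleton_ext_of_injective {T T' : Type u} [AddCommGroup T] [Module B T]
    [AddCommGroup T'] [Module B T'] {f : T →ₗ[B] T'} (hf : Function.Injective f)
    (Y : ModuleCat.{u} B) (n : ℕ) (hT' : Subsingleton (Ext (ModuleCat.of B T') Y n))
    (hcoker : Subsingleton (Ext (ModuleCat.of B (T' ⧸ LinearMap.range f)) Y (n + 1))) :
    Subsingleton (Ext (ModuleCat.of B T) Y n) := by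
  let S := ModuleCat.shortComplexOfCompEqZero f (LinearMap.range f).mkQ
    (LinearMap.range_mkQ_comp f)
  have hS : S.ShortExact := ModuleCat.shortComplex_shortExact S
    (LinearMap.exact_map_mkQ_range f) hf (Submodule.mkQ_surjective _)
  exact subsingleton_ext_left_of_shortExact hS Y n (h₂ := hT') (h₃ := hcoker)

variable [IsLocalRing B]

theorem subsingleton_of_forall_eq_smul {E : Type*} [AddCommGroup E] [Module B E]
    [Module.Finite B E] {x : B} (mem : x ∈ maximalIdeal B) (h : ∀ y : E, ∃ z, y = x • z) :
    Subsingleton E := by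
  have : (⊤ : Submodule B E) = ⊥ := by
    refine Submodule.eq_bot_of_le_smul_of_le_jacobson_bot (maximalIdeal B) _
      Module.Finite.fg_top ?_ (maximalIdeal_le_jacobson _)
    rintro y -
    obtain ⟨z, rfl⟩ := h y
    exact Submodule.smul_mem_smul mem trivial
  exact (Submodule.subsingleton_iff B).1 (subsingleton_of_bot_eq_top this.symm)

theorem length_le_ringKrullDim [IsNoetherianRing B] {rs : List B}
    (mem : ∀ r ∈ rs, r ∈ maximalIdeal B) (reg : IsWeaklyRegular B rs) :
    (rs.length : WithBot ℕ∞) ≤ ringKrullDim B := by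
  have hne : Ideal.ofList rs ≠ ⊤ :=
    ((Ideal.span_le.2 mem).trans_lt (maximalIdeal.isMaximal B).lt_top).ne
  have : Nontrivial (B ⧸ Ideal.ofList rs) := Ideal.Quotient.nontrivial_iff.2 hne
  rw [← ringKrullDim_add_length_eq_ringKrullDim_of_isRegular rs
    ⟨reg, by rwa [smul_eq_mul, Ideal.mul_top, ne_comm]⟩]
  exact le_add_of_nonneg_left ringKrullDim_nonneg_of_nontrivial

theorem exists_maximal_isWeaklyRegular [IsNoetherianRing B] :
    ∃ rs : List B, (∀ r ∈ rs, r ∈ maximalIdeal B) ∧ IsWeaklyRegular B rs ∧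
      ∀ rs' : List B, (∀ r ∈ rs', r ∈ maximalIdeal B) → IsWeaklyRegular B rs' →
        rs'.length ≤ rs.length := by
  let lengths : Set ℕ := List.length '' {rs : List B | (∀ r ∈ rs, r ∈ maximalIdeal B) ∧
    IsWeaklyRegular B rs}
  have hbdd : BddAbove lengths := ⟨(maximalIdeal B).spanFinrank, by
    rintro _ ⟨rs, ⟨mem, reg⟩, rfl⟩
    exact_mod_cast (length_le_ringKrullDim mem reg).trans
      (ringKrullDim_le_spanFinrank_maximalIdeal B)⟩
  obtain ⟨rs, ⟨mem, reg⟩, hrs⟩ :=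
    Nat.sSup_mem (s := lengths) ⟨0, [], ⟨by simp, IsWeaklyRegular.nil B B⟩, rfl⟩ hbdd
  exact ⟨rs, mem, reg, fun rs' mem' reg' => hrs ▸ le_csSup hbdd ⟨rs', ⟨mem', reg'⟩, rfl⟩⟩

variable [IsNoetherianRing B]

theorem exists_residueField_injective {rs : List B} (mem : ∀ r ∈ rs, r ∈ maximalIdeal B)
    (reg : IsWeaklyRegular B rs)
    (hmax : ∀ rs' : List B, (∀ r ∈ rs', r ∈ maximalIdeal B) → IsWeaklyRegular B rs' →
      rs'.length ≤ rs.length) :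
    ∃ f : (B ⧸ maximalIdeal B) →ₗ[B] (B ⧸ Ideal.ofList rs • (⊤ : Submodule B B)),
      Function.Injective f := by
  have h1 : ¬ Subsingleton ((B ⧸ maximalIdeal B) →ₗ[B]
      (B ⧸ Ideal.ofList rs • (⊤ : Submodule B B))) := by
    rw [IsSMulRegular.subsingleton_linearMap_iff]
    rintro ⟨x, hx, hreg⟩
    rw [Ideal.annihilator_quotient] at hx
    have := hmax (rs ++ [x]) (by simpa [or_imp, forall_and] using ⟨mem, hx⟩) (by
      rw [isWeaklyRegular_append_iff]
      exact ⟨reg, (isWeaklyRegular_singleton_iff _ _).2 hreg⟩)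
    simp at this
  rw [not_subsingleton_iff_nontrivial] at h1
  obtain ⟨f, hf⟩ := exists_ne (0 : (B ⧸ maximalIdeal B) →ₗ[B]
      (B ⧸ Ideal.ofList rs • (⊤ : Submodule B B)))
  have : IsSimpleModule B (B ⧸ maximalIdeal B) :=
    isSimpleModule_iff_isCoatom.2 (maximalIdeal.isMaximal B).out
  exact ⟨f, (LinearMap.injective_or_eq_zero f).resolve_right hf⟩

theorem subsingleton_ext_of_isSMulRegular {T Y : ModuleCat.{u} B} [Module.Finite B T]
    [Module.Finite B Y] {x : B} (reg : IsSMulRegular T x) (mem : x ∈ maximalIdeal B) {n : ℕ}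
    (h : Subsingleton (Ext (ModuleCat.of B (QuotSMulTop x T)) Y (n + 1))) :
    Subsingleton (Ext T Y n) := by
  have hS := reg.smulShortComplex_shortExact
  refine subsingleton_of_forall_eq_smul mem fun y => ?_
  obtain ⟨z, hz⟩ := Ext.contravariant_sequence_exact₁ hS Y y (add_comm 1 n)
    (h.elim _ _)
  have h1 : ∀ z : Ext T Y n, (Ext.mk₀ (x • 𝟙 T)).comp z (zero_add n) = x • z := fun z => by
    rw [Ext.mk₀_smul, Ext.smul_comp, Ext.mk₀_id_comp]
  exact ⟨z, hz.symm.trans (h1 z)⟩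

theorem subsingleton_ext_of_isWeaklyRegular {Y : ModuleCat.{u} B} [Module.Finite B Y] {n : ℕ}
    (h : ∀ (W : Type u) [AddCommGroup W] [Module B W] [Module.Finite B W] (i : ℕ), n < i →
      Subsingleton (Ext (ModuleCat.of B W) Y i))
    (rs : List B) (mem : ∀ r ∈ rs, r ∈ maximalIdeal B)
    (T : Type u) [AddCommGroup T] [Module B T] [Module.Finite B T] (reg : IsWeaklyRegular T rs)
    (i : ℕ) (hi : n < i + rs.length) : Subsingleton (Ext (ModuleCat.of B T) Y i) := by
  induction rs generalizing T i with
  | nil => exact h T i hi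
  | cons x rs ih =>
    rw [isWeaklyRegular_cons_iff] at reg
    refine subsingleton_ext_of_isSMulRegular (T := ModuleCat.of B T) reg.1
      (mem x List.mem_cons_self) (ih (fun r hr => mem r (List.mem_cons_of_mem _ hr))
        (QuotSMulTop x T) reg.2 (i + 1) ?_)
    rw [List.length_cons] at hi
    omega

theorem subsingleton_ext_of_residueField {Y : ModuleCat.{u} B} [Module.Finite B Y] {n : ℕ}
    (h : ∀ (W : Type u) [AddCommGroup W] [Module B W] [Module.Finite B W],
      Subsingleton (Ext (ModuleCat.of B W) Y (n + 1)))
    (hk : Subsingleton (Ext (ModuleCat.of B (B ⧸ maximalIdeal B)) Y n))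
    (W : Type u) [AddCommGroup W] [Module B W] [hW : Module.Finite B W] :
    Subsingleton (Ext (ModuleCat.of B W) Y n) := by
  induction hW using IsNoetherianRing.induction_on_isQuotientEquivQuotientPrime B with
  | subsingleton N => exact subsingleton_ext_of_subsingleton N Y n
  | quotient N p f =>
    have := p.2
    suffices hp : Subsingleton (Ext (ModuleCat.of B (B ⧸ p.1)) Y n) from
      subsingleton_ext_congr f.symm Y n
    by_cases hpm : p.1 = maximalIdeal B
    · rw [hpm]
      exact hk
    · obtain ⟨x, hx, hxp⟩ := SetLike.exists_of_lt
        (lt_of_le_of_ne (le_maximalIdeal p.2.ne_top) hpm)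
      refine subsingleton_ext_of_isSMulRegular (T := ModuleCat.of B (B ⧸ p.1)) (x := x) ?_ hx
        (h _)
      rw [isSMulRegular_iff_right_eq_zero_of_smul]
      intro y hy
      obtain ⟨y, rfl⟩ := Ideal.Quotient.mk_surjective y
      have hy' : Ideal.Quotient.mk p.1 (x * y) = 0 := hy
      rw [Ideal.Quotient.eq_zero_iff_mem] at hy' ⊢
      exact (p.2.mem_or_mem hy').resolve_left hxp
  | exact N₁ N₂ N₃ f g hf hg hfg h₁ h₃ =>
    exact subsingleton_ext_of_shortExact (ModuleCat.shortComplex_shortExact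
      (ModuleCat.shortComplexOfCompEqZero f g hfg.linearMap_comp_eq_zero) hfg hf hg) Y n

-- If `B / (rs)` contains the residue field, then `Ext^i(k, B)` embeds, up to `Ext^(i+1)`, into
-- `Ext^i(B / (rs), B)`, which vanishes for `i > rs.length` by the Koszul resolution.
theorem exists_forall_subsingleton_ext {n : ℕ}
    (hn : HasInjectiveDimensionLE (ModuleCat.of B B) n) :
    ∃ a : ℕ, (a : WithBot ℕ∞) ≤ ringKrullDim B ∧
      ∀ (W : Type u) [AddCommGroup W] [Module B W] [Module.Finite B W] (i : ℕ), a < i →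
        Subsingleton (Ext (ModuleCat.of B W) (ModuleCat.of B B) i) := by
  obtain ⟨rs, mem, reg, hmax⟩ := exists_maximal_isWeaklyRegular (B := B)
  obtain ⟨f, hf⟩ := exists_residueField_injective mem reg hmax
  have hpd := ModuleCat.projectiveDimension_quotient_eq_add_length_of_isWeaklyRegular
    (ModuleCat.of B B) rs reg mem
  rw [ModuleCat.projectiveDimension_eq_zero_of_projective (ModuleCat.of B B), zero_add] at hpd
  have hpd' := (projectiveDimension_le_iff _ _).1 hpd.le
  refine ⟨rs.length, length_le_ringKrullDim mem reg, ?_⟩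
  suffices key : ∀ (j : ℕ) (W : Type u) [AddCommGroup W] [Module B W] [Module.Finite B W] (i : ℕ),
      rs.length < i → n + 1 ≤ i + j →
      Subsingleton (Ext (ModuleCat.of B W) (ModuleCat.of B B) i) from
    fun W _ _ _ i hi => key (n + 1) W i hi (by omega)
  intro j
  induction j with
  | zero => exact fun W _ _ _ i _ hi => HasInjectiveDimensionLT.subsingleton _ (n + 1) i hi _
  | succ j ih =>
    intro W _ _ _ i hi hij
    have above (W : Type u) [AddCommGroup W] [Module B W] [Module.Finite B W] :
        Subsingleton (Ext (ModuleCat.of B W) (ModuleCat.of B B) (i + 1)) :=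
      ih W (i + 1) (by omega) (by omega)
    exact subsingleton_ext_of_residueField above (subsingleton_ext_of_injective hf _ i
      (HasProjectiveDimensionLT.subsingleton _ (rs.length + 1) i hi _) (above _)) W

end InjectiveDimension

section ExtendFunctionals

open CategoryTheory CategoryTheory.Abelian RingTheory.Sequence

theorem exists_extension_of_subsingleton_ext {B : Type u} [CommRing B]
    {S : ShortComplex (ModuleCat.{u} B)} (hS : S.ShortExact) (Y : ModuleCat.{u} B)
    (h : Subsingleton (Ext S.X₃ Y 1)) (φ : S.X₁ ⟶ Y) : ∃ ψ : S.X₂ ⟶ Y, S.f ≫ ψ = φ := by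
  obtain ⟨e, he⟩ := Ext.contravariant_sequence_exact₁ hS Y (Ext.mk₀ φ) (add_zero 1)
    (h.elim _ _)
  obtain ⟨ψ, rfl⟩ := (Ext.mk₀_bijective S.X₂ Y).2 e
  refine ⟨ψ, (Ext.mk₀_bijective S.X₁ Y).1 ?_⟩
  rw [← he, Ext.mk₀_comp_mk₀]

section Localization

variable {R : Type u} [CommRing R] (p : Ideal R) [p.IsPrime]
  {P : Type u} [AddCommGroup P] [Module R P]

theorem exists_localized_extension {N : Type u} [AddCommGroup N] [Module R N]
    (h : Subsingleton (Ext (ModuleCat.of (Localization.AtPrime p)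
      (LocalizedModule p.primeCompl N))
      (ModuleCat.of (Localization.AtPrime p) (Localization.AtPrime p)) 1))
    {g : P →ₗ[R] N} (hg : Function.Surjective g) (φ : LinearMap.ker g →ₗ[R] R) :
    ∃ ψ : LocalizedModule p.primeCompl P →ₗ[Localization.AtPrime p] Localization.AtPrime p,
      ∀ z : LinearMap.ker g, ψ (LocalizedModule.mkLinearMap p.primeCompl P z) =
        algebraMap R (Localization.AtPrime p) (φ z) := by
  let B := Localization.AtPrime p
  let mk := LocalizedModule.mkLinearMap p.primeCompl (LinearMap.ker g)
  let j := LocalizedModule.map p.primeCompl (LinearMap.ker g).subtype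
  let g' := LocalizedModule.map p.primeCompl g
  have hex : Function.Exact j g' := LocalizedModule.map_exact p.primeCompl _ _
    (LinearMap.exact_subtype_ker_map g)
  let C := ModuleCat.shortComplexOfCompEqZero j g' hex.linearMap_comp_eq_zero
  have hC : C.ShortExact := ModuleCat.shortComplex_shortExact C hex
    (LocalizedModule.map_injective _ _ (Submodule.injective_subtype _))
    (LocalizedModule.map_surjective _ _ hg)
  let φ' : LocalizedModule p.primeCompl (LinearMap.ker g) →ₗ[B] B :=
    (IsLocalizedModule.map p.primeCompl mk (Algebra.linearMap R B)
      φ).extendScalarsOfIsLocalization p.primeCompl B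
  obtain ⟨ψ, hψ⟩ := exists_extension_of_subsingleton_ext hC (ModuleCat.of B B) h
    (ModuleCat.ofHom φ')
  refine ⟨ψ.hom, fun z => ?_⟩
  calc ψ.hom (LocalizedModule.mkLinearMap p.primeCompl P z)
      = ψ.hom (j (mk z)) := congrArg ψ.hom (IsLocalizedModule.map_apply p.primeCompl mk
        (LocalizedModule.mkLinearMap p.primeCompl P) (LinearMap.ker g).subtype z).symm
    _ = φ' (mk z) := congrArg (fun a => a.hom (mk z)) hψ
    _ = algebraMap R B (φ z) := IsLocalizedModule.map_apply _ _ _ _ _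

theorem exists_extension_of_localized_extension [Module.FinitePresentation R P]
    (K : Submodule R P) [Module.Finite R K] (φ : K →ₗ[R] R)
    (ψ' : LocalizedModule p.primeCompl P →ₗ[Localization.AtPrime p] Localization.AtPrime p)
    (hψ' : ∀ z : K, ψ' (LocalizedModule.mkLinearMap p.primeCompl P z) =
      algebraMap R (Localization.AtPrime p) (φ z)) :
    ∃ u ∉ p, ∃ ψ : P →ₗ[R] R, ∀ z : K, ψ z = u * φ z := by
  let B := Localization.AtPrime p
  obtain ⟨ψ, s, hs⟩ := Module.FinitePresentation.exists_lift_of_isLocalizedModule p.primeCompl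
    (Algebra.linearMap R B)
    ((ψ'.restrictScalars R) ∘ₗ LocalizedModule.mkLinearMap p.primeCompl P)
  have hψ : Algebra.linearMap R B ∘ₗ ψ ∘ₗ K.subtype = Algebra.linearMap R B ∘ₗ ((s : R) • φ) := by
    ext z
    refine (LinearMap.congr_fun hs (z : P)).trans ?_
    change (s : R) • ψ' _ = algebraMap R B ((s : R) * φ z)
    rw [hψ', map_mul, Algebra.smul_def]
  obtain ⟨t, ht⟩ := Module.Finite.exists_smul_of_comp_eq_of_isLocalizedModule p.primeCompl
    (Algebra.linearMap R B) _ _ hψ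
  refine ⟨t * s, (t * s).2, (t : R) • ψ, fun z => ?_⟩
  rw [mul_assoc]
  exact LinearMap.congr_fun ht z

end Localization

variable {R : Type u} [CommRing R] (p : Ideal R) [p.IsPrime]

theorem subsingleton_ext_prod_projective {N F : Type u} [AddCommGroup N] [Module R N]
    [AddCommGroup F] [Module R F] [Module.Projective R F]
    (Y : ModuleCat.{u} (Localization.AtPrime p))
    (h : Subsingleton (Ext (ModuleCat.of (Localization.AtPrime p)
      (LocalizedModule p.primeCompl N)) Y 1)) :
    Subsingleton (Ext (ModuleCat.of (Localization.AtPrime p)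
      (LocalizedModule p.primeCompl (N × F))) Y 1) := by
  let j := LocalizedModule.map p.primeCompl (LinearMap.inl R N F)
  let g := LocalizedModule.map p.primeCompl (LinearMap.snd R N F)
  have hex : Function.Exact j g := LocalizedModule.map_exact p.primeCompl _ _
    Function.Exact.inl_snd
  let C := ModuleCat.shortComplexOfCompEqZero j g hex.linearMap_comp_eq_zero
  have hC : C.ShortExact := ModuleCat.shortComplex_shortExact C hex
    (LocalizedModule.map_injective _ _ LinearMap.inl_injective)
    (LocalizedModule.map_surjective _ _ LinearMap.snd_surjective)
  have h3 : Subsingleton (Ext C.X₃ Y 1) :=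
    Ext.subsingleton_of_projective (ModuleCat.of _ (LocalizedModule p.primeCompl F)) Y 0
  have h1 : Subsingleton (Ext C.X₁ Y 1) := h
  exact subsingleton_ext_of_shortExact hC Y 1

theorem subsingleton_ext_localized_of_depth [IsNoetherianRing R] {n : ℕ}
    (hn : HasInjectiveDimensionLE
      (ModuleCat.of (Localization.AtPrime p) (Localization.AtPrime p)) n)
    {N : Type u} [AddCommGroup N] [Module R N] [Module.Finite R N]
    (hN : ∀ i : ℕ, (i : WithBot ℕ∞) < ringKrullDim R →
      Subsingleton (Ext (ModuleCat.of R (R ⧸ p)) (ModuleCat.of R N) i)) :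
    Subsingleton (Ext (ModuleCat.of (Localization.AtPrime p)
      (LocalizedModule p.primeCompl N))
      (ModuleCat.of (Localization.AtPrime p) (Localization.AtPrime p)) 1) := by
  obtain ⟨a, ha, hext⟩ := exists_forall_subsingleton_ext hn
  have ha' : (a : WithBot ℕ∞) ≤ ringKrullDim R := by
    refine ha.trans ?_
    rw [IsLocalization.AtPrime.ringKrullDim_eq_height p]
    exact Ideal.height_le_ringKrullDim_of_ne_top Ideal.IsPrime.ne_top'
  by_cases htop : p • (⊤ : Submodule R N) = ⊤
  · obtain ⟨r, hr, hr'⟩ := Submodule.exists_sub_one_mem_and_smul_eq_zero_of_fg_of_le_smul p ⊤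
      (Module.Finite.fg_top (R := R) (M := N)) htop.ge
    have hrp : r ∉ p := fun hrp => (inferInstance : p.IsPrime).ne_top
      ((Ideal.eq_top_iff_one p).2 (by simpa using sub_mem hrp hr))
    have : Subsingleton (LocalizedModule p.primeCompl N) :=
      LocalizedModule.subsingleton_iff.2 fun m => ⟨r, hrp, hr' m trivial⟩
    exact subsingleton_ext_of_subsingleton _ _ _
  · obtain ⟨rs, hlen, hmem, hreg⟩ := ModuleCat.exists_isRegular_of_exists_subsingleton_ext p a
      (ModuleCat.of R N) (Ne.lt_top htop) (ModuleCat.of R (R ⧸ p))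
      (by rw [Module.support_eq_zeroLocus, Ideal.annihilator_quotient])
      (fun i hi => hN i (lt_of_lt_of_le (by exact_mod_cast hi) ha'))
    refine subsingleton_ext_of_isWeaklyRegular hext
      (rs.map (algebraMap R (Localization.AtPrime p))) ?_ _
      (IsWeaklyRegular.of_isLocalizedModule (Localization.AtPrime p) p.primeCompl
        (LocalizedModule.mkLinearMap p.primeCompl N) hreg.1) 1 ?_
    · simp only [List.mem_map, forall_exists_index, and_imp, forall_apply_eq_imp_iff₂]
      exact fun r hr => (IsLocalization.AtPrime.to_map_mem_maximal_iff _ p r).2 (hmem r hr)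
    · rw [List.length_map, hlen]
      omega

end ExtendFunctionals

section LiftFunctionals

theorem exists_smul_eq_zero_of_subsingleton {S C : Type*} [CommRing S] [AddCommGroup C]
    [Module S C] [Module.Finite S C] (q : Ideal S) [q.IsPrime]
    (h : Subsingleton (LocalizedModule q.primeCompl C)) : ∃ w ∉ q, ∀ c : C, w • c = 0 := by
  obtain ⟨s, hs⟩ := Module.Finite.exists_smul_of_comp_eq_of_isLocalizedModule q.primeCompl
    (LocalizedModule.mkLinearMap q.primeCompl C) LinearMap.id 0
    (LinearMap.ext fun _ => Subsingleton.elim _ _)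
  exact ⟨s, s.2, fun c => by simpa [Submonoid.smul_def] using LinearMap.congr_fun hs c⟩

theorem exists_smul_eq_zero_of_forall_exists {S C : Type*} [CommRing S] [AddCommGroup C]
    [Module S C] [Module.Finite S C] (q : Ideal S) [q.IsPrime] {x : S} (hx : x ∈ q)
    (h : ∀ c : C, ∃ u ∉ q, ∃ c', u • c = x • c') : ∃ w ∉ q, ∀ c : C, w • c = 0 := by
  refine exists_smul_eq_zero_of_subsingleton q ?_
  refine subsingleton_of_forall_eq_smul (B := Localization.AtPrime q)
    (x := algebraMap S (Localization.AtPrime q) x)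
    ((IsLocalization.AtPrime.to_map_mem_maximal_iff _ q x).2 hx) fun y => ?_
  obtain ⟨⟨c, s⟩, rfl⟩ := IsLocalizedModule.mk'_surjective q.primeCompl
    (LocalizedModule.mkLinearMap q.primeCompl C) y
  obtain ⟨u, hu, c', hc⟩ := h c
  refine ⟨IsLocalizedModule.mk' (LocalizedModule.mkLinearMap q.primeCompl C) c'
    (⟨u, hu⟩ * s), ?_⟩
  rw [algebraMap_smul, ← IsLocalizedModule.mk'_smul, ← hc]
  exact (IsLocalizedModule.mk'_cancel_left (LocalizedModule.mkLinearMap q.primeCompl C) c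
    (⟨u, hu⟩ : q.primeCompl) s).symm

variable {S R : Type*} [CommRing S] [CommRing R] [Algebra S R]

theorem exists_eq_smul_of_forall_dvd {x : S} (hx : IsSMulRegular S x) {K : Type*}
    [AddCommGroup K] [Module S K] (f : K →ₗ[S] S) (hf : ∀ z, x ∣ f z) :
    ∃ f' : K →ₗ[S] S, f = x • f' := by
  choose d hd using hf
  exact ⟨{ toFun := d
           map_add' := fun a b => hx <| by
            simp only [smul_eq_mul, mul_add, ← hd, map_add]
           map_smul' := fun a b => hx <| by
            simp only [RingHom.id_apply, smul_eq_mul, mul_left_comm x a, ← hd, map_smul] },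
    LinearMap.ext hd⟩

theorem exists_comp_eq_of_ker_le (hSR : Function.Surjective (algebraMap S R)) {K K' T : Type*}
    [AddCommGroup K] [Module S K] [AddCommGroup K'] [Module S K'] [Module R K']
    [IsScalarTower S R K'] [AddCommGroup T] [Module S T] [Module R T] [IsScalarTower S R T]
    {r : K →ₗ[S] K'} (hr : Function.Surjective r) {f : K →ₗ[S] T}
    (h : LinearMap.ker r ≤ LinearMap.ker f) : ∃ g : K' →ₗ[R] T, ∀ z, g (r z) = f z := by
  refine ⟨((LinearMap.ker r).liftQ f h ∘ₗ
    (r.quotKerEquivOfSurjective hr).symm.toLinearMap).extendScalarsOfSurjective hSR,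
    fun z => ?_⟩
  have hz : (r.quotKerEquivOfSurjective hr).symm (r z) = (LinearMap.ker r).mkQ z := by
    rw [LinearEquiv.symm_apply_eq]
    rfl
  exact congrArg ((LinearMap.ker r).liftQ f h) hz

section

variable {x : S} (hx₀ : algebraMap S R x = 0)
  {P P' Q N : Type*} [AddCommGroup P] [Module S P] [AddCommGroup P'] [Module S P'] [Module R P']
  [IsScalarTower S R P'] [AddCommGroup Q] [Module S Q] [AddCommGroup N] [Module R N]
  {G : P →ₗ[S] Q}
  {r : P →ₗ[S] P'} {g : P' →ₗ[R] N}

include hx₀ in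
theorem exists_ker_reduction [Module S N] {π : Q →ₗ[S] N} (hxQ : IsSMulRegular Q x)
    (hker : ∀ q, π q = 0 → ∃ q', q = x • q') (hG : Function.Surjective G)
    (hr : Function.Surjective r) (hr_ker : ∀ z, r z = 0 → ∃ z', z = x • z')
    (hg : ∀ z, g (r z) = π (G z)) :
    ∃ s : LinearMap.ker G →ₗ[S] LinearMap.ker g, (∀ z, (s z : P') = r z) ∧
      Function.Surjective s ∧ ∀ z, s z = 0 → ∃ z', z = x • z' := by
  refine ⟨{ toFun := fun z => ⟨r z, by rw [LinearMap.mem_ker, hg, z.2, map_zero]⟩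
            map_add' := fun a b => Subtype.ext (map_add r (a : P) b)
            map_smul' := fun a b => Subtype.ext (map_smul r a (b : P)) }, fun z => rfl, ?_, ?_⟩
  · rintro ⟨y, hy⟩
    obtain ⟨z, rfl⟩ := hr y
    obtain ⟨q, hq⟩ := hker (G z) (by rw [← hg]; exact hy)
    obtain ⟨z', rfl⟩ := hG q
    refine ⟨⟨z - x • z', by rw [LinearMap.mem_ker, map_sub, map_smul, hq, sub_self]⟩,
      Subtype.ext ?_⟩
    change r (z - x • z') = r z
    rw [map_sub, map_smul, ← algebraMap_smul R x, hx₀, zero_smul, sub_zero]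
  · rintro ⟨z, hz⟩ hz₀
    obtain ⟨z', rfl⟩ := hr_ker z (congrArg Subtype.val hz₀)
    have hz' : G z' = 0 := hxQ (((map_smul G x z').symm.trans hz).trans (smul_zero x).symm)
    exact ⟨⟨z', hz'⟩, rfl⟩

variable (hSR : Function.Surjective (algebraMap S R)) (hx : ∀ s, algebraMap S R s = 0 → x ∣ s)
  (hxS : IsSMulRegular S x) [Module.Projective S P] (p : Ideal R)

include hx₀ hSR hx hxS in
theorem exists_smul_eq_restrict_add {s : LinearMap.ker G →ₗ[S] LinearMap.ker g}
    (hs : ∀ z, (s z : P') = r z) (hs_surj : Function.Surjective s)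
    (hs_ker : ∀ z, s z = 0 → ∃ z', z = x • z')
    (hext : ∀ φ : LinearMap.ker g →ₗ[R] R, ∃ u ∉ p, ∃ ψ : P' →ₗ[R] R,
      ∀ z : LinearMap.ker g, ψ z = u * φ z) (φ : LinearMap.ker G →ₗ[S] S) :
    ∃ u : S, algebraMap S R u ∉ p ∧ ∃ (ψ : P →ₗ[S] S) (φ' : LinearMap.ker G →ₗ[S] S),
      u • φ = ψ ∘ₗ (LinearMap.ker G).subtype + x • φ' := by
  have hle : LinearMap.ker s ≤ LinearMap.ker (Algebra.linearMap S R ∘ₗ φ) := fun z hz => by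
    obtain ⟨z', rfl⟩ := hs_ker z hz
    rw [LinearMap.mem_ker, map_smul, ← algebraMap_smul R x, hx₀, zero_smul]
  obtain ⟨φ₀, hφ₀⟩ := exists_comp_eq_of_ker_le hSR hs_surj hle
  obtain ⟨u, hu, ψ₀, hψ₀⟩ := hext φ₀
  obtain ⟨u, rfl⟩ := hSR u
  obtain ⟨ψ, hψ⟩ := Module.projective_lifting_property (Algebra.linearMap S R)
    (ψ₀.restrictScalars S ∘ₗ r) hSR
  have hdvd (z : LinearMap.ker G) : x ∣ (u • φ - ψ ∘ₗ (LinearMap.ker G).subtype) z := by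
    refine hx _ ?_
    have hψz : algebraMap S R (ψ z) = algebraMap S R u * algebraMap S R (φ z) := by
      refine (LinearMap.congr_fun hψ (z : P)).trans ?_
      change ψ₀ (r z) = _
      rw [← hs, hψ₀, hφ₀]
      rfl
    simp only [LinearMap.sub_apply, LinearMap.smul_apply, LinearMap.comp_apply,
      Submodule.subtype_apply, smul_eq_mul, map_sub, map_mul, hψz, sub_self]
  obtain ⟨φ', hφ'⟩ := exists_eq_smul_of_forall_dvd hxS _ hdvd
  exact ⟨u, hu, ψ, φ', by rw [← hφ', add_sub_cancel]⟩

include hx₀ hSR hx hxS in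
/- With `C` the cokernel of the restriction of functionals from `P` to `ker G`, the hypothesis
`hres` says that `C = xC` locally at `p`, so Nakayama gives `w` with `w C = 0`. -/
theorem exists_functional_lift_of_restrict [IsNoetherianRing S] [Module.Finite S P] [p.IsPrime]
    (hG : Function.Surjective G)
    (hres : ∀ φ : LinearMap.ker G →ₗ[S] S, ∃ u : S, algebraMap S R u ∉ p ∧
      ∃ (ψ : P →ₗ[S] S) (φ' : LinearMap.ker G →ₗ[S] S),
        u • φ = ψ ∘ₗ (LinearMap.ker G).subtype + x • φ')
    (f : Q →ₗ[S] R) :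
    ∃ (h : Q →ₗ[S] S) (w : S), algebraMap S R w ∉ p ∧
      ∀ q, algebraMap S R (h q) = algebraMap S R w * f q := by
  let res : (P →ₗ[S] S) →ₗ[S] (LinearMap.ker G →ₗ[S] S) :=
    LinearMap.lcomp S S (LinearMap.ker G).subtype
  obtain ⟨w, hw, hwC⟩ := exists_smul_eq_zero_of_forall_exists
    (C := (LinearMap.ker G →ₗ[S] S) ⧸ LinearMap.range res) (p.comap (algebraMap S R)) (x := x)
    (by rw [Ideal.mem_comap, hx₀]; exact zero_mem _) (fun c => by
      obtain ⟨φ, rfl⟩ := Submodule.mkQ_surjective _ c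
      obtain ⟨u, hu, ψ, φ', e⟩ := hres φ
      refine ⟨u, hu, (LinearMap.range res).mkQ φ', ?_⟩
      rw [← map_smul, ← map_smul, e, map_add, add_eq_right]
      exact (Submodule.Quotient.mk_eq_zero _).2 ⟨ψ, rfl⟩)
  obtain ⟨ψ, hψ⟩ := Module.projective_lifting_property (Algebra.linearMap S R) (f ∘ₗ G) hSR
  replace hψ (z : P) : algebraMap S R (ψ z) = f (G z) := LinearMap.congr_fun hψ z
  obtain ⟨φ, hφ⟩ := exists_eq_smul_of_forall_dvd hxS (ψ ∘ₗ (LinearMap.ker G).subtype)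
    (fun z => hx _ ((hψ z).trans (by rw [z.2, map_zero])))
  obtain ⟨ψ', hψ'⟩ := (Submodule.Quotient.mk_eq_zero _).1 (hwC ((LinearMap.range res).mkQ φ))
  have hle : LinearMap.ker G ≤ LinearMap.ker (w • ψ - x • ψ') := fun z hz => by
    have h₁ : ψ z = x * φ ⟨z, hz⟩ := LinearMap.congr_fun hφ ⟨z, hz⟩
    have h₂ : ψ' z = w * φ ⟨z, hz⟩ := LinearMap.congr_fun hψ' ⟨z, hz⟩
    simp only [LinearMap.mem_ker, LinearMap.sub_apply, LinearMap.smul_apply, smul_eq_mul, h₁, h₂]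
    ring
  obtain ⟨h, hh⟩ := exists_comp_eq_of_ker_le (R := S) Function.surjective_id hG hle
  refine ⟨h, w, hw, fun q => ?_⟩
  obtain ⟨z, rfl⟩ := hG q
  simp only [hh, LinearMap.sub_apply, LinearMap.smul_apply, smul_eq_mul, map_sub, map_mul, hx₀,
    zero_mul, sub_zero, hψ]

end

theorem exists_functional_lift [IsNoetherianRing S] (hSR : Function.Surjective (algebraMap S R))
    {x : S} (hx₀ : algebraMap S R x = 0) (hx : ∀ s, algebraMap S R s = 0 → x ∣ s)
    (hxS : IsSMulRegular S x) {Q N : Type*} [AddCommGroup Q] [Module S Q] [Module.Finite S Q]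
    [AddCommGroup N] [Module R N] [Module S N] [IsScalarTower S R N] (hxQ : IsSMulRegular Q x)
    {π : Q →ₗ[S] N} (hπ : Function.Surjective π) (hker : ∀ q, π q = 0 → ∃ q', q = x • q')
    (p : Ideal R) [p.IsPrime]
    (hext : ∀ (m : ℕ) (g : (Fin m → R) →ₗ[R] N), Function.Surjective g →
      ∀ φ : LinearMap.ker g →ₗ[R] R, ∃ u ∉ p, ∃ ψ : (Fin m → R) →ₗ[R] R,
        ∀ z : LinearMap.ker g, ψ z = u * φ z)
    (f : N →ₗ[R] R) :
    ∃ (h : Q →ₗ[S] S) (w : S), algebraMap S R w ∉ p ∧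
      ∀ q, algebraMap S R (h q) = algebraMap S R w * f (π q) := by
  obtain ⟨m, G, hG⟩ := Module.Finite.exists_fin' S Q
  let r : (Fin m → S) →ₗ[S] (Fin m → R) := (Algebra.linearMap S R).compLeft (Fin m)
  have hr : Function.Surjective r := hSR.comp_left
  have hr_ker (z : Fin m → S) (hz : r z = 0) : ∃ z', z = x • z' := by
    choose z' hz' using fun j => hx (z j) (congrFun hz j)
    exact ⟨z', funext hz'⟩
  obtain ⟨g, hg⟩ := exists_comp_eq_of_ker_le hSR hr (f := π ∘ₗ G) fun z hz => by
    obtain ⟨z', rfl⟩ := hr_ker z hz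
    rw [LinearMap.mem_ker, map_smul, ← algebraMap_smul R x, hx₀, zero_smul]
  have hg_surj : Function.Surjective g :=
    .of_comp (g := r) (by rw [show g ∘ r = π ∘ G from funext hg]; exact hπ.comp hG)
  obtain ⟨s, hs, hs_surj, hs_ker⟩ := exists_ker_reduction hx₀ hxQ hker hG hr hr_ker hg
  exact exists_functional_lift_of_restrict hx₀ hSR hx hxS p hG
    (exists_smul_eq_restrict_add hx₀ hSR hx hxS p hs hs_surj hs_ker (hext m g hg_surj))
    (f.restrictScalars S ∘ₗ π)

end LiftFunctionals

section DegreeZeroPart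

variable {S S' M T : Type*} [CommRing S] [CommRing S'] [AddCommGroup M] [Module S M]
  [AddCommGroup T] [Module S T] [Module S' T] {ℳ : ℤ → Submodule S M} {𝒯 : ℤ → Submodule S T}

theorem proj_add_of_map_mem (hℳ : DirectSum.IsInternal ℳ) {f : M →+ M} {i : ℤ}
    (hf : ∀ n, ∀ m ∈ ℳ n, f m ∈ ℳ (i + n)) (n : ℤ) (m : M) :
    proj hℳ (i + n) (f m) = f (proj hℳ n m) := by
  refine homogeneous_induction (P := fun m => proj hℳ (i + n) (f m) = f (proj hℳ n m))
    hℳ.submodule_iSup_eq_top (fun j x hx => ?_) (by simp only [map_zero])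
    (fun x y hx hy => by simp only [map_add, hx, hy]) m
  by_cases hj : j = n
  · subst hj
    rw [proj_of_mem _ hx, proj_of_mem _ (hf _ _ hx)]
  · rw [proj_of_mem_ne _ hj hx, proj_of_mem_ne _ (by omega) (hf _ _ hx), map_zero]

theorem isGradedHom_degreeZeroPart {k R : Type*} [CommRing k] [CommRing R] [Algebra k R]
    [Module R M] [Module R T] {𝒜 : ℕ → Submodule k R} [GradedAlgebra 𝒜]
    (hℳ : DirectSum.IsInternal ℳ) (h𝒯 : DirectSum.IsInternal 𝒯)
    (smul_mem : ∀ i, ∀ r ∈ 𝒜 i, ∀ n, ∀ m ∈ ℳ n, r • m ∈ ℳ (i + n))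
    (smul_mem' : ∀ i, ∀ r ∈ 𝒜 i, ∀ n, ∀ t ∈ 𝒯 n, r • t ∈ 𝒯 (i + n)) {f : M →ₗ[S] T}
    (hf : ∀ (r : R) m, f (r • m) = r • f m) : IsGradedHom R ℳ 𝒯 (degreeZeroPart hℳ h𝒯 f) where
  map_smul r m := by
    refine homogeneous_induction (P := fun m => degreeZeroPart hℳ h𝒯 f (r • m) =
      r • degreeZeroPart hℳ h𝒯 f m) hℳ.submodule_iSup_eq_top (fun n m hm => ?_)
      (by simp only [smul_zero, map_zero])
      (fun x y hx hy => by rw [smul_add, map_add, hx, hy, map_add, smul_add]) m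
    induction r using DirectSum.Decomposition.inductionOn 𝒜 with
    | zero => rw [zero_smul, zero_smul, map_zero]
    | @homogeneous i r =>
      rw [degreeZeroPart_apply hℳ h𝒯 f (smul_mem i r r.2 n m hm),
        degreeZeroPart_apply hℳ h𝒯 f hm, hf]
      exact proj_add_of_map_mem h𝒯 (f := DistribSMul.toAddMonoidHom T (r : R))
        (smul_mem' i r r.2) n _
    | add r s hr hs => rw [add_smul, map_add, hr, hs, add_smul]
  map_mem n m hm := by
    rw [degreeZeroPart_apply hℳ h𝒯 f hm]
    exact proj_mem h𝒯 n _

end DegreeZeroPart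

section Augmentation

variable {k R : Type*} [Field k] [CommRing R] [Algebra k R]

variable (k R) in
/-- Reduction modulo the uniformizer from `k⟦X⟧ ⊗ R` to `R`, as a morphism of algebras. -/
noncomputable def augmentation : k⟦X⟧ ⊗[k] R →ₐ[k] R :=
  Algebra.TensorProduct.lift
    ((Algebra.ofId k R).comp (AlgHom.mk' (PowerSeries.constantCoeff (R := k)) fun c v => by simp))
    (AlgHom.id k R) fun _ _ => Commute.all _ _

theorem augmentation_eq_reduction (s : k⟦X⟧ ⊗[k] R) : augmentation k R s = reduction k R s := by
  induction s with
  | zero => simp only [map_zero]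
  | add x y hx hy => simp only [map_add, hx, hy]
  | tmul v r =>
    rw [augmentation, Algebra.TensorProduct.lift_tmul, reduction_tmul, Algebra.smul_def]
    rfl

theorem augmentation_surjective : Function.Surjective (augmentation k R) := fun r =>
  ⟨1 ⊗ₜ r, by rw [augmentation_eq_reduction, reduction_tmul, map_one, one_smul]⟩

theorem X_tmul_one_smul {T : Type*} [AddCommGroup T] [Module k⟦X⟧ T] [Module (k⟦X⟧ ⊗[k] R) T]
    [IsScalarTower k⟦X⟧ (k⟦X⟧ ⊗[k] R) T] (t : T) :
    ((PowerSeries.X : k⟦X⟧) ⊗ₜ[k] (1 : R)) • t = (PowerSeries.X : k⟦X⟧) • t :=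
  algebraMap_smul (k⟦X⟧ ⊗[k] R) (PowerSeries.X : k⟦X⟧) t

theorem X_tmul_one_mul (s : k⟦X⟧ ⊗[k] R) :
    ((PowerSeries.X : k⟦X⟧) ⊗ₜ[k] (1 : R)) * s = (PowerSeries.X : k⟦X⟧) • s :=
  (Algebra.smul_def (PowerSeries.X : k⟦X⟧) s).symm

end Augmentation

namespace IsDegeneration

variable {k R M N Q : Type u} [Field k] [CommRing R] [Algebra k R]
  [AddCommGroup M] [Module k M] [Module R M] [IsScalarTower k R M]
  [AddCommGroup N] [Module k N] [Module R N] [IsScalarTower k R N]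
  [AddCommGroup Q] [Module k⟦X⟧ Q] [Module R Q] [Module (k⟦X⟧ ⊗[k] R) Q]
  [IsScalarTower k⟦X⟧ (k⟦X⟧ ⊗[k] R) Q] [IsScalarTower R (k⟦X⟧ ⊗[k] R) Q]
  {𝒜 : ℕ → Submodule k R} {ℳ : ℤ → Submodule k M} {𝒩 : ℤ → Submodule k N}
  {𝒬 : ℤ → Submodule k⟦X⟧ Q}

section Functional

variable {π : Q →ₛₗ[PowerSeries.constantCoeff (R := k)] N} {ι : Q →ₗ[k⟦X⟧] Loc k ⊗[k] M}

theorem special_tensor_smul (h : IsDegeneration R ℳ 𝒩 𝒬 π ι) (s : k⟦X⟧ ⊗[k] R) (q : Q) :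
    π (s • q) = augmentation k R s • π q := by
  induction s with
  | zero =>
    rw [map_zero, zero_smul]
    exact (congrArg π (zero_smul (k⟦X⟧ ⊗[k] R) q)).trans (map_zero π)
  | add x y hx hy => rw [add_smul, map_add, hx, hy, map_add, add_smul]
  | tmul v r =>
    rw [tmul_smul_eq, map_smulₛₗ, h.special.map_smul, augmentation_eq_reduction, reduction_tmul,
      smul_assoc]

theorem exists_functional_lift [IsNoetherianRing (k⟦X⟧ ⊗[k] R)] [Module.Finite (k⟦X⟧ ⊗[k] R) Q]
    (h : IsDegeneration R ℳ 𝒩 𝒬 π ι) (p : Ideal R) [p.IsPrime]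
    (hext : ∀ (m : ℕ) (g : (Fin m → R) →ₗ[R] N), Function.Surjective g →
      ∀ φ : LinearMap.ker g →ₗ[R] R, ∃ u ∉ p, ∃ ψ : (Fin m → R) →ₗ[R] R,
        ∀ z : LinearMap.ker g, ψ z = u * φ z)
    (f : N →ₗ[R] R) :
    ∃ (H : Q →ₗ[k⟦X⟧ ⊗[k] R] k⟦X⟧ ⊗[k] R) (w : k⟦X⟧ ⊗[k] R), augmentation k R w ∉ p ∧
      ∀ q, augmentation k R (H q) = augmentation k R w * f (π q) := by
  let : Algebra (k⟦X⟧ ⊗[k] R) R := (augmentation k R).toRingHom.toAlgebra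
  let : Module (k⟦X⟧ ⊗[k] R) N := Module.compHom N (augmentation k R).toRingHom
  have : IsScalarTower (k⟦X⟧ ⊗[k] R) R N := ⟨fun s r n => mul_smul _ r n⟩
  let π' : Q →ₗ[k⟦X⟧ ⊗[k] R] N := { π.toAddMonoidHom with map_smul' := h.special_tensor_smul }
  have aug_X : augmentation k R ((PowerSeries.X : k⟦X⟧) ⊗ₜ 1) = 0 := by
    rw [augmentation_eq_reduction, reduction_tmul, PowerSeries.constantCoeff_X, zero_smul]
  have dvd_of_aug_eq_zero (s : k⟦X⟧ ⊗[k] R) (hs : augmentation k R s = 0) :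
      (PowerSeries.X : k⟦X⟧) ⊗ₜ[k] (1 : R) ∣ s := by
    obtain ⟨s', hs'⟩ := exists_eq_one_tmul_reduction_add s
    rw [← augmentation_eq_reduction, hs, TensorProduct.tmul_zero, zero_add] at hs'
    exact ⟨s', hs'.trans (X_tmul_one_mul s').symm⟩
  have regular_ring : IsSMulRegular (k⟦X⟧ ⊗[k] R) ((PowerSeries.X : k⟦X⟧) ⊗ₜ[k] (1 : R)) := by
    have hX := Module.Flat.isSMulRegular_of_nonZeroDivisors (M := k⟦X⟧ ⊗[k] R)
      (mem_nonZeroDivisors_of_ne_zero (PowerSeries.X_ne_zero (R := k)))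
    refine fun s t hst => hX ?_
    exact (X_tmul_one_mul s).symm.trans (Eq.trans hst (X_tmul_one_mul t))
  have regular_module : IsSMulRegular Q ((PowerSeries.X : k⟦X⟧) ⊗ₜ[k] (1 : R)) := fun q q' hq =>
    h.X_pow_smul_injective 1 (by simpa only [pow_one, X_tmul_one_smul] using hq)
  refine GradedDegeneration.exists_functional_lift (π := π') augmentation_surjective aug_X
    dvd_of_aug_eq_zero regular_ring regular_module h.special_surjective (fun q hq => ?_) p hext f
  obtain ⟨q', hq'⟩ := h.special_ker q hq
  exact ⟨q', by rw [X_tmul_one_smul, hq']⟩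

end Functional

section LiftFree

variable {F : Type u} [AddCommGroup F] [Module k F] [Module R F] [IsScalarTower k R F]
  {ℱ : ℤ → Submodule k F} {π : Q →ₛₗ[PowerSeries.constantCoeff (R := k)] N × F}
  {ι : Q →ₗ[k⟦X⟧] Loc k ⊗[k] M}

theorem exists_projection_lift [IsNoetherianRing (k⟦X⟧ ⊗[k] R)]
    [Module.Finite (k⟦X⟧ ⊗[k] R) Q] [Module.Finite R F] [Module.Free R F]
    (h : IsDegeneration R ℳ (prodGrading 𝒩 ℱ) 𝒬 π ι) (p : Ideal R) [p.IsPrime]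
    (hext : ∀ (m : ℕ) (g : (Fin m → R) →ₗ[R] N × F), Function.Surjective g →
      ∀ φ : LinearMap.ker g →ₗ[R] R, ∃ u ∉ p, ∃ ψ : (Fin m → R) →ₗ[R] R,
        ∀ z : LinearMap.ker g, ψ z = u * φ z) :
    ∃ (H : Q →ₗ[k⟦X⟧] k⟦X⟧ ⊗[k] F) (a : R), a ∉ p ∧ (∀ (r : R) q, H (r • q) = r • H q) ∧
      ∀ q, reduction k F (H q) = a • (π q).2 := by
  classical
  let b := Module.Free.chooseBasis R F
  choose H w hw hH using fun j =>
    h.exists_functional_lift p hext (b.coord j ∘ₗ LinearMap.snd R N F)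
  let span (y : F) : k⟦X⟧ ⊗[k] R →ₗ[k⟦X⟧] k⟦X⟧ ⊗[k] F :=
    ((LinearMap.toSpanSingleton R F y).restrictScalars k).baseChange k⟦X⟧
  let W (j) : k⟦X⟧ ⊗[k] R := ∏ i ∈ Finset.univ.erase j, w i
  let G (j) : Q →ₗ[k⟦X⟧] k⟦X⟧ ⊗[k] F :=
    span (b j) ∘ₗ LinearMap.mulLeft k⟦X⟧ (W j) ∘ₗ (H j).restrictScalars k⟦X⟧
  have G_apply (j q) : G j q = span (b j) (W j * H j q) := rfl
  refine ⟨∑ j, G j, ∏ i, augmentation k R (w i), ?_, fun r q => ?_, fun q => ?_⟩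
  · rw [Ideal.IsPrime.prod_mem_iff]
    simpa using hw
  · rw [LinearMap.sum_apply, LinearMap.sum_apply, Finset.smul_sum]
    refine Finset.sum_congr rfl fun j _ => ?_
    rw [G_apply, G_apply, ← baseChange_right_smul, right_smul_eq_mul, ← one_tmul_smul (S := k⟦X⟧)
      (k := k), map_smul, smul_eq_mul, mul_left_comm]
  · rw [LinearMap.sum_apply, map_sum]
    conv_rhs => rw [← b.sum_repr (π q).2, Finset.smul_sum]
    refine Finset.sum_congr rfl fun j _ => ?_
    rw [G_apply, reduction_baseChange, ← augmentation_eq_reduction, map_mul, hH, ← mul_assoc,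
      ← map_mul, Finset.prod_erase_mul _ _ (Finset.mem_univ j), map_prod]
    exact mul_smul _ _ _

theorem exists_inclusion_lift [Module.Finite R F] [Module.Free R F]
    (h : IsDegeneration R ℳ (prodGrading 𝒩 ℱ) 𝒬 π ι) :
    ∃ f : k⟦X⟧ ⊗[k] F →ₗ[k⟦X⟧] Q, (∀ (r : R) z, f (r • z) = r • f z) ∧
      ∀ z, π (f z) = (0, reduction k F z) := by
  let b := Module.Free.chooseBasis R F
  choose q hq using fun j => h.special_surjective (0, b j)
  let coord (j) : k⟦X⟧ ⊗[k] F →ₗ[k⟦X⟧] k⟦X⟧ ⊗[k] R :=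
    ((b.coord j).restrictScalars k).baseChange k⟦X⟧
  let G (j) : k⟦X⟧ ⊗[k] F →ₗ[k⟦X⟧] Q :=
    (LinearMap.toSpanSingleton (k⟦X⟧ ⊗[k] R) Q (q j)).restrictScalars k⟦X⟧ ∘ₗ coord j
  have G_apply (j z) : G j z = coord j z • q j := rfl
  refine ⟨∑ j, G j, fun r z => ?_, fun z => ?_⟩
  · rw [LinearMap.sum_apply, LinearMap.sum_apply, Finset.smul_sum]
    refine Finset.sum_congr rfl fun j _ => ?_
    rw [G_apply, G_apply, baseChange_right_smul, smul_assoc]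
  · rw [LinearMap.sum_apply, map_sum]
    have π_G (j) : π (G j z) = (0, b.repr (reduction k F z) j • b j) := by
      rw [G_apply, h.special_tensor_smul, augmentation_eq_reduction, reduction_baseChange, hq,
        Prod.smul_mk, smul_zero]
      rfl
    rw [Finset.sum_congr rfl fun j _ => π_G j]
    refine Prod.ext ?_ ?_
    · simp only [Prod.fst_sum, Finset.sum_const_zero]
    · rw [Prod.snd_sum]
      exact b.sum_repr _

end LiftFree

end IsDegeneration

section Expansion

variable {k R : Type u} [Field k] [CommRing R] [Algebra k R]
  {Y M : Type*} [AddCommGroup Y] [Module k Y] [Module R Y] [IsScalarTower k R Y]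
  [AddCommGroup M] [Module k M] [Module R M] [IsScalarTower k R M]
  {𝒴 : ℤ → Submodule k Y} {ℳ : ℤ → Submodule k M} {L : Type*} [CommRing L] [Algebra k L]

theorem isGradedHom_slice (l : L →ₗ[k] k) :
    IsGradedHom R (fun n => (ℳ n).baseChange L) ℳ
      fun z => TensorProduct.lid k M (l.rTensor M z) where
  map_smul r z := by
    induction z with
    | zero => simp only [smul_zero, map_zero]
    | add z w hz hw => simp only [smul_add, map_add, hz, hw]
    | tmul a m =>
      simp only [right_smul_tmul, LinearMap.rTensor_tmul, TensorProduct.lid_tmul, smul_comm (l a) r]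
  map_mem n z hz := by
    obtain ⟨w, rfl⟩ := hz
    induction w with
    | zero => simp only [map_zero, zero_mem]
    | add z w hz hw =>
      simp only [map_add]
      exact add_mem hz hw
    | tmul a m => exact (ℳ n).smul_mem (l a) m.2

theorem exists_eq_sum_smul_baseChange [Module.Finite R Y] {Φ : L ⊗[k] Y →ₗ[L] L ⊗[k] M}
    (hΦ : IsGradedHom R (fun n => (𝒴 n).baseChange L) (fun n => (ℳ n).baseChange L) Φ) :
    ∃ (s : Finset (Module.Basis.ofVectorSpaceIndex k L)) (x : s → L) (α : s → Y →ₗ[R] M),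
      (∀ j, IsHomogeneousMap 𝒴 ℳ (α j)) ∧
        Φ = ∑ j, x j • ((α j).restrictScalars k).baseChange L := by
  classical
  let e := Module.Basis.ofVectorSpace k L
  let E := TensorProduct.equivFinsuppOfBasisLeft (N := M) e
  have E_apply (z s) : E z s = TensorProduct.lid k M ((e.coord s).rTensor M z) :=
    TensorProduct.equivFinsuppOfBasisLeft_apply e z s
  have slice_graded (s) : IsGradedHom R (fun n => (ℳ n).baseChange L) ℳ fun z => E z s := by
    simpa only [E_apply] using isGradedHom_slice (e.coord s)
  let α (s) : Y →ₗ[R] M :=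
    { toFun y := E (Φ (1 ⊗ₜ y)) s
      map_add' y z := by rw [TensorProduct.tmul_add, map_add, map_add, Finsupp.add_apply]
      map_smul' r y := by
        rw [← right_smul_tmul, hΦ.map_smul, (slice_graded s).map_smul, RingHom.id_apply] }
  obtain ⟨t, ht⟩ := (Module.Finite.fg_top : (⊤ : Submodule R Y).FG)
  let J := t.biUnion fun y => (E (Φ (1 ⊗ₜ y))).support
  have α_eq_zero (s) (hs : s ∉ J) : α s = 0 :=
    LinearMap.ext_on ht fun y hy => by
      by_contra hne
      exact hs (Finset.mem_biUnion.2 ⟨y, hy, Finsupp.mem_support_iff.2 hne⟩)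
  refine ⟨J, fun s => e s, fun s => α s, fun s n y hy => (slice_graded _).map_mem n _
    (hΦ.map_mem n _ (Submodule.tmul_mem_baseChange_of_mem _ hy)),
    TensorProduct.AlgebraTensorModule.ext fun a y => ?_⟩
  have expand_one : Φ (1 ⊗ₜ y) = ∑ s ∈ J, e s ⊗ₜ α s y := by
    rw [← E.symm_apply_apply (Φ (1 ⊗ₜ y)), TensorProduct.equivFinsuppOfBasisLeft_symm_apply]
    refine Finsupp.sum_of_support_subset _ (fun s hs => ?_) _
      fun _ _ => TensorProduct.tmul_zero _ _
    by_contra hsJ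
    exact Finsupp.mem_support_iff.1 hs (LinearMap.congr_fun (α_eq_zero s hsJ) y)
  have tmul_eq : a ⊗ₜ[k] y = a • ((1 : L) ⊗ₜ[k] y) := by
    rw [TensorProduct.smul_tmul', smul_eq_mul, mul_one]
  rw [tmul_eq, map_smul, map_smul, expand_one, LinearMap.sum_apply, ← Finset.sum_coe_sort]
  refine congrArg (a • ·) (Finset.sum_congr rfl fun s _ => ?_)
  rw [LinearMap.smul_apply, LinearMap.baseChange_tmul, TensorProduct.smul_tmul', smul_eq_mul,
    mul_one]
  rfl

end Expansion

section Specialization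

open MvPolynomial

variable {k W σ ν : Type*} [Field k] [AddCommGroup W] [Module k W] [Fintype ν]

theorem aeval_det_sum {n L : Type*} [Fintype n] [DecidableEq n] [CommRing L] [Algebra k L]
    (b : Module.Basis n k W) (T : ν → Module.End k W) (P : ν → MvPolynomial σ k) (z : σ → L) :
    aeval z (∑ i, P i • (LinearMap.toMatrix b b (T i)).map C).det =
      LinearMap.det (∑ i, aeval z (P i) • (T i).baseChange L) := by
  rw [← LinearMap.det_toMatrix (Algebra.TensorProduct.basis L b), AlgHom.map_det, map_sum]
  congr 1
  ext j l
  simp [Matrix.sum_apply, LinearMap.toMatrix_baseChange]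

theorem exists_bijective_of_injective_baseChange [Module.Finite k W] [Infinite k] {L : Type*}
    [CommRing L] [IsDomain L] [Algebra k L] (T : ν → Module.End k W) (P : ν → MvPolynomial σ k)
    (z : σ → L)
    (hinj : Function.Injective (∑ i, aeval z (P i) • (T i).baseChange L :
      Module.End L (L ⊗[k] W))) :
    ∃ z' : σ → k, Function.Bijective (∑ i, eval z' (P i) • T i : Module.End k W) := by
  let b := Module.finBasis k W
  let D : MvPolynomial σ k := (∑ i, P i • (LinearMap.toMatrix b b (T i)).map C).det
  have D_ne_zero : D ≠ 0 := by
    intro hD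
    have det_eq_zero := (aeval_det_sum b T P z).symm.trans ((congrArg _ hD).trans (map_zero _))
    exact (LinearMap.bot_lt_ker_of_det_eq_zero det_eq_zero).ne' (LinearMap.ker_eq_bot.2 hinj)
  obtain ⟨z', hz'⟩ : ∃ z', eval z' D ≠ 0 := by
    by_contra! h
    exact D_ne_zero (MvPolynomial.funext fun z' => (h z').trans (map_zero _).symm)
  have baseChange_sum : ∑ i, eval z' (P i) • (T i).baseChange k =
      (∑ i, eval z' (P i) • T i).baseChange k := by
    ext w
    simp [TensorProduct.tmul_sum]
  refine ⟨z', ?_⟩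
  rw [← aeval_eq_eval, aeval_det_sum, aeval_eq_eval, baseChange_sum,
    LinearMap.det_baseChange] at hz'
  rw [← Module.End.isUnit_iff, LinearMap.isUnit_iff_isUnit_det]
  exact isUnit_iff_ne_zero.2 hz'

end Specialization

section Splitting

theorem exists_graded_leftInverse_of_surjective {k R : Type u} [Field k] [CommRing R] {F : Type*}
    [AddCommGroup F] [Module k F] [Module R F] [Module.Finite R F] {ℱ : ℤ → Submodule k F}
    (hℱ : DirectSum.IsInternal ℱ) {g : F →ₗ[R] F} (hg : IsHomogeneousMap ℱ ℱ g)
    (hs : Function.Surjective g) :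
    ∃ g' : F →ₗ[R] F, IsHomogeneousMap ℱ ℱ g' ∧ g' ∘ₗ g = LinearMap.id := by
  have hi : Function.Injective g := OrzechProperty.injective_of_surjective_endomorphism g hs
  let e := LinearEquiv.ofBijective g ⟨hi, hs⟩
  refine ⟨e.symm, fun n y hy => ?_, LinearMap.ext fun y => e.symm_apply_apply y⟩
  rw [← mem_iff_of_injective (f := g.toAddMonoidHom) hi hℱ.submodule_iSup_eq_top hℱ hg]
  exact (e.apply_symm_apply y).symm ▸ hy

variable {k R : Type u} [Field k] [CommRing R] [Algebra k R]
  {F M : Type*} [AddCommGroup F] [Module k F] [Module R F] [IsScalarTower k R F] [Module.Finite R F]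
  [AddCommGroup M] [Module k M] [Module R M] [IsScalarTower k R M] [Module.Finite R M]
  {𝒜 : ℕ → Submodule k R} {ℱ : ℤ → Submodule k F} {ℳ : ℤ → Submodule k M}
  {L : Type*} [CommRing L] [IsDomain L] [Algebra k L]

theorem exists_surjective_of_injective_baseChange [Infinite k] (hℱ : IsGradedModule 𝒜 ℱ)
    (hfin : ∀ n, Module.Finite k (ℱ n)) {σ ν : Type*} [Fintype ν] {T : ν → F →ₗ[R] F}
    (hT : ∀ i, IsHomogeneousMap ℱ ℱ (T i)) (P : ν → MvPolynomial σ k) (z : σ → L)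
    (hinj : Function.Injective (∑ i, MvPolynomial.aeval z (P i) •
      ((T i).restrictScalars k).baseChange L : Module.End L (L ⊗[k] F))) :
    ∃ z' : σ → k, Function.Surjective (∑ i, MvPolynomial.eval z' (P i) • T i : F →ₗ[R] F) := by
  obtain ⟨s, hs⟩ := hℱ.exists_finset_span_eq_top (A := R)
  let W : Submodule k F := ⨆ n : s, ℱ n
  have map_W (i) : ∀ w ∈ W, (T i).restrictScalars k w ∈ W := by
    have : W ≤ W.comap ((T i).restrictScalars k) := iSup_le fun n w hw =>
      Submodule.mem_iSup_of_mem n (hT i n w hw)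
    exact this
  let T' (i) : Module.End k W := ((T i).restrictScalars k).restrict (map_W i)
  let Θ : Module.End L (L ⊗[k] W) := ∑ i, MvPolynomial.aeval z (P i) • (T' i).baseChange L
  have subtype_inj : Function.Injective (W.subtype.baseChange L) :=
    Module.Flat.lTensor_preserves_injective_linearMap W.subtype W.injective_subtype
  have subtype_comp : W.subtype.baseChange L ∘ₗ Θ = (∑ i, MvPolynomial.aeval z (P i) •
      ((T i).restrictScalars k).baseChange L) ∘ₗ W.subtype.baseChange L := by
    ext w
    simp [Θ, T']
  have Θ_inj : Function.Injective Θ := by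
    refine Function.Injective.of_comp (f := W.subtype.baseChange L) ?_
    rw [← LinearMap.coe_comp, subtype_comp]
    exact hinj.comp subtype_inj
  obtain ⟨z', -, hz'⟩ := exists_bijective_of_injective_baseChange T' P z Θ_inj
  refine ⟨z', ?_⟩
  rw [← LinearMap.range_eq_top, eq_top_iff, ← hs, Submodule.span_le, Set.iUnion₂_subset_iff]
  intro n hn y hy
  obtain ⟨w, hw⟩ := hz' ⟨y, Submodule.mem_iSup_of_mem (⟨n, hn⟩ : s) hy⟩
  refine ⟨w, ?_⟩
  have := congrArg Subtype.val hw
  simpa [T'] using this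

theorem exists_graded_splitting [Infinite k] (hℱ : IsGradedModule 𝒜 ℱ)
    (hfin : ∀ n, Module.Finite k (ℱ n)) {Φ : L ⊗[k] F →ₗ[L] L ⊗[k] M}
    {Ψ : L ⊗[k] M →ₗ[L] L ⊗[k] F}
    (hΦ : IsGradedHom R (fun n => (ℱ n).baseChange L) (fun n => (ℳ n).baseChange L) Φ)
    (hΨ : IsGradedHom R (fun n => (ℳ n).baseChange L) (fun n => (ℱ n).baseChange L) Ψ)
    (hinj : Function.Injective (Ψ ∘ₗ Φ)) :
    ∃ (i : F →ₗ[R] M) (p : M →ₗ[R] F), IsHomogeneousMap ℱ ℳ i ∧ IsHomogeneousMap ℳ ℱ p ∧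
      p ∘ₗ i = LinearMap.id := by
  obtain ⟨J, x, α, hα, rfl⟩ := exists_eq_sum_smul_baseChange hΦ
  obtain ⟨Λ, y, β, hβ, rfl⟩ := exists_eq_sum_smul_baseChange hΨ
  let T (i : Λ × J) : F →ₗ[R] F := β i.1 ∘ₗ α i.2
  let P (i : Λ × J) : MvPolynomial (J ⊕ Λ) k :=
    MvPolynomial.X (Sum.inr i.1) * MvPolynomial.X (Sum.inl i.2)
  obtain ⟨z', hz'⟩ := exists_surjective_of_injective_baseChange hℱ hfin (T := T)
    (fun i n f hf => hβ _ n _ (hα _ n f hf)) P (Sum.elim x y) (by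
      convert hinj using 1
      ext f
      simp [T, P, LinearMap.baseChange_comp, Fintype.sum_prod_type, Finset.smul_sum, mul_smul])
  let i₀ : F →ₗ[R] M := ∑ j, z' (Sum.inl j) • α j
  let p₀ : M →ₗ[R] F := ∑ l, z' (Sum.inr l) • β l
  have hi₀ : IsHomogeneousMap ℱ ℳ i₀ :=
    (gradedHom (R := R) ℱ ℳ).sum_mem fun j _ => Submodule.smul_mem _ _ (hα j)
  have hp₀ : IsHomogeneousMap ℳ ℱ p₀ :=
    (gradedHom (R := R) ℳ ℱ).sum_mem fun l _ => Submodule.smul_mem _ _ (hβ l)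
  have p₀_comp_i₀ : p₀ ∘ₗ i₀ = ∑ i, MvPolynomial.eval z' (P i) • T i := by
    ext f
    simp [i₀, p₀, T, P, Fintype.sum_prod_type, Finset.smul_sum, mul_smul]
  obtain ⟨g, hg, hg_comp⟩ := exists_graded_leftInverse_of_surjective hℱ.isInternal
    (g := p₀ ∘ₗ i₀) (fun n f hf => hp₀ n _ (hi₀ n f hf)) (p₀_comp_i₀ ▸ hz')
  exact ⟨i₀, g ∘ₗ p₀, hi₀, fun n m hm => hg n _ (hp₀ n m hm), hg_comp⟩

end Splitting

section GradedLift

theorem right_smul_mem_baseChange {k R S M : Type*} [CommRing k] [CommRing R] [Algebra k R]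
    [CommRing S] [Algebra k S] [AddCommGroup M] [Module k M] [Module R M] [IsScalarTower k R M]
    {𝒜 : ℕ → Submodule k R} {ℳ : ℤ → Submodule k M} (hℳ : IsGradedModule 𝒜 ℳ) {i : ℕ} {r : R}
    (hr : r ∈ 𝒜 i) {n : ℤ} {z : S ⊗[k] M} (hz : z ∈ (ℳ n).baseChange S) :
    r • z ∈ (ℳ (i + n)).baseChange S :=
  map_mem_of_mem_baseChange (f := (Algebra.lsmul k k M r).baseChange S)
    (fun _ hm => Submodule.tmul_mem_baseChange_of_mem 1 (hℳ.smul_mem hr hm)) hz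

theorem IsGradedModule.right_smul_mem {k R S Q : Type*} [CommRing k] [CommRing R] [Algebra k R]
    [CommRing S] [Algebra k S] [AddCommGroup Q] [Module S Q] [Module R Q] [Module (S ⊗[k] R) Q]
    [IsScalarTower R (S ⊗[k] R) Q] {𝒜 : ℕ → Submodule k R} {𝒬 : ℤ → Submodule S Q}
    (h𝒬 : IsGradedModule (fun i => (𝒜 i).baseChange S) 𝒬) {i : ℕ} {r : R} (hr : r ∈ 𝒜 i) {n : ℤ}
    {q : Q} (hq : q ∈ 𝒬 n) : r • q ∈ 𝒬 (i + n) :=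
  one_tmul_smul (S := S) (k := k) r q ▸
    h𝒬.smul_mem (Submodule.tmul_mem_baseChange_of_mem 1 hr) hq

theorem exists_isGradedHom_of_lift_smul {k R A B B₀ : Type*} [Field k] [CommRing R] [Algebra k R]
    [AddCommGroup A] [Module k⟦X⟧ A] [Module R A] [AddCommGroup B] [Module k⟦X⟧ B] [Module R B]
    [SMulCommClass k⟦X⟧ R B] [AddCommGroup B₀] [Module k B₀] [Module R B₀] [IsScalarTower k R B₀]
    {𝒜 : ℕ → Submodule k R} [GradedAlgebra 𝒜] {𝒮 : ℤ → Submodule k⟦X⟧ A}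
    {𝒯 : ℤ → Submodule k⟦X⟧ B} {ℬ : ℤ → Submodule k B₀}
    (h₀ : ∀ a ∈ 𝒜 0, ∃ c : k, algebraMap k R c = a) (h𝒮 : DirectSum.IsInternal 𝒮)
    (h𝒯 : DirectSum.IsInternal 𝒯) (hℬ : IsGradedModule 𝒜 ℬ)
    (smul_mem : ∀ i, ∀ r ∈ 𝒜 i, ∀ n, ∀ x ∈ 𝒮 n, r • x ∈ 𝒮 (i + n))
    (smul_mem' : ∀ i, ∀ r ∈ 𝒜 i, ∀ n, ∀ y ∈ 𝒯 n, r • y ∈ 𝒯 (i + n))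
    {ρ : B →ₛₗ[PowerSeries.constantCoeff (R := k)] B₀} (hρ : ∀ n, ∀ y ∈ 𝒯 n, ρ y ∈ ℬ n)
    {φ : A →ₛₗ[PowerSeries.constantCoeff (R := k)] B₀} (hφ : ∀ n, ∀ x ∈ 𝒮 n, φ x ∈ ℬ n)
    {a : R} (ha : a ∉ (HomogeneousIdeal.irrelevant 𝒜).toIdeal) {g : A →ₗ[k⟦X⟧] B}
    (hg : ∀ (r : R) x, g (r • x) = r • g x) (hgφ : ∀ x, ρ (g x) = a • φ x) :
    ∃ g' : A →ₗ[k⟦X⟧] B, IsGradedHom R 𝒮 𝒯 g' ∧ ∀ x, ρ (g' x) = φ x := by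
  obtain ⟨c, hc⟩ := h₀ _ (SetLike.coe_mem (DirectSum.decompose 𝒜 a 0))
  have c_ne_zero : c ≠ 0 := by
    rintro rfl
    exact ha ((HomogeneousIdeal.mem_irrelevant_iff 𝒜 a).2 (hc.symm.trans (map_zero _)))
  refine ⟨PowerSeries.C c⁻¹ • degreeZeroPart h𝒮 h𝒯 g,
    (isGradedHom_degreeZeroPart h𝒮 h𝒯 smul_mem smul_mem' hg).const_smul _, fun x => ?_⟩
  refine homogeneous_induction (P := fun x =>
    ρ ((PowerSeries.C c⁻¹ • degreeZeroPart h𝒮 h𝒯 g) x) = φ x) h𝒮.submodule_iSup_eq_top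
    (fun n x hx => ?_) (by simp only [map_zero])
    (fun x y hx hy => by rw [map_add, map_add, hx, hy, map_add]) x
  rw [LinearMap.smul_apply, map_smulₛₗ, PowerSeries.constantCoeff_C,
    degreeZeroPart_apply h𝒮 h𝒯 g hx]
  have := proj_comp_of_graded h𝒯 hℬ.isInternal (f := ρ.toAddMonoidHom) hρ n (g x)
  simp only [LinearMap.toAddMonoidHom_coe] at this
  rw [← this, hgφ, hℬ.proj_smul_of_mem (hφ n x hx), ← hc, algebraMap_smul, smul_smul,
    inv_mul_cancel₀ c_ne_zero, one_smul]

end GradedLift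

section GradedSection

variable {k R M N F Q : Type u} [Field k] [CommRing R] [Algebra k R]
  [AddCommGroup M] [Module k M] [Module R M] [IsScalarTower k R M]
  [AddCommGroup N] [Module k N] [Module R N] [IsScalarTower k R N]
  [AddCommGroup F] [Module k F] [Module R F] [IsScalarTower k R F]
  [AddCommGroup Q] [Module k⟦X⟧ Q] [Module R Q] [Module (k⟦X⟧ ⊗[k] R) Q]
  [IsScalarTower k⟦X⟧ (k⟦X⟧ ⊗[k] R) Q] [IsScalarTower R (k⟦X⟧ ⊗[k] R) Q]
  {𝒜 : ℕ → Submodule k R} [GradedAlgebra 𝒜] {ℳ : ℤ → Submodule k M} {𝒩 : ℤ → Submodule k N}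
  {ℱ : ℤ → Submodule k F} {𝒬 : ℤ → Submodule k⟦X⟧ Q}
  {π : Q →ₛₗ[PowerSeries.constantCoeff (R := k)] N × F} {ι : Q →ₗ[k⟦X⟧] Loc k ⊗[k] M}

namespace IsDegeneration

theorem exists_graded_projection_lift [IsNoetherianRing (k⟦X⟧ ⊗[k] R)]
    [Module.Finite (k⟦X⟧ ⊗[k] R) Q] [Module.Finite R F] [Module.Free R F]
    [(HomogeneousIdeal.irrelevant 𝒜).toIdeal.IsPrime]
    (h : IsDegeneration R ℳ (prodGrading 𝒩 ℱ) 𝒬 π ι)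
    (h₀ : ∀ a ∈ 𝒜 0, ∃ c : k, algebraMap k R c = a)
    (h𝒬 : IsGradedModule (fun i => (𝒜 i).baseChange k⟦X⟧) 𝒬) (hℱ : IsGradedModule 𝒜 ℱ)
    (hext : ∀ (m : ℕ) (g : (Fin m → R) →ₗ[R] N × F), Function.Surjective g →
      ∀ φ : LinearMap.ker g →ₗ[R] R, ∃ u ∉ (HomogeneousIdeal.irrelevant 𝒜).toIdeal,
        ∃ ψ : (Fin m → R) →ₗ[R] R, ∀ z : LinearMap.ker g, ψ z = u * φ z) :
    ∃ H : Q →ₗ[k⟦X⟧] k⟦X⟧ ⊗[k] F, IsGradedHom R 𝒬 (fun n => (ℱ n).baseChange k⟦X⟧) H ∧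
      ∀ q, reduction k F (H q) = (π q).2 := by
  obtain ⟨H, a, ha, hH, hHπ⟩ := h.exists_projection_lift _ hext
  exact exists_isGradedHom_of_lift_smul (φ := (LinearMap.snd k N F).comp π) h₀ h𝒬.isInternal
    hℱ.isInternal.baseChange hℱ (fun i r hr n q hq => h𝒬.right_smul_mem hr hq)
    (fun i r hr n z hz => right_smul_mem_baseChange hℱ hr hz)
    (isDegeneration_constant (R := R) ℱ).special.map_mem
    (fun n q hq => (h.special.map_mem n q hq).2) ha hH hHπ

theorem exists_graded_inclusion_lift [Module.Finite R F] [Module.Free R F]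
    [(HomogeneousIdeal.irrelevant 𝒜).toIdeal.IsPrime]
    (h : IsDegeneration R ℳ (prodGrading 𝒩 ℱ) 𝒬 π ι)
    (h₀ : ∀ a ∈ 𝒜 0, ∃ c : k, algebraMap k R c = a)
    (h𝒬 : IsGradedModule (fun i => (𝒜 i).baseChange k⟦X⟧) 𝒬) (h𝒩 : IsGradedModule 𝒜 𝒩)
    (hℱ : IsGradedModule 𝒜 ℱ) :
    ∃ f : k⟦X⟧ ⊗[k] F →ₗ[k⟦X⟧] Q, IsGradedHom R (fun n => (ℱ n).baseChange k⟦X⟧) 𝒬 f ∧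
      ∀ z, π (f z) = (0, reduction k F z) := by
  have : SMulCommClass k⟦X⟧ R Q := smulCommClass_of_isScalarTower (k := k)
  have h𝒩ℱ : IsGradedModule 𝒜 (prodGrading 𝒩 ℱ) :=
    ⟨isInternal_prodGrading h𝒩.isInternal hℱ.isInternal,
      fun _ _ _ _ ha hx => ⟨h𝒩.smul_mem ha hx.1, hℱ.smul_mem ha hx.2⟩⟩
  obtain ⟨f, hf, hfπ⟩ := h.exists_inclusion_lift
  exact exists_isGradedHom_of_lift_smul (φ := (LinearMap.inr k N F).comp (reduction k F)) h₀
    hℱ.isInternal.baseChange h𝒬.isInternal h𝒩ℱ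
    (fun i r hr n z hz => right_smul_mem_baseChange hℱ hr hz)
    (fun i r hr n q hq => h𝒬.right_smul_mem hr hq) h.special.map_mem
    (fun n z hz => ⟨zero_mem _, (isDegeneration_constant (R := R) ℱ).special.map_mem n z hz⟩)
    ((Ideal.ne_top_iff_one _).1 Ideal.IsPrime.ne_top') hf fun z => by rw [one_smul, hfπ]; rfl

end IsDegeneration

end GradedSection

section Reduction

variable {k F : Type*} [Field k] [AddCommGroup F] [Module k F]

theorem eq_zero_of_forall_exists_eq_X_pow_smul {z : k⟦X⟧ ⊗[k] F}
    (hz : ∀ n : ℕ, ∃ w, z = (PowerSeries.X : k⟦X⟧) ^ n • w) : z = 0 := by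
  let b := Module.Free.chooseBasis k⟦X⟧ (k⟦X⟧ ⊗[k] F)
  rw [← map_eq_zero_iff b.repr b.repr.injective]
  ext j m
  obtain ⟨w, hw⟩ := hz (m + 1)
  rw [hw, map_smul, Finsupp.smul_apply, smul_eq_mul, PowerSeries.coeff_X_pow_mul']
  simp

theorem injective_of_reduction_comp {θ : k⟦X⟧ ⊗[k] F →ₗ[k⟦X⟧] k⟦X⟧ ⊗[k] F}
    (hθ : ∀ z, reduction k F (θ z) = reduction k F z) : Function.Injective θ := by
  have regular := Module.Flat.isSMulRegular_of_nonZeroDivisors (M := k⟦X⟧ ⊗[k] F)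
    (mem_nonZeroDivisors_of_ne_zero (PowerSeries.X_ne_zero (R := k)))
  rw [injective_iff_map_eq_zero]
  intro z hz
  have divisible (n : ℕ) : ∃ w, z = (PowerSeries.X : k⟦X⟧) ^ n • w ∧ θ w = 0 := by
    induction n with
    | zero => exact ⟨z, by rw [pow_zero, one_smul], hz⟩
    | succ n ih =>
      obtain ⟨w, rfl, hw⟩ := ih
      obtain ⟨w', hw'⟩ := exists_eq_one_tmul_reduction_add w
      rw [← hθ, hw, map_zero, TensorProduct.tmul_zero, zero_add] at hw'
      subst hw'
      refine ⟨w', by rw [smul_smul, ← pow_succ], regular ?_⟩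
      simpa only [map_smul, smul_zero] using hw
  exact eq_zero_of_forall_exists_eq_X_pow_smul fun n => (divisible n).imp fun _ hw => hw.1

end Reduction

section Splitting

variable {k R M N F Q : Type u} [Field k] [CommRing R] [Algebra k R]
  [AddCommGroup M] [Module k M] [Module R M] [IsScalarTower k R M]
  [AddCommGroup N] [Module k N] [Module R N] [AddCommGroup Q] [Module k⟦X⟧ Q] [Module R Q]
  [AddCommGroup F] [Module k F] [Module R F] [IsScalarTower k R F]
  {𝒜 : ℕ → Submodule k R} {ℳ : ℤ → Submodule k M} {𝒩 : ℤ → Submodule k N}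
  {ℱ : ℤ → Submodule k F} {𝒬 : ℤ → Submodule k⟦X⟧ Q}
  {π : Q →ₛₗ[PowerSeries.constantCoeff (R := k)] N} {ι : Q →ₗ[k⟦X⟧] Loc k ⊗[k] M}

namespace IsDegeneration

theorem injective_of_comp_generic (h : IsDegeneration R ℳ 𝒩 𝒬 π ι) {T : Type*} [AddCommGroup T]
    [Module (Loc k) T] {Θ : Loc k ⊗[k] M →ₗ[Loc k] T}
    (hΘ : Function.Injective fun q => Θ (ι q)) : Function.Injective Θ := by
  rw [injective_iff_map_eq_zero]
  intro z hz
  obtain ⟨n, q, hq⟩ := h.generic_surj z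
  have q_eq_zero : q = 0 := hΘ (by
    simp only [hq, map_zero]
    rw [← algebraMap_smul (Loc k), map_smul, hz, smul_zero])
  refine (X_pow_smul_bijective (k := k) n).injective ?_
  simp only [← hq, q_eq_zero, map_zero, smul_zero]

theorem exists_graded_splitting [Infinite k] [Module.Finite R F] [Module.Finite R M]
    (h : IsDegeneration R ℳ 𝒩 𝒬 π ι) (h𝒬 : iSup 𝒬 = ⊤)
    (hℳ : DirectSum.IsInternal ℳ) (hℱ : IsGradedModule 𝒜 ℱ) (hfin : ∀ n, Module.Finite k (ℱ n))
    {f : k⟦X⟧ ⊗[k] F →ₗ[k⟦X⟧] Q} (hf : IsGradedHom R (fun n => (ℱ n).baseChange k⟦X⟧) 𝒬 f)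
    {H : Q →ₗ[k⟦X⟧] k⟦X⟧ ⊗[k] F} (hH : IsGradedHom R 𝒬 (fun n => (ℱ n).baseChange k⟦X⟧) H)
    (hHf : ∀ z, reduction k F (H (f z)) = reduction k F z) :
    ∃ (i : F →ₗ[R] M) (p : M →ₗ[R] F), IsHomogeneousMap ℱ ℳ i ∧ IsHomogeneousMap ℳ ℱ p ∧
      p ∘ₗ i = LinearMap.id := by
  have hC := isDegeneration_constant (R := R) ℱ
  have hℱV : iSup (fun n => (ℱ n).baseChange k⟦X⟧) = ⊤ :=
    hℱ.isInternal.baseChange.submodule_iSup_eq_top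
  obtain ⟨Φ, hΦ, Φ_loc⟩ :=
    hC.exists_generic_extension hℱV hℱ.isInternal (f := ι ∘ₗ f) (h.generic.comp hf)
  obtain ⟨Ψ, hΨ, Ψ_ι⟩ :=
    h.exists_generic_extension h𝒬 hℳ (f := localization k F ∘ₗ H) (hC.generic.comp hH)
  have : IsDomain (Loc k) := IsLocalization.isDomain_localization
    (powers_le_nonZeroDivisors_of_noZeroDivisors PowerSeries.X_ne_zero)
  have Hf_injective : Function.Injective (H ∘ₗ f) := injective_of_reduction_comp hHf
  refine GradedDegeneration.exists_graded_splitting hℱ hfin hΦ hΨ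
    (hC.injective_of_comp_generic fun z w hzw => Hf_injective (hC.generic_injective ?_))
  simpa only [LinearMap.comp_apply, Φ_loc, Ψ_ι] using hzw

end IsDegeneration

end Splitting

section FreeCancellation

variable {k R M N F : Type u} [Field k] [CommRing R] [Algebra k R]
  [AddCommGroup F] [Module R F] [AddCommGroup M] [Module k M] [Module R M] [IsScalarTower k R M]
  [AddCommGroup N] [Module R N] {𝒜 : ℕ → Submodule k R} {ℳ : ℤ → Submodule k M}

theorem isPrime_irrelevant [Nontrivial R] [GradedAlgebra 𝒜]
    (h₀ : ∀ a ∈ 𝒜 0, ∃ c : k, algebraMap k R c = a) :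
    (HomogeneousIdeal.irrelevant 𝒜).toIdeal.IsPrime := by
  have mem_iff (a : R) : a ∈ (HomogeneousIdeal.irrelevant 𝒜).toIdeal ↔
      GradedRing.projZeroRingHom 𝒜 a = 0 := HomogeneousIdeal.mem_irrelevant_iff 𝒜 a
  refine ⟨(Ideal.ne_top_iff_one _).2 ?_, fun {a b} hab => ?_⟩
  · rw [mem_iff, map_one]
    exact one_ne_zero
  · rw [mem_iff, map_mul] at hab
    rw [mem_iff, mem_iff]
    obtain ⟨c, hc⟩ := h₀ (GradedRing.projZeroRingHom 𝒜 a) (SetLike.coe_mem _)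
    rw [← hc] at hab ⊢
    obtain rfl | hc₀ := eq_or_ne c 0
    · exact Or.inl (map_zero _)
    · exact Or.inr (((IsUnit.mk0 c hc₀).map (algebraMap k R)).mul_right_eq_zero.1 hab)

theorem exists_extension_of_isGorenstein [IsNoetherianRing R] [GradedAlgebra 𝒜]
    [(HomogeneousIdeal.irrelevant 𝒜).toIdeal.IsPrime] (hR : IsGorenstein R)
    [Module.Finite R N] (hN : IsGradedCM 𝒜 N) [Module.Projective R F] (m : ℕ)
    (g : (Fin m → R) →ₗ[R] N × F) (hg : Function.Surjective g) (φ : LinearMap.ker g →ₗ[R] R) :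
    ∃ u ∉ (HomogeneousIdeal.irrelevant 𝒜).toIdeal, ∃ ψ : (Fin m → R) →ₗ[R] R,
      ∀ z : LinearMap.ker g, ψ z = u * φ z := by
  obtain ⟨n, hn⟩ := hR (HomogeneousIdeal.irrelevant 𝒜).toIdeal
  have ext_N := subsingleton_ext_localized_of_depth _ hn hN
  have ext_prod := subsingleton_ext_prod_projective (F := F) _ _ ext_N
  have := Module.finitePresentation_of_finite R (Fin m → R)
  obtain ⟨ψ, hψ⟩ := exists_localized_extension _ ext_prod hg φ
  exact exists_extension_of_localized_extension _ _ φ ψ hψ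

theorem isInternal_quotientGrading [Module k F] {ℱ : ℤ → Submodule k F}
    (hℳ : DirectSum.IsInternal ℳ) {i : F →ₗ[R] M} {p : M →ₗ[R] F} (hi : IsHomogeneousMap ℱ ℳ i)
    (hp : IsHomogeneousMap ℳ ℱ p) (hpi : p ∘ₗ i = LinearMap.id) :
    DirectSum.IsInternal (quotientGrading ℳ (LinearMap.range i)) := by
  let s : (M ⧸ LinearMap.range i) →ₗ[R] M :=
    (LinearMap.range i).liftQ (LinearMap.id - i ∘ₗ p) (by
      rintro _ ⟨y, rfl⟩
      have := LinearMap.congr_fun hpi y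
      rw [LinearMap.comp_apply, LinearMap.id_apply] at this
      rw [LinearMap.mem_ker, LinearMap.sub_apply, LinearMap.comp_apply, this, LinearMap.id_apply,
        sub_self])
  refine isInternal_of_injective s.toAddMonoidHom ?_ ?_ hℳ ?_
  · refine (injective_iff_map_eq_zero s).2 fun z hz => ?_
    obtain ⟨m, rfl⟩ := (LinearMap.range i).mkQ_surjective z
    have hm : m = i (p m) := sub_eq_zero.1 hz
    exact (Submodule.Quotient.mk_eq_zero _).2 ⟨p m, hm.symm⟩
  · change ⨆ n, (ℳ n).map ((LinearMap.range i).mkQ.restrictScalars k) = ⊤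
    rw [← Submodule.map_iSup, hℳ.submodule_iSup_eq_top, Submodule.map_top, LinearMap.range_eq_top]
    exact (LinearMap.range i).mkQ_surjective
  · rintro n _ ⟨m, hm, rfl⟩
    exact sub_mem hm (hi n _ (hp n m hm))

theorem Degenerates.cancel_free [Infinite k] [Nontrivial R] [IsNoetherianRing R] [GradedAlgebra 𝒜]
    [Module k N] [IsScalarTower k R N] [Module k F] [IsScalarTower k R F] [Module.Finite R M]
    [Module.Finite R N] [Module.Finite R F] [Module.Free R F] {𝒩 : ℤ → Submodule k N}
    {ℱ : ℤ → Submodule k F} (h₀ : ∀ a ∈ 𝒜 0, ∃ c : k, algebraMap k R c = a)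
    (hR : IsGorenstein R) (hN : IsGradedCM 𝒜 N) (hℳ : IsGradedModule 𝒜 ℳ)
    (h𝒩 : IsGradedModule 𝒜 𝒩) (hℱ : IsGradedModule 𝒜 ℱ)
    (h : Degenerates 𝒜 ℳ (prodGrading 𝒩 ℱ)) :
    (∃ (i : F →ₗ[R] M) (p : M →ₗ[R] F), IsHomogeneousMap ℱ ℳ i ∧ IsHomogeneousMap ℳ ℱ p ∧
      p ∘ₗ i = LinearMap.id) ∧
    ∀ (i : F →ₗ[R] M) (p : M →ₗ[R] F), IsHomogeneousMap ℱ ℳ i → IsHomogeneousMap ℳ ℱ p →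
      p ∘ₗ i = LinearMap.id → Degenerates 𝒜 (quotientGrading ℳ (LinearMap.range i)) 𝒩 := by
  obtain ⟨Q, _, _, _, _, _, _, 𝒬, π, ι, h𝒬, _, h⟩ := h.exists_isDegeneration
  have : SMulCommClass k⟦X⟧ R Q := smulCommClass_of_isScalarTower (k := k)
  have := isNoetherianRing_powerSeries_tensor 𝒜 h₀
  have := isPrime_irrelevant h₀
  have hfin := finite_piece h₀ hℱ
  obtain ⟨f, hf, hfπ⟩ := h.exists_graded_inclusion_lift h₀ h𝒬 h𝒩 hℱ
  refine ⟨?_, fun i p hi hp hpi => ?_⟩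
  · obtain ⟨H, hH, hHπ⟩ := h.exists_graded_projection_lift h₀ h𝒬 hℱ
      (exists_extension_of_isGorenstein hR hN)
    exact h.exists_graded_splitting h𝒬.isInternal.submodule_iSup_eq_top hℳ.isInternal hℱ hfin hf hH
      fun z => by rw [hHπ, hfπ]
  · exact h.cancel h𝒬 hℳ.isInternal h𝒩.isInternal hℱ
      (isInternal_quotientGrading hℳ.isInternal hi hp hpi) hfin hi hp
      (c := (LinearMap.range i).mkQ) (fun n m hm => ⟨m, hm, rfl⟩) hpi
      (Submodule.mkQ_surjective _) (LinearMap.exact_map_mkQ_range i) hf hfπ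

end FreeCancellation

end GradedDegeneration

open GradedDegeneration in
theorem lemma3p9_general {k R : Type u} [Field k] [CommRing R] [Nontrivial R] [IsNoetherianRing R]
    [Algebra k R] (𝒜 : ℕ → Submodule k R) [GradedAlgebra 𝒜]
    (h𝒜₀ : (𝒜 0 : Set R) = Set.range (algebraMap k R)) {M N : Type u}
    [AddCommGroup M] [Module k M] [Module R M] [IsScalarTower k R M] [Module.Finite R M]
    [AddCommGroup N] [Module k N] [Module R N] [IsScalarTower k R N] [Module.Finite R N]
    (ℳ : ℤ → Submodule k M) (𝒩 : ℤ → Submodule k N)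
    (hℳ : IsGradedModule 𝒜 ℳ) (h𝒩 : IsGradedModule 𝒜 𝒩) :
    (∀ (X : Type u) [AddCommGroup X] [Module k X] [Module R X] [IsScalarTower k R X]
        [Module.Finite R X] (𝒳 : ℤ → Submodule k X), IsGradedModule 𝒜 𝒳 →
      homDim R 𝒳 ℳ = homDim R 𝒳 𝒩 → Degenerates 𝒜 (prodGrading ℳ 𝒳) (prodGrading 𝒩 𝒳) →
      Degenerates 𝒜 ℳ 𝒩) ∧
    (∀ [Infinite k], IsGorenstein R → IsGradedCM 𝒜 N →
      ∀ (F : Type u) [AddCommGroup F] [Module k F] [Module R F] [IsScalarTower k R F]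
        [Module.Finite R F] [Module.Free R F] (ℱ : ℤ → Submodule k F), IsGradedModule 𝒜 ℱ →
      Degenerates 𝒜 ℳ (prodGrading 𝒩 ℱ) →
      (∃ (i : F →ₗ[R] M) (p : M →ₗ[R] F), IsHomogeneousMap ℱ ℳ i ∧ IsHomogeneousMap ℳ ℱ p ∧
        p ∘ₗ i = LinearMap.id) ∧
      ∀ (i : F →ₗ[R] M) (p : M →ₗ[R] F), IsHomogeneousMap ℱ ℳ i → IsHomogeneousMap ℳ ℱ p →
        p ∘ₗ i = LinearMap.id → Degenerates 𝒜 (quotientGrading ℳ (LinearMap.range i)) 𝒩) := by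
  have h₀ (a : R) (ha : a ∈ 𝒜 0) : ∃ c : k, algebraMap k R c = a := h𝒜₀.subset ha
  exact ⟨fun X _ _ _ _ _ 𝒳 h𝒳 hdim h => h.cancel h₀ hℳ h𝒩 h𝒳 hdim,
    fun hR hN F _ _ _ _ _ _ ℱ hℱ h => h.cancel_free h₀ hR hN hℳ h𝒩 hℱ⟩

theorem lemma3p9 {k R : Type u} [Field k] [CharZero k]
    [CommRing R] [Nontrivial R] [IsNoetherianRing R] [Algebra k R]
    (𝒜 : ℕ → Submodule k R) [GradedAlgebra 𝒜]
    (h𝒜₀ : (𝒜 0 : Set R) = Set.range (algebraMap k R))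
    (hCM : GradedDegeneration.IsGradedCM 𝒜 R)
    {M N : Type u}
    [AddCommGroup M] [Module k M] [Module R M] [IsScalarTower k R M] [Module.Finite R M]
    [AddCommGroup N] [Module k N] [Module R N] [IsScalarTower k R N] [Module.Finite R N]
    (ℳ : ℤ → Submodule k M) (𝒩 : ℤ → Submodule k N)
    (hℳ : GradedDegeneration.IsGradedModule 𝒜 ℳ)
    (h𝒩 : GradedDegeneration.IsGradedModule 𝒜 𝒩) :
    (∀ (X : Type u) [AddCommGroup X] [Module k X] [Module R X] [IsScalarTower k R X]
        [Module.Finite R X] (𝒳 : ℤ → Submodule k X),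
      GradedDegeneration.IsGradedModule 𝒜 𝒳 →
      GradedDegeneration.homDim R 𝒳 ℳ = GradedDegeneration.homDim R 𝒳 𝒩 →
      GradedDegeneration.Degenerates 𝒜
        (GradedDegeneration.prodGrading ℳ 𝒳) (GradedDegeneration.prodGrading 𝒩 𝒳) →
      GradedDegeneration.Degenerates 𝒜 ℳ 𝒩) ∧
    (GradedDegeneration.IsGorenstein R →
      GradedDegeneration.IsGradedCM 𝒜 M → GradedDegeneration.IsGradedCM 𝒜 N →
      ∀ (F : Type u) [AddCommGroup F] [Module k F] [Module R F] [IsScalarTower k R F]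
        [Module.Finite R F] (ℱ : ℤ → Submodule k F),
      GradedDegeneration.IsGradedModule 𝒜 ℱ →
      GradedDegeneration.IsGradedFree R ℱ →
      GradedDegeneration.Degenerates 𝒜 ℳ (GradedDegeneration.prodGrading 𝒩 ℱ) →
      (∃ (i : F →ₗ[R] M) (p : M →ₗ[R] F),
        GradedDegeneration.IsHomogeneousMap ℱ ℳ i ∧
        GradedDegeneration.IsHomogeneousMap ℳ ℱ p ∧ p ∘ₗ i = LinearMap.id) ∧
      (∀ (i : F →ₗ[R] M) (p : M →ₗ[R] F),
        GradedDegeneration.IsHomogeneousMap ℱ ℳ i →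
        GradedDegeneration.IsHomogeneousMap ℳ ℱ p → p ∘ₗ i = LinearMap.id →
        GradedDegeneration.Degenerates 𝒜
          (GradedDegeneration.quotientGrading ℳ (LinearMap.range i)) 𝒩)) :=
  ⟨(lemma3p9_general 𝒜 h𝒜₀ ℳ 𝒩 hℳ h𝒩).1, fun hR _ hN F _ _ _ _ _ ℱ hℱ ⟨_, b, _⟩ h =>
    have := Module.Free.of_basis b
    (lemma3p9_general 𝒜 h𝒜₀ ℳ 𝒩 hℳ h𝒩).2 hR hN F ℱ hℱ h⟩
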